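/- **Lemma 3 (almost-monotonicity formula).** Let $d\in\{2,3\}$, and let $\phi\colon[0,\infty)\to\mathbb R$ and $p\in(1,2)$ satisfy: (H1) $\phi\in C^1[0,\infty)\cap C^2(0,\infty)$; (H2) $\phi(0)=\phi'(0)=0$ and $\phi''(t)>0$ for all $t>0$; (H3) there are $0<c_0\le c_1$ with $c_0\phi'(t)\le\phi''(t)\,t\le c_1\phi'(t)$ for all $t\ge0$; (H4) $\sup_{t\ge0}\left(\phi'(t)t-p\,\phi(t)\right)<+\infty$; (H5) there are $c$ and $\beta>0$ with $|\phi''(s+t)-\phi''(t)|\le c\,\phi''(t)\,(|s|/t)^\beta$ for all $t>0$ and $s\in\mathbb R$ with $|s|<t/2$. Set $\xi(t):=\phi'(t)t-p\,\phi(t)$ for $t\ge 0$. Then there is a constant $M>0$, depending only on $d$, $\phi$ and $p$, with the following property. Let $\Omega\subset\mathbb R^d$ be a bounded domain with smooth boundary, let $A,B,C,L>0$, and let $S_0$ be the space of symmetric traceless real $3\times3$ matrices, with $|Q|^2=\operatorname{tr}Q^2$. Let $$f_B(Q)=-\tfrac A2\operatorname{tr}Q^2-\tfrac B3\operatorname{tr}Q^3+\tfrac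 C4(\operatorname{tr}Q^2)^2+\text{const},$$ the constant being such that $\min_{S_0}f_B=0$. Let $W^{1,\phi}(\Omega)$ be the space of maps $Q$ with distributional gradient $\nabla Q$ such that $\int_\Omega\phi(|Q|)<\infty$ and $\int_\Omega\phi(|\nabla Q|)<\infty$. Let $Q_b\in W^{1,\phi}(\Omega)$ take its values a.e. in $$\left\{s_+\left(n\otimes n-\tfrac13 I\right):\ n\in\mathbb R^3,\ |n|=1\right\},\qquad s_+=\frac{B+\sqrt{B^2+24AC}}{4C},$$ and let $\mathcal A$ be the set of all $Q\in W^{1,\phi}(\Omega;S_0)$ with $f_B(Q)\in L^1(\Omega)$ and $Q=Q_b$ on $\partial\Omega$ (that is, $Q-Q_b\in W^{1,\phi}_0(\Omega)$). Put $e_L(Q):=\phi(|\nabla Q|)+\frac1Lf_B(Q)$, and let $Q_L\in\mathcal A$ be a minimizer of $I_{mod}[Q]=\int_\Omega e_L(Q)\,dV$ in $\mathcal A$. For $B(x_0,r)\subset\Omega$ let $$\mathcal F_L(Q_L,x_0,r):=\frac1{r^{d-p}}\int_{B(x_0,r)}e_L(Q_L)\,dV .$$ Then, for every $x_0\in\Omega$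 and all $0<r\le R$ with $B(x_0,R)\subset\Omega$, the integrals below converge and $$\mathcal F_L(Q_L,x_0,r)\ \le\ \mathcal F_L(Q_L,x_0,R)+\int_r^R\left(\rho^{p-d-1}\int_{B(x_0,\rho)}\xi(|\nabla Q_L|)\,dV\right)d\rho\ \le\ \mathcal F_L(Q_L,x_0,R)+M\,(R^p-r^p).$$ -/

import Mathlib

open MeasureTheory Set Filter
open scoped ContDiff Topology

namespace LdG

noncomputable section

/-- Points of `ℝᵈ`, with the Euclidean norm. -/
abbrev Pt (d : ℕ) : Type := EuclideanSpace ℝ (Fin d)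

/-- Real `3 × 3` matrices. -/
abbrev Mat : Type := Matrix (Fin 3) (Fin 3) ℝ

/-- The `k`-th vector of the standard basis of `ℝᵈ`. -/
def stdVec {d : ℕ} (k : Fin d) : Pt d := EuclideanSpace.single k (1 : ℝ)

/-- Bounded domain with smooth boundary: open, connected, bounded, and near each boundary point
it is the set where a smooth function without critical points is negative. -/
structure IsBoundedSmoothDomain {d : ℕ} (Ω : Set (Pt d)) : Prop where
  isOpen : IsOpen Ω
  isConnected : IsConnected Ω
  isBounded : Bornology.IsBounded Ω
  smooth_boundary : ∀ x ∈ frontier Ω, ∃ (U : Set (Pt d)) (g : Pt d → ℝ),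
    IsOpen U ∧ x ∈ U ∧ ContDiffOn ℝ ∞ g U ∧ (∀ y ∈ U, fderiv ℝ g y ≠ 0) ∧
      Ω ∩ U = {y ∈ U | g y < 0}

/-! ### The elastic energy density -/

/-- `φ'` on `[0, ∞)`; the derivative at `0` is one-sided. -/
def dphi (φ : ℝ → ℝ) (t : ℝ) : ℝ := derivWithin φ (Ici 0) t

/-- `φ''` on `(0, ∞)`. -/
def ddphi (φ : ℝ → ℝ) (t : ℝ) : ℝ := deriv (dphi φ) t

/-- `ξ(t) = φ'(t) t - p φ(t)`. -/
def xi (φ : ℝ → ℝ) (p t : ℝ) : ℝ := dphi φ t * t - p * φ t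

/-- The assumptions on the elastic energy density `φ : [0, ∞) → ℝ` (only the values of the
function `φ : ℝ → ℝ` on `[0, ∞)` matter) and on the exponent `p`. In `charact`, the value of `φ''`
at `t = 0` plays no role, since it is multiplied by `t`. -/
structure IsElasticDensity (φ : ℝ → ℝ) (p : ℝ) : Prop where
  contDiff_one : ContDiffOn ℝ 1 φ (Ici 0)
  contDiff_two : ContDiffOn ℝ 2 φ (Ioi 0)
  map_zero : φ 0 = 0
  deriv_zero : dphi φ 0 = 0
  deriv_two_pos : ∀ t, 0 < t → 0 < ddphi φ t
  charact : ∃ c₀ c₁ : ℝ, 0 < c₀ ∧ c₀ ≤ c₁ ∧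
    ∀ t, 0 ≤ t → c₀ * dphi φ t ≤ ddphi φ t * t ∧ ddphi φ t * t ≤ c₁ * dphi φ t
  one_lt_p : 1 < p
  p_lt_two : p < 2
  subquadratic : BddAbove (xi φ p '' Ici 0)
  holder : ∃ c β : ℝ, 0 < β ∧ ∀ t s : ℝ, 0 < t → |s| < t / 2 →
    |ddphi φ (s + t) - ddphi φ t| ≤ c * ddphi φ t * (|s| / t) ^ β

/-! ### `Q`-tensors and the bulk potential -/

/-- The symmetric, traceless `3 × 3` matrices. -/
def S0 : Set Mat := {P | P.transpose = P ∧ P.trace = 0}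

/-- The bulk potential, up to an additive constant. -/
def bulk₀ (A B C : ℝ) (P : Mat) : ℝ :=
  -(A / 2) * (P * P).trace - B / 3 * (P * P * P).trace + C / 4 * (P * P).trace ^ 2

/-- The bulk potential `f_B`, normalised so that its minimum over `S0` is zero (for `C > 0` the
function `bulk₀ A B C` is bounded below on `S0` and attains its infimum there). -/
def bulk (A B C : ℝ) (P : Mat) : ℝ := bulk₀ A B C P - sInf (bulk₀ A B C '' S0)

/-- The optimal scalar order parameter. -/
def sPlus (A B C : ℝ) : ℝ := (B + √(B ^ 2 + 24 * A * C)) / (4 * C)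

/-- The vacuum manifold `{ s₊ (n ⊗ n - I/3) : |n| = 1 }`. -/
def vacuum (A B C : ℝ) : Set Mat :=
  {P | ∃ n : EuclideanSpace ℝ (Fin 3), ‖n‖ = 1 ∧
    P = sPlus A B C • (Matrix.of (fun i j => n i * n j) - (1 / 3 : ℝ) • (1 : Mat))}

/-- The Euclidean (Frobenius) norm of a matrix. -/
def frob (P : Mat) : ℝ := √(∑ i, ∑ j, P i j ^ 2)

/-- The Euclidean norm of a gradient `(∂ₖ Qᵢⱼ)`. -/
def gradNorm {d : ℕ} (G : Fin d → Mat) : ℝ := √(∑ k, ∑ i, ∑ j, G k i j ^ 2)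

/-! ### Orlicz-Sobolev maps -/

/-- `G = (∂ₖ Qᵢⱼ)` is a weak (distributional) gradient of `Q` in `Ω`. -/
def IsWeakGrad {d : ℕ} (Ω : Set (Pt d)) (Q : Pt d → Mat) (G : Pt d → Fin d → Mat) : Prop :=
  ∀ i j : Fin 3, LocallyIntegrableOn (fun x => Q x i j) Ω volume ∧
    ∀ k : Fin d, LocallyIntegrableOn (fun x => G x k i j) Ω volume ∧
      ∀ η : Pt d → ℝ, ContDiff ℝ ∞ η → HasCompactSupport η → tsupport η ⊆ Ω →
        ∫ x in Ω, Q x i j * fderiv ℝ η x (stdVec k) = -∫ x in Ω, G x k i j * η x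

open Classical in
/-- The weak gradient of `Q` in `Ω` (it is unique up to null sets when it exists; it is set
to zero when it does not exist). -/
def weakGrad {d : ℕ} (Ω : Set (Pt d)) (Q : Pt d → Mat) : Pt d → Fin d → Mat :=
  if h : ∃ G, IsWeakGrad Ω Q G then h.choose else 0

/-- `Q ∈ W^{1,φ}(Ω; M^{3×3})`. -/
structure MemW1phi {d : ℕ} (Ω : Set (Pt d)) (φ : ℝ → ℝ) (Q : Pt d → Mat) : Prop where
  exists_weakGrad : ∃ G, IsWeakGrad Ω Q G
  integrable_self : IntegrableOn (fun x => φ (frob (Q x))) Ω volume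
  integrable_grad : IntegrableOn (fun x => φ (gradNorm (weakGrad Ω Q x))) Ω volume

/-- The classical gradient `(∂ₖ wᵢⱼ)` of a smooth map. -/
def classicalGrad {d : ℕ} (w : Pt d → Mat) (x : Pt d) (k : Fin d) : Mat :=
  Matrix.of (fun i j => fderiv ℝ (fun y => w y i j) x (stdVec k))

/-- `w ∈ C_c^∞(Ω; M^{3×3})`. -/
def IsTestMap {d : ℕ} (Ω : Set (Pt d)) (w : Pt d → Mat) : Prop :=
  ∀ i j : Fin 3, ContDiff ℝ ∞ (fun x => w x i j) ∧ HasCompactSupport (fun x => w x i j) ∧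
    tsupport (fun x => w x i j) ⊆ Ω

/-- `Q ∈ W^{1,φ}_0(Ω; M^{3×3})`: `Q` is a limit in `W^{1,φ}` of maps in `C_c^∞`. For densities
with the doubling property, convergence in norm is the same as convergence of the modulars. -/
structure MemW10phi {d : ℕ} (Ω : Set (Pt d)) (φ : ℝ → ℝ) (Q : Pt d → Mat) : Prop where
  mem : MemW1phi Ω φ Q
  approx : ∃ w : ℕ → Pt d → Mat, (∀ n, IsTestMap Ω (w n)) ∧
    Tendsto (fun n => ∫⁻ x in Ω, ENNReal.ofReal (φ (frob (w n x - Q x)))) atTop (𝓝 0) ∧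
    Tendsto (fun n => ∫⁻ x in Ω,
      ENNReal.ofReal (φ (gradNorm (classicalGrad (w n) x - weakGrad Ω Q x)))) atTop (𝓝 0)

/-! ### The energy and its minimizers -/

/-- A boundary datum: a map in `W^{1,φ}(Ω)` with values in the vacuum manifold. -/
structure IsBoundaryDatum {d : ℕ} (Ω : Set (Pt d)) (φ : ℝ → ℝ) (A B C : ℝ)
    (Qb : Pt d → Mat) : Prop where
  mem : MemW1phi Ω φ Qb
  values : ∀ᵐ x ∂(volume.restrict Ω), Qb x ∈ vacuum A B C

/-- The admissible class: maps in `W^{1,φ}(Ω; S0)` with integrable bulk energy that agree with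
`Qb` on `∂Ω` (in the sense that the difference belongs to `W^{1,φ}_0`). -/
structure IsAdmissible {d : ℕ} (Ω : Set (Pt d)) (φ : ℝ → ℝ) (A B C : ℝ)
    (Qb Q : Pt d → Mat) : Prop where
  mem : MemW1phi Ω φ Q
  values : ∀ᵐ x ∂(volume.restrict Ω), Q x ∈ S0
  integrable_bulk : IntegrableOn (fun x => bulk A B C (Q x)) Ω volume
  boundary : MemW10phi Ω φ (fun x => Q x - Qb x)

/-- The energy density `e_L(Q) = φ(|∇Q|) + f_B(Q) / L`. -/
def energyDensity {d : ℕ} (Ω : Set (Pt d)) (φ : ℝ → ℝ) (A B C L : ℝ) (Q : Pt d → Mat)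
    (x : Pt d) : ℝ :=
  φ (gradNorm (weakGrad Ω Q x)) + 1 / L * bulk A B C (Q x)

/-- The modified Landau-de Gennes energy. -/
def Imod {d : ℕ} (Ω : Set (Pt d)) (φ : ℝ → ℝ) (A B C L : ℝ) (Q : Pt d → Mat) : ℝ :=
  ∫ x in Ω, energyDensity Ω φ A B C L Q x

/-- `Q` is a minimizer of the energy in the admissible class. -/
def IsEnergyMinimizer {d : ℕ} (Ω : Set (Pt d)) (φ : ℝ → ℝ) (A B C L : ℝ)
    (Qb Q : Pt d → Mat) : Prop :=
  IsAdmissible Ω φ A B C Qb Q ∧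
    ∀ P : Pt d → Mat, IsAdmissible Ω φ A B C Qb P →
      Imod Ω φ A B C L Q ≤ Imod Ω φ A B C L P

/-- The rescaled energy on the ball `B(x₀, r)`. -/
def rescaledEnergy {d : ℕ} (Ω : Set (Pt d)) (φ : ℝ → ℝ) (p A B C L : ℝ) (Q : Pt d → Mat)
    (x₀ : Pt d) (r : ℝ) : ℝ :=
  1 / r ^ ((d : ℝ) - p) * ∫ x in Metric.ball x₀ r, energyDensity Ω φ A B C L Q x

/-- The function `ρ ↦ ρ^{p-d-1} ∫_{B(x₀, ρ)} ξ(|∇Q|)`. -/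
def errorDensity {d : ℕ} (Ω : Set (Pt d)) (φ : ℝ → ℝ) (p : ℝ) (Q : Pt d → Mat)
    (x₀ : Pt d) (ρ : ℝ) : ℝ :=
  ρ ^ (p - (d : ℝ) - 1) * ∫ x in Metric.ball x₀ ρ, xi φ p (gradNorm (weakGrad Ω Q x))

end

end LdG

/-!
The estimate is the inner variation (Pohozaev type) inequality for the minimizer `Q`, tested with a
radial vector field whose profile is chosen so that both sides become explicit.

Let `χ` be smooth and nonincreasing, with `χ(|y - x₀|²)` supported in `Ω`. For small `s > 0` the map
`Ψₛ y = x₀ + (1 - s χ) (y - x₀)` is a diffeomorphism that is the identity off a compact subset of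
`Ω`. Its differential has the eigenvalue `a = 1 - s χ` in the tangential directions and
`b = a - 2 s χ' |y - x₀|² ≥ a` in the radial one. The competitor `Q ∘ Ψₛ⁻¹` is admissible, the norm
of its gradient at `Ψₛ y` is at most `|∇Q(y)| / a`, and `det DΨₛ = a ^ (d - 1) b`. Minimality and
differentiation in `s` at `0` give (`IsEnergyMinimizer.inner_variation`)
`∫ e (d χ + 2 χ' |y - x₀|²) ≤ ∫ φ'(|∇Q|) |∇Q| χ`.
Only contractions are used, and for them the estimate by `|∇Q| / a` discards the radial derivative
of `Q` with the right sign.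

By approximation the inequality holds for the weight `χ = w(|y - x₀|)`, where
`w(a) = ∫_r^R ρ ^ (p - d - 1) 1_{a < ρ} dρ`. For this weight `d χ + |y - x₀| ∂χ - p χ` equals
`r ^ (p - d)` times the indicator function of `B(x₀, r)` minus `R ^ (p - d)` times that of
`B(x₀, R)`. Writing `φ'(t) t = ξ(t) + p φ(t)` and using `f_B ≥ 0`, one obtains the difference of the
rescaled energies on the left and `∫ ξ(|∇Q|) w` on the right (`IsEnergyMinimizer.rescaledEnergy_le`),
and Fubini's theorem turns the latter into the integral of `errorDensity`. The upper bound for the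
error term follows from `ξ ≤ K` and `|B(x₀, ρ)| = |B(0, 1)| ρ ^ d`.

The analytic work is in the admissibility of `Q ∘ Ψₛ⁻¹` (`IsAdmissible.comp`). The chain rule for
weak gradients rests on Piola's identity, which is proved by duality from the change of variables
formula (`IsCompactDiffeo.ae_div_piola_eq`). The difference `Q ∘ Ψₛ⁻¹ - Q` has compact support in
`Ω`, so that mollification places it in `W^{1,φ}_0`: convexity of `φ` (Jensen's inequality), its
doubling property and Fatou's lemma give convergence in the modular
(`IsElasticDensity.tendsto_lintegral_mollify`).
-/

namespace LdG

/-! ### The elastic energy density -/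

namespace IsElasticDensity

variable {φ : ℝ → ℝ} {p : ℝ}

lemma continuousOn (hφ : IsElasticDensity φ p) : ContinuousOn φ (Ici 0) :=
  hφ.contDiff_one.continuousOn

lemma hasDerivAt (hφ : IsElasticDensity φ p) {t : ℝ} (ht : 0 < t) :
    HasDerivAt φ (dphi φ t) t := by
  have h : DifferentiableAt ℝ φ t :=
    (hφ.contDiff_two.differentiableOn (by norm_num)).differentiableAt (Ioi_mem_nhds ht)
  rw [dphi, derivWithin_of_mem_nhds (Ici_mem_nhds ht)]
  exact h.hasDerivAt

lemma continuousOn_dphi (hφ : IsElasticDensity φ p) : ContinuousOn (dphi φ) (Ici 0) :=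
  hφ.contDiff_one.continuousOn_derivWithin (uniqueDiffOn_Ici 0) le_rfl

lemma hasDerivAt_dphi (hφ : IsElasticDensity φ p) {t : ℝ} (ht : 0 < t) :
    HasDerivAt (dphi φ) (ddphi φ t) t := by
  have h1 : ContDiffOn ℝ 1 (deriv φ) (Ioi 0) :=
    (hφ.contDiff_two.deriv_of_isOpen isOpen_Ioi (by norm_num))
  have h2 : DifferentiableAt ℝ (deriv φ) t :=
    (h1.differentiableOn (by norm_num)).differentiableAt (Ioi_mem_nhds ht)
  have h3 : dphi φ =ᶠ[𝓝 t] deriv φ := by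
    filter_upwards [Ioi_mem_nhds ht] with s hs
    rw [dphi, derivWithin_of_mem_nhds (Ici_mem_nhds hs)]
  exact (h2.congr_of_eventuallyEq h3).hasDerivAt

lemma monotoneOn_dphi (hφ : IsElasticDensity φ p) : MonotoneOn (dphi φ) (Ici 0) := by
  refine (strictMonoOn_of_deriv_pos (convex_Ici 0) hφ.continuousOn_dphi ?_).monotoneOn
  intro t ht
  rw [interior_Ici] at ht
  exact hφ.deriv_two_pos t ht

lemma dphi_nonneg (hφ : IsElasticDensity φ p) {t : ℝ} (ht : 0 ≤ t) : 0 ≤ dphi φ t := by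
  rw [← hφ.deriv_zero]
  exact hφ.monotoneOn_dphi (mem_Ici.2 le_rfl) ht ht

lemma monotoneOn (hφ : IsElasticDensity φ p) : MonotoneOn φ (Ici 0) := by
  refine monotoneOn_of_deriv_nonneg (convex_Ici 0) hφ.continuousOn ?_ ?_
  · intro t ht
    rw [interior_Ici] at ht
    exact (hφ.hasDerivAt ht).differentiableAt.differentiableWithinAt
  · intro t ht
    rw [interior_Ici] at ht
    rw [(hφ.hasDerivAt ht).deriv]
    exact hφ.dphi_nonneg (le_of_lt ht)

lemma mono (hφ : IsElasticDensity φ p) {s t : ℝ} (hs : 0 ≤ s) (hst : s ≤ t) : φ s ≤ φ t :=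
  hφ.monotoneOn hs (hs.trans hst) hst

lemma nonneg (hφ : IsElasticDensity φ p) {t : ℝ} (ht : 0 ≤ t) : 0 ≤ φ t := by
  rw [← hφ.map_zero]
  exact hφ.mono le_rfl ht

/-- The graph of the convex function `φ` lies above its tangent lines. -/
lemma tangent_le (hφ : IsElasticDensity φ p) {a b : ℝ} (ha : 0 ≤ a) (hb : 0 ≤ b) :
    φ a + dphi φ a * (b - a) ≤ φ b := by
  rcases lt_trichotomy a b with h | h | h
  · obtain ⟨c, hc, hc'⟩ := exists_hasDerivAt_eq_slope φ (dphi φ) h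
      (hφ.continuousOn.mono fun x hx => ha.trans hx.1)
      (fun x hx => hφ.hasDerivAt (ha.trans_lt hx.1))
    have h1 : dphi φ a ≤ dphi φ c := hφ.monotoneOn_dphi ha (ha.trans hc.1.le) hc.1.le
    rw [hc', le_div_iff₀ (by linarith)] at h1
    linarith
  · simp [h]
  · obtain ⟨c, hc, hc'⟩ := exists_hasDerivAt_eq_slope φ (dphi φ) h
      (hφ.continuousOn.mono fun x hx => hb.trans hx.1)
      (fun x hx => hφ.hasDerivAt (hb.trans_lt hx.1))
    have h1 : dphi φ c ≤ dphi φ a := hφ.monotoneOn_dphi (hb.trans hc.1.le) ha hc.2.le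
    rw [hc', div_le_iff₀ (by linarith)] at h1
    linarith

/-- The upper bound of the characteristic of `φ`, integrated once. -/
lemma exists_mul_dphi_le (hφ : IsElasticDensity φ p) :
    ∃ K : ℕ, ∀ t, 0 ≤ t → t * dphi φ t ≤ K * φ t := by
  obtain ⟨c₀, c₁, -, -, hc⟩ := hφ.charact
  obtain ⟨K, hK⟩ := exists_nat_ge (1 + c₁)
  refine ⟨K, fun t ht => ?_⟩
  have hmono : MonotoneOn (fun t => K * φ t - t * dphi φ t) (Ici 0) := by
    have hd : ∀ s ∈ interior (Ici (0 : ℝ)), HasDerivAt (fun t => K * φ t - t * dphi φ t)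
        (K * dphi φ s - (1 * dphi φ s + s * ddphi φ s)) s := by
      intro s hs
      rw [interior_Ici] at hs
      exact ((hφ.hasDerivAt hs).const_mul _).sub ((hasDerivAt_id s).mul (hφ.hasDerivAt_dphi hs))
    refine monotoneOn_of_deriv_nonneg (convex_Ici 0) ?_
      (fun s hs => (hd s hs).differentiableAt.differentiableWithinAt) ?_
    · exact (hφ.continuousOn.const_smul (K : ℝ)).sub (continuousOn_id.mul hφ.continuousOn_dphi)
    · intro s hs
      rw [(hd s hs).deriv]
      rw [interior_Ici] at hs
      have h1 := (hc s (le_of_lt hs)).2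
      have h2 := mul_le_mul_of_nonneg_right hK (hφ.dphi_nonneg (le_of_lt hs))
      linarith
  have h := hmono (mem_Ici.2 le_rfl) ht ht
  simp only [hφ.map_zero, mul_zero, zero_mul, sub_zero] at h
  linarith

/-- The doubling property of `φ`, for arbitrary dilation factors. -/
lemma exists_map_mul_le (hφ : IsElasticDensity φ p) :
    ∃ K : ℕ, ∀ l t, 1 ≤ l → 0 ≤ t → φ (l * t) ≤ l ^ K * φ t := by
  obtain ⟨K, hK⟩ := hφ.exists_mul_dphi_le
  refine ⟨K, fun l t hl ht => ?_⟩
  rcases ht.eq_or_lt with rfl | ht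
  · simp [hφ.map_zero]
  have hd : ∀ s ∈ Ici (1 : ℝ), HasDerivAt (fun s => φ (s * t) / s ^ K)
      ((dphi φ (s * t) * t * s ^ K - φ (s * t) * (K * s ^ (K - 1))) / (s ^ K) ^ 2) s := by
    intro s hs
    have hs0 : 0 < s := zero_lt_one.trans_le hs
    have h1 : HasDerivAt (fun s => s * t) t s := by simpa using (hasDerivAt_id s).mul_const t
    exact ((hφ.hasDerivAt (mul_pos hs0 ht)).comp s h1).div (hasDerivAt_pow K s)
      (pow_pos hs0 K).ne'
  have hanti : AntitoneOn (fun s => φ (s * t) / s ^ K) (Ici 1) := by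
    refine antitoneOn_of_deriv_nonpos (convex_Ici 1)
      (fun s hs => (hd s hs).continuousAt.continuousWithinAt)
      (fun s hs => (hd s (interior_subset hs)).differentiableAt.differentiableWithinAt) ?_
    intro s hs
    have hs := interior_subset hs
    have hs0 : 0 < s := zero_lt_one.trans_le hs
    rw [(hd s hs).deriv]
    refine div_nonpos_of_nonpos_of_nonneg ?_ (sq_nonneg _)
    have h1 := hK (s * t) (by positivity)
    rcases Nat.eq_zero_or_pos K with rfl | hKpos
    · have h2 := hφ.dphi_nonneg (mul_pos hs0 ht).le
      have h3 : 0 ≤ t * dphi φ (s * t) := by positivity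
      have h4 : s * (t * dphi φ (s * t)) ≤ s * 0 := by
        simp only [Nat.cast_zero, zero_mul] at h1
        linarith
      have h5 := le_of_mul_le_mul_left h4 hs0
      simp only [pow_zero, Nat.cast_zero]
      linarith
    · have h2 : s ^ K = s * s ^ (K - 1) := by
        rw [← pow_succ', Nat.sub_add_cancel hKpos]
      have h3 := mul_le_mul_of_nonneg_right h1 (pow_pos hs0 (K - 1)).le
      rw [h2]
      linarith
  have h := hanti (mem_Ici.2 le_rfl) (mem_Ici.2 hl) hl
  simp only [one_pow, div_one, one_mul] at h
  rw [div_le_iff₀ (pow_pos (zero_lt_one.trans_le hl) K)] at h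
  linarith

/-- A quasi-triangle inequality for finite sums. -/
lemma exists_map_sum_le (hφ : IsElasticDensity φ p) (ι : Type*) [Fintype ι] :
    ∃ C : ℝ, 0 ≤ C ∧ ∀ a : ι → ℝ, (∀ i, 0 ≤ a i) → φ (∑ i, a i) ≤ C * ∑ i, φ (a i) := by
  obtain ⟨K, hK⟩ := hφ.exists_map_mul_le
  refine ⟨(Fintype.card ι : ℝ) ^ K, by positivity, fun a ha => ?_⟩
  rcases isEmpty_or_nonempty ι with h | h
  · simp [hφ.map_zero]
  obtain ⟨j, -, hj⟩ := Finset.exists_max_image Finset.univ a Finset.univ_nonempty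
  have h1 : ∑ i, a i ≤ Fintype.card ι * a j := by
    calc ∑ i, a i ≤ ∑ _i : ι, a j := Finset.sum_le_sum fun i hi => hj i hi
      _ = Fintype.card ι * a j := by simp
  calc φ (∑ i, a i) ≤ φ (Fintype.card ι * a j) := hφ.mono (Finset.sum_nonneg fun i _ => ha i) h1
    _ ≤ (Fintype.card ι : ℝ) ^ K * φ (a j) :=
        hK _ _ (by exact_mod_cast Fintype.card_pos) (ha j)
    _ ≤ _ := by
        gcongr
        exact Finset.single_le_sum (f := fun i => φ (a i)) (fun i _ => hφ.nonneg (ha i))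
          (Finset.mem_univ j)

lemma exists_map_add_le (hφ : IsElasticDensity φ p) :
    ∃ C : ℝ, 0 ≤ C ∧ ∀ s t, 0 ≤ s → 0 ≤ t → φ (s + t) ≤ C * (φ s + φ t) := by
  obtain ⟨C, hC, h⟩ := hφ.exists_map_sum_le (Fin 2)
  refine ⟨C, hC, fun s t hs ht => ?_⟩
  have := h ![s, t] (by intro i; fin_cases i <;> simpa)
  simpa [Fin.sum_univ_two] using this

/-- Only the values of `φ` on `[0, ∞)` are controlled, so measurability of `φ ∘ g` is obtained
by truncating the argument of `φ` at `0`. -/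
lemma aestronglyMeasurable_comp (hφ : IsElasticDensity φ p) {α : Type*} [MeasurableSpace α]
    {μ : Measure α} {g : α → ℝ} (hg : AEStronglyMeasurable g μ) (h0 : ∀ x, 0 ≤ g x) :
    AEStronglyMeasurable (fun x => φ (g x)) μ := by
  have hc : Continuous (fun t : ℝ => φ (max t 0)) :=
    hφ.continuousOn.comp_continuous (by fun_prop) fun t => mem_Ici.2 (le_max_right _ _)
  have h := hc.comp_aestronglyMeasurable hg
  refine h.congr (Eventually.of_forall fun x => ?_)
  simp [max_eq_left (h0 x)]

lemma aestronglyMeasurable_dphi_comp (hφ : IsElasticDensity φ p) {α : Type*} [MeasurableSpace α]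
    {μ : Measure α} {g : α → ℝ} (hg : AEStronglyMeasurable g μ) (h0 : ∀ x, 0 ≤ g x) :
    AEStronglyMeasurable (fun x => dphi φ (g x)) μ := by
  have hc : Continuous (fun t : ℝ => dphi φ (max t 0)) :=
    hφ.continuousOn_dphi.comp_continuous (by fun_prop) fun t => mem_Ici.2 (le_max_right _ _)
  have h := hc.comp_aestronglyMeasurable hg
  refine h.congr (Eventually.of_forall fun x => ?_)
  simp [max_eq_left (h0 x)]

/-- Integrability of `φ(g)` entails integrability of `φ'(g) g`. -/
lemma integrable_dphi_mul (hφ : IsElasticDensity φ p) {α : Type*} [MeasurableSpace α]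
    {μ : Measure α} {g : α → ℝ} (hg : AEStronglyMeasurable g μ) (h0 : ∀ x, 0 ≤ g x)
    (hi : Integrable (fun x => φ (g x)) μ) : Integrable (fun x => dphi φ (g x) * g x) μ := by
  obtain ⟨K, hK⟩ := hφ.exists_mul_dphi_le
  refine (hi.const_mul (K : ℝ)).mono' ((hφ.aestronglyMeasurable_dphi_comp hg h0).mul hg)
    (Eventually.of_forall fun x => ?_)
  rw [Real.norm_of_nonneg (mul_nonneg (hφ.dphi_nonneg (h0 x)) (h0 x)), mul_comm]
  exact hK _ (h0 x)

lemma integrable_xi (hφ : IsElasticDensity φ p) {α : Type*} [MeasurableSpace α]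
    {μ : Measure α} {g : α → ℝ} (hg : AEStronglyMeasurable g μ) (h0 : ∀ x, 0 ≤ g x)
    (hi : Integrable (fun x => φ (g x)) μ) : Integrable (fun x => xi φ p (g x)) μ :=
  (hφ.integrable_dphi_mul hg h0 hi).sub (hi.const_mul p)

/-- Domination criterion: if `g ≤ C ∑ fᵢ` and all `φ(fᵢ)` are integrable, so is `φ(g)`. -/
lemma integrable_comp_of_le_sum (hφ : IsElasticDensity φ p) {α ι : Type*} [MeasurableSpace α]
    [Fintype ι] {μ : Measure α} {g : α → ℝ} {f : ι → α → ℝ} (hg : AEStronglyMeasurable g μ)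
    (h0 : ∀ x, 0 ≤ g x) (hf0 : ∀ i x, 0 ≤ f i x) (C : ℝ) (hle : ∀ x, g x ≤ C * ∑ i, f i x)
    (hf : ∀ i, Integrable (fun x => φ (f i x)) μ) : Integrable (fun x => φ (g x)) μ := by
  obtain ⟨K, hK⟩ := hφ.exists_map_mul_le
  obtain ⟨C', hC', hs⟩ := hφ.exists_map_sum_le ι
  refine ((integrable_finsetSum Finset.univ fun i _ => hf i).const_mul
    (max C 1 ^ K * C')).mono' (hφ.aestronglyMeasurable_comp hg h0) (Eventually.of_forall fun x => ?_)
  rw [Real.norm_of_nonneg (hφ.nonneg (h0 x))]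
  have hsum : 0 ≤ ∑ i, f i x := Finset.sum_nonneg fun i _ => hf0 i x
  calc φ (g x) ≤ φ (max C 1 * ∑ i, f i x) :=
        hφ.mono (h0 x) ((hle x).trans (by gcongr; exact le_max_left _ _))
    _ ≤ max C 1 ^ K * φ (∑ i, f i x) := hK _ _ (le_max_right _ _) hsum
    _ ≤ max C 1 ^ K * (C' * ∑ i, φ (f i x)) := by gcongr; exact hs _ fun i => hf0 i x
    _ = _ := by ring

end IsElasticDensity

/-! ### Weak gradients of scalar functions -/

/-- `g` is a weak gradient of the scalar function `u` in `Ω`; the scalar version of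
`IsWeakGrad`. -/
def HasWeakGrad {d : ℕ} (Ω : Set (Pt d)) (u : Pt d → ℝ) (g : Fin d → Pt d → ℝ) : Prop :=
  LocallyIntegrableOn u Ω volume ∧ ∀ k : Fin d, LocallyIntegrableOn (g k) Ω volume ∧
    ∀ η : Pt d → ℝ, ContDiff ℝ ∞ η → HasCompactSupport η → tsupport η ⊆ Ω →
      ∫ x in Ω, u x * fderiv ℝ η x (stdVec k) = -∫ x in Ω, g k x * η x

lemma isWeakGrad_iff {d : ℕ} {Ω : Set (Pt d)} {Q : Pt d → Mat} {G : Pt d → Fin d → Mat} :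
    IsWeakGrad Ω Q G ↔ ∀ i j, HasWeakGrad Ω (fun x => Q x i j) (fun k x => G x k i j) := Iff.rfl

variable {d : ℕ} {Ω : Set (Pt d)}

lemma integrable_mul_of_tsupport_subset {u f : Pt d → ℝ} (hu : LocallyIntegrableOn u Ω volume)
    (hf : Continuous f) (hc : HasCompactSupport f) (hs : tsupport f ⊆ Ω) :
    Integrable (fun x => u x * f x) volume := by
  have h1 : IntegrableOn u (tsupport f) volume := hu.integrableOn_compact_subset hs hc
  have h2 : IntegrableOn (fun x => u x * f x) (tsupport f) volume :=
    h1.mul_continuousOn hf.continuousOn hc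
  refine (integrableOn_iff_integrable_of_support_subset ?_).1 h2
  intro x hx
  exact subset_tsupport f fun h => hx (by simp [h])

lemma tsupport_fderiv_apply_subset_tsupport (η : Pt d → ℝ) (v : Pt d) :
    tsupport (fun x => fderiv ℝ η x v) ⊆ tsupport η :=
  (tsupport_fderiv_apply_subset ℝ v)

lemma continuous_fderiv_apply_const {η : Pt d → ℝ} (hη : ContDiff ℝ ∞ η) (v : Pt d) :
    Continuous (fun x => fderiv ℝ η x v) :=
  (hη.continuous_fderiv (by simp)).clm_apply continuous_const

lemma hasCompactSupport_fderiv_apply {η : Pt d → ℝ} (hη : HasCompactSupport η) (v : Pt d) :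
    HasCompactSupport (fun x => fderiv ℝ η x v) :=
  hη.fderiv_apply (𝕜 := ℝ) v

namespace HasWeakGrad

variable {u v : Pt d → ℝ} {g h : Fin d → Pt d → ℝ}

lemma integral_mul_fderiv (hu : HasWeakGrad Ω u g) (k : Fin d) {η : Pt d → ℝ}
    (h1 : ContDiff ℝ ∞ η) (h2 : HasCompactSupport η) (h3 : tsupport η ⊆ Ω) :
    ∫ x in Ω, u x * fderiv ℝ η x (stdVec k) = -∫ x in Ω, g k x * η x :=
  (hu.2 k).2 η h1 h2 h3

lemma integrable_mul_fderiv (hu : LocallyIntegrableOn u Ω volume) (k : Fin d) {η : Pt d → ℝ}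
    (h1 : ContDiff ℝ ∞ η) (h2 : HasCompactSupport η) (h3 : tsupport η ⊆ Ω) :
    Integrable (fun x => u x * fderiv ℝ η x (stdVec k)) volume :=
  integrable_mul_of_tsupport_subset hu (continuous_fderiv_apply_const h1 _)
    (hasCompactSupport_fderiv_apply h2 _) ((tsupport_fderiv_apply_subset_tsupport η _).trans h3)

lemma add (hu : HasWeakGrad Ω u g) (hv : HasWeakGrad Ω v h) :
    HasWeakGrad Ω (fun x => u x + v x) (fun k x => g k x + h k x) := by
  refine ⟨hu.1.add hv.1, fun k => ⟨(hu.2 k).1.add (hv.2 k).1, fun η h1 h2 h3 => ?_⟩⟩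
  simp only [add_mul]
  rw [integral_add (integrable_mul_fderiv hu.1 k h1 h2 h3).integrableOn
      (integrable_mul_fderiv hv.1 k h1 h2 h3).integrableOn,
    integral_add (integrable_mul_of_tsupport_subset (hu.2 k).1 h1.continuous h2 h3).integrableOn
      (integrable_mul_of_tsupport_subset (hv.2 k).1 h1.continuous h2 h3).integrableOn,
    hu.integral_mul_fderiv k h1 h2 h3, hv.integral_mul_fderiv k h1 h2 h3]
  ring

lemma neg (hu : HasWeakGrad Ω u g) :
    HasWeakGrad Ω (fun x => -u x) (fun k x => -g k x) := by
  refine ⟨hu.1.neg, fun k => ⟨(hu.2 k).1.neg, fun η h1 h2 h3 => ?_⟩⟩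
  simp only [neg_mul, integral_neg]
  rw [hu.integral_mul_fderiv k h1 h2 h3]

lemma sub (hu : HasWeakGrad Ω u g) (hv : HasWeakGrad Ω v h) :
    HasWeakGrad Ω (fun x => u x - v x) (fun k x => g k x - h k x) := by
  simpa only [sub_eq_add_neg] using hu.add hv.neg

/-- Weak gradients are unique up to null sets. -/
lemma ae_eq (hΩ : IsOpen Ω) (hu : HasWeakGrad Ω u g) (hv : HasWeakGrad Ω u h) (k : Fin d) :
    ∀ᵐ x ∂(volume.restrict Ω), g k x = h k x := by
  rw [ae_restrict_iff' hΩ.measurableSet]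
  have := hΩ.ae_eq_zero_of_integral_contDiff_smul_eq_zero (f := fun x => g k x - h k x)
    (μ := volume) ((hu.2 k).1.sub (hv.2 k).1) ?_
  · filter_upwards [this] with x hx hxΩ using sub_eq_zero.1 (hx hxΩ)
  · intro η h1 h2 h3
    have e : ∀ x, η x • (g k x - h k x) = g k x * η x - h k x * η x := fun x => by
      rw [smul_eq_mul]; ring
    simp only [e]
    rw [← setIntegral_eq_integral_of_forall_compl_eq_zero (s := Ω), integral_sub
      (integrable_mul_of_tsupport_subset (hu.2 k).1 h1.continuous h2 h3).integrableOn
      (integrable_mul_of_tsupport_subset (hv.2 k).1 h1.continuous h2 h3).integrableOn]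
    · have a := hu.integral_mul_fderiv k h1 h2 h3
      have b := hv.integral_mul_fderiv k h1 h2 h3
      linarith
    · intro x hx
      have : η x = 0 := image_eq_zero_of_notMem_tsupport fun h => hx (h3 h)
      simp [this]

end HasWeakGrad

lemma weakGrad_spec {Q : Pt d → Mat} (h : ∃ G, IsWeakGrad Ω Q G) :
    IsWeakGrad Ω Q (weakGrad Ω Q) := by
  rw [weakGrad, dif_pos h]
  exact h.choose_spec

lemma weakGrad_ae_eq (hΩ : IsOpen Ω) {Q : Pt d → Mat} {G : Pt d → Fin d → Mat}
    (h : IsWeakGrad Ω Q G) : ∀ᵐ x ∂(volume.restrict Ω), weakGrad Ω Q x = G x := by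
  have h1 : IsWeakGrad Ω Q (weakGrad Ω Q) := weakGrad_spec ⟨G, h⟩
  have h2 : ∀ᵐ x ∂(volume.restrict Ω), ∀ i j k, weakGrad Ω Q x k i j = G x k i j := by
    simp only [ae_all_iff]
    exact fun i j k => (isWeakGrad_iff.1 h1 i j).ae_eq hΩ (isWeakGrad_iff.1 h i j) k
  filter_upwards [h2] with x hx
  ext k i j
  exact hx i j k

/-! ### Diffeomorphisms with compact support -/

/-- `Ψ` is a diffeomorphism of `ℝᵈ` with inverse `Φ` that differs from the identity only on a
compact subset of `Ω`. -/
structure IsCompactDiffeo (Ω : Set (Pt d)) (Ψ Φ : Pt d → Pt d) : Prop where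
  contDiff : ContDiff ℝ ∞ Ψ
  contDiff_symm : ContDiff ℝ ∞ Φ
  left_inv : ∀ x, Φ (Ψ x) = x
  right_inv : ∀ x, Ψ (Φ x) = x
  eq_id : ∃ K, IsCompact K ∧ K ⊆ Ω ∧ ∀ x, x ∉ K → Ψ x = x

/-- The absolute value of the Jacobian determinant. -/
noncomputable def absJac (Ψ : Pt d → Pt d) (x : Pt d) : ℝ := |(fderiv ℝ Ψ x).det|

lemma absJac_nonneg (Ψ : Pt d → Pt d) (x : Pt d) : 0 ≤ absJac Ψ x := abs_nonneg _

namespace IsCompactDiffeo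

variable {Ψ Φ : Pt d → Pt d}

lemma symm (h : IsCompactDiffeo Ω Ψ Φ) : IsCompactDiffeo Ω Φ Ψ := by
  obtain ⟨K, hK, hKΩ, hid⟩ := h.eq_id
  refine ⟨h.contDiff_symm, h.contDiff, h.right_inv, h.left_inv, K, hK, hKΩ, fun x hx => ?_⟩
  conv_lhs => rw [← hid x hx]
  exact h.left_inv x

lemma mono (h : IsCompactDiffeo Ω Ψ Φ) {Ω' : Set (Pt d)} (hΩ : Ω ⊆ Ω') :
    IsCompactDiffeo Ω' Ψ Φ := by
  obtain ⟨K, hK, hKΩ, hid⟩ := h.eq_id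
  exact ⟨h.contDiff, h.contDiff_symm, h.left_inv, h.right_inv, K, hK, hKΩ.trans hΩ, hid⟩

lemma injective (h : IsCompactDiffeo Ω Ψ Φ) : Function.Injective Ψ :=
  Function.LeftInverse.injective h.left_inv

lemma mapsTo (h : IsCompactDiffeo Ω Ψ Φ) : MapsTo Ψ Ω Ω := by
  obtain ⟨K, hK, hKΩ, hid⟩ := h.eq_id
  intro x hx
  by_contra hcon
  exact hcon (by rwa [h.injective (hid (Ψ x) fun hK' => hcon (hKΩ hK'))])

lemma image_eq (h : IsCompactDiffeo Ω Ψ Φ) : Ψ '' Ω = Ω :=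
  Subset.antisymm h.mapsTo.image_subset fun x hx => ⟨Φ x, h.symm.mapsTo hx, h.right_inv x⟩

lemma differentiable (h : IsCompactDiffeo Ω Ψ Φ) : Differentiable ℝ Ψ :=
  h.contDiff.differentiable (by simp)

lemma fderiv_comp_fderiv (h : IsCompactDiffeo Ω Ψ Φ) (y : Pt d) :
    (fderiv ℝ Φ (Ψ y)).comp (fderiv ℝ Ψ y) = ContinuousLinearMap.id ℝ (Pt d) := by
  rw [← fderiv_comp y (h.symm.differentiable _) (h.differentiable y)]
  have : Φ ∘ Ψ = id := funext h.left_inv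
  rw [this, fderiv_id]

lemma fderiv_comp_fderiv' (h : IsCompactDiffeo Ω Ψ Φ) (y : Pt d) :
    (fderiv ℝ Ψ y).comp (fderiv ℝ Φ (Ψ y)) = ContinuousLinearMap.id ℝ (Pt d) := by
  have := h.symm.fderiv_comp_fderiv (Ψ y)
  rwa [h.left_inv] at this

lemma absJac_mul (h : IsCompactDiffeo Ω Ψ Φ) (y : Pt d) :
    absJac Φ (Ψ y) * absJac Ψ y = 1 := by
  have h1 := congrArg ContinuousLinearMap.det (h.fderiv_comp_fderiv y)
  simp only [ContinuousLinearMap.det, ContinuousLinearMap.toLinearMap_comp, LinearMap.det_comp,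
    ContinuousLinearMap.coe_id, LinearMap.det_id] at h1
  rw [absJac, absJac, ← abs_mul]
  simp only [ContinuousLinearMap.det, h1, abs_one]

lemma continuous_absJac (h : IsCompactDiffeo Ω Ψ Φ) : Continuous (absJac Ψ) :=
  (ContinuousLinearMap.continuous_det.comp (h.contDiff.continuous_fderiv (by simp))).abs

lemma contDiff_absJac (h : IsCompactDiffeo Ω Ψ Φ) : ContDiff ℝ ∞ (absJac Ψ) := by
  have h1 : ContDiff ℝ ∞ (fun x => (fderiv ℝ Ψ x).det) := by
    have e : ∀ x, (fderiv ℝ Ψ x).det = ∑ σ : Equiv.Perm (Fin d), ((Equiv.Perm.sign σ : ℤ) : ℝ) *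
        ∏ i, (fderiv ℝ Ψ x (stdVec i)) (σ i) := by
      intro x
      rw [ContinuousLinearMap.det, ← LinearMap.det_toMatrix
        (EuclideanSpace.basisFun (Fin d) ℝ).toBasis, Matrix.det_apply']
      simp [LinearMap.toMatrix_apply, stdVec]
    simp only [e]
    refine ContDiff.sum fun σ _ => contDiff_const.mul (contDiff_prod fun i _ => ?_)
    have h2 : ContDiff ℝ ∞ (fun x => fderiv ℝ Ψ x (stdVec i)) :=
      (h.contDiff.fderiv_right (m := ∞) (by simp)).clm_apply contDiff_const
    exact contDiff_euclidean.1 h2 (σ i)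
  rw [contDiff_iff_contDiffAt]
  intro x
  refine h1.contDiffAt.abs fun h0 => ?_
  have := h.absJac_mul x
  rw [absJac, absJac, h0] at this
  simp at this

lemma exists_bound {f : Pt d → ℝ} {c : ℝ} (h : IsCompactDiffeo Ω Ψ Φ)
    (hf : Continuous f) (hc : ∀ x, fderiv ℝ Ψ x = ContinuousLinearMap.id ℝ (Pt d) → f x ≤ c) :
    ∃ M, ∀ x, f x ≤ M := by
  obtain ⟨K, hK, hKΩ, hid⟩ := h.eq_id
  obtain ⟨M, hM⟩ := hK.bddAbove_image hf.continuousOn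
  refine ⟨max M c, fun x => ?_⟩
  by_cases hx : x ∈ K
  · exact (hM ⟨x, hx, rfl⟩).trans (le_max_left _ _)
  · refine (hc x ?_).trans (le_max_right _ _)
    have : Ψ =ᶠ[𝓝 x] id := by
      filter_upwards [hK.isClosed.isOpen_compl.mem_nhds hx] with y hy using hid y hy
    rw [this.fderiv_eq, fderiv_id]

lemma exists_absJac_le (h : IsCompactDiffeo Ω Ψ Φ) : ∃ M, ∀ x, absJac Ψ x ≤ M :=
  h.exists_bound (c := 1) h.continuous_absJac fun x hx => by
    simp [absJac, hx, ContinuousLinearMap.det]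

lemma exists_norm_fderiv_le (h : IsCompactDiffeo Ω Ψ Φ) : ∃ M, ∀ x, ‖fderiv ℝ Ψ x‖ ≤ M :=
  h.exists_bound (c := 1) (h.contDiff.continuous_fderiv (by simp)).norm fun x hx => by
    rw [hx]
    exact ContinuousLinearMap.norm_id_le

lemma setIntegral_image (h : IsCompactDiffeo Ω Ψ Φ) {s : Set (Pt d)} (hs : MeasurableSet s)
    (f : Pt d → ℝ) : ∫ x in Ψ '' s, f x = ∫ y in s, absJac Ψ y * f (Ψ y) :=
  integral_image_eq_integral_abs_det_fderiv_smul volume hs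
    (fun x _ => (h.differentiable x).hasFDerivAt.hasFDerivWithinAt) h.injective.injOn f

lemma setIntegral_eq (h : IsCompactDiffeo Ω Ψ Φ) (hΩ : MeasurableSet Ω) (f : Pt d → ℝ) :
    ∫ x in Ω, f x = ∫ y in Ω, absJac Ψ y * f (Ψ y) := by
  conv_lhs => rw [← h.image_eq]
  exact h.setIntegral_image hΩ f

lemma integral_eq (h : IsCompactDiffeo Ω Ψ Φ) (f : Pt d → ℝ) :
    ∫ x, f x = ∫ y, absJac Ψ y * f (Ψ y) := by
  simpa using (h.mono (subset_univ Ω)).setIntegral_eq MeasurableSet.univ f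

lemma integrableOn_comp (h : IsCompactDiffeo Ω Ψ Φ) {s : Set (Pt d)} (hs : MeasurableSet s)
    {f : Pt d → ℝ} (hf : IntegrableOn f (Ψ '' s) volume) :
    IntegrableOn (fun y => f (Ψ y)) s volume := by
  have h1 := (integrableOn_image_iff_integrableOn_abs_det_fderiv_smul volume hs
    (fun x _ => (h.differentiable x).hasFDerivAt.hasFDerivWithinAt) h.injective.injOn f).1 hf
  obtain ⟨M, hM⟩ := h.symm.exists_absJac_le
  have h2 : Continuous (fun y => absJac Φ (Ψ y)) :=
    h.symm.continuous_absJac.comp h.contDiff.continuous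
  have h3 := Integrable.bdd_mul h1 (c := M) h2.aestronglyMeasurable
    (Eventually.of_forall fun y => by
      rw [Real.norm_of_nonneg (absJac_nonneg _ _)]; exact hM _)
  refine h3.congr (Eventually.of_forall fun y => ?_)
  have h4 := h.absJac_mul y
  simp only [smul_eq_mul]
  rw [← mul_assoc]
  exact (congrArg (· * f (Ψ y)) h4).trans (one_mul _)

lemma quasiMeasurePreserving (h : IsCompactDiffeo Ω Ψ Φ) :
    Measure.QuasiMeasurePreserving Ψ (volume.restrict Ω) (volume.restrict Ω) := by
  refine ⟨h.contDiff.continuous.measurable, Measure.AbsolutelyContinuous.mk fun s hs h0 => ?_⟩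
  rw [Measure.map_apply h.contDiff.continuous.measurable hs]
  rw [Measure.restrict_apply hs] at h0
  rw [Measure.restrict_apply (h.contDiff.continuous.measurable hs)]
  refine measure_mono_null (t := Φ '' (s ∩ Ω)) ?_
    (addHaar_image_eq_zero_of_differentiableOn_of_addHaar_eq_zero volume
      h.symm.differentiable.differentiableOn h0)
  rintro y ⟨hy, hyΩ⟩
  exact ⟨Ψ y, ⟨hy, h.mapsTo hyΩ⟩, h.left_inv y⟩

lemma locallyIntegrableOn_comp (h : IsCompactDiffeo Ω Ψ Φ) (hΩ : IsOpen Ω) {f : Pt d → ℝ}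
    (hf : LocallyIntegrableOn f Ω volume) :
    LocallyIntegrableOn (fun y => f (Ψ y)) Ω volume := by
  rw [locallyIntegrableOn_iff hΩ.isLocallyClosed] at hf ⊢
  intro K hKΩ hK
  exact h.integrableOn_comp hK.measurableSet
    (hf _ ((image_mono hKΩ).trans h.image_eq.subset) (hK.image h.contDiff.continuous))

/-- `Ψ` as a homeomorphism of `ℝᵈ`. -/
def homeomorph (h : IsCompactDiffeo Ω Ψ Φ) : Pt d ≃ₜ Pt d where
  toFun := Ψ
  invFun := Φ
  left_inv := h.left_inv
  right_inv := h.right_inv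
  continuous_toFun := h.contDiff.continuous
  continuous_invFun := h.contDiff_symm.continuous

lemma tsupport_comp_subset (h : IsCompactDiffeo Ω Ψ Φ) {η : Pt d → ℝ} (hη : tsupport η ⊆ Ω) :
    tsupport (fun y => η (Ψ y)) ⊆ Ω := by
  intro y hy
  have h1 : y ∈ Ψ ⁻¹' (tsupport η) := tsupport_comp_subset_preimage η h.contDiff.continuous hy
  rw [← h.left_inv y]
  exact h.symm.mapsTo (hη h1)

lemma hasCompactSupport_comp (h : IsCompactDiffeo Ω Ψ Φ) {η : Pt d → ℝ}
    (hη : HasCompactSupport η) : HasCompactSupport (fun y => η (Ψ y)) :=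
  hη.comp_homeomorph h.homeomorph

end IsCompactDiffeo

/-! ### The chain rule for weak gradients -/

lemma clm_apply_eq_sum (f : Pt d →L[ℝ] ℝ) (v : Pt d) : f v = ∑ l, v l * f (stdVec l) := by
  have hv : v = ∑ l, v l • (stdVec l : Pt d) := by
    ext i
    simp [stdVec, Finset.sum_apply, Pi.single_apply]
  conv_lhs => rw [hv]
  simp

namespace IsCompactDiffeo

variable {Ψ Φ : Pt d → Pt d}

/-- The vector field `(∂ₖΦ ∘ Ψ) (η ∘ Ψ) |det DΨ|`: the Piola transform of the field `η eₖ`. -/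
noncomputable def piola (Ψ Φ : Pt d → Pt d) (η : Pt d → ℝ) (k l : Fin d) (y : Pt d) : ℝ :=
  (fderiv ℝ Φ (Ψ y) (stdVec k)) l * absJac Ψ y * η (Ψ y)

lemma contDiff_piola (h : IsCompactDiffeo Ω Ψ Φ) {η : Pt d → ℝ} (hη : ContDiff ℝ ∞ η)
    (k l : Fin d) : ContDiff ℝ ∞ (piola Ψ Φ η k l) := by
  have h1 : ContDiff ℝ ∞ (fun x => fderiv ℝ Φ x (stdVec k)) :=
    (h.contDiff_symm.fderiv_right (m := ∞) (by simp)).clm_apply contDiff_const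
  exact ((contDiff_euclidean.1 (h1.comp h.contDiff) l).mul h.contDiff_absJac).mul
    (hη.comp h.contDiff)

lemma hasCompactSupport_piola (h : IsCompactDiffeo Ω Ψ Φ) {η : Pt d → ℝ}
    (hη : HasCompactSupport η) (k l : Fin d) : HasCompactSupport (piola Ψ Φ η k l) :=
  (h.hasCompactSupport_comp hη).mul_left

lemma tsupport_piola_subset (h : IsCompactDiffeo Ω Ψ Φ) {η : Pt d → ℝ} (hη : tsupport η ⊆ Ω)
    (k l : Fin d) : tsupport (piola Ψ Φ η k l) ⊆ Ω :=
  (tsupport_mul_subset_right).trans (h.tsupport_comp_subset hη)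

lemma integrable_mul_of_contDiff {u f : Pt d → ℝ} (hu : ContDiff ℝ ∞ u) (hf : ContDiff ℝ ∞ f)
    (hc : HasCompactSupport f) (l : Fin d) :
    Integrable (fun y => u y * fderiv ℝ f y (stdVec l)) volume ∧
      Integrable (fun y => fderiv ℝ u y (stdVec l) * f y) volume ∧
        Integrable (fun y => u y * f y) volume :=
  ⟨integrable_mul_of_tsupport_subset (hu.continuous.locallyIntegrable.locallyIntegrableOn univ)
      (continuous_fderiv_apply_const hf _) (hasCompactSupport_fderiv_apply hc _) (subset_univ _),
    integrable_mul_of_tsupport_subset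
      ((continuous_fderiv_apply_const hu _).locallyIntegrable.locallyIntegrableOn univ)
      hf.continuous hc (subset_univ _),
    integrable_mul_of_tsupport_subset (hu.continuous.locallyIntegrable.locallyIntegrableOn univ)
      hf.continuous hc (subset_univ _)⟩

lemma integral_mul_fderiv_of_contDiff {u f : Pt d → ℝ} (hu : ContDiff ℝ ∞ u)
    (hf : ContDiff ℝ ∞ f) (hc : HasCompactSupport f) (l : Fin d) :
    ∫ y, u y * fderiv ℝ f y (stdVec l) = -∫ y, fderiv ℝ u y (stdVec l) * f y := by
  obtain ⟨h1, h2, h3⟩ := integrable_mul_of_contDiff hu hf hc l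
  exact integral_mul_fderiv_eq_neg_fderiv_mul_of_integrable h2 h1 h3
    (fun x _ => hu.differentiable (by simp) x) (fun x _ => hf.differentiable (by simp) x)

/-- Piola's identity: the Piola transform maps `div (η eₖ) = ∂ₖη` to `(∂ₖη ∘ Ψ) |det DΨ|`.
Instead of differentiating the cofactors, both sides are tested with a smooth function `v`, for
which the identity is the change of variables in `∫ (v ∘ Φ) ∂ₖη = - ∫ ∂ₖ(v ∘ Φ) η`. -/
lemma ae_div_piola_eq (h : IsCompactDiffeo Ω Ψ Φ) {η : Pt d → ℝ} (hη : ContDiff ℝ ∞ η)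
    (hc : HasCompactSupport η) (k : Fin d) :
    ∀ᵐ y, ∑ l, fderiv ℝ (piola Ψ Φ η k l) y (stdVec l) =
      absJac Ψ y * fderiv ℝ η (Ψ y) (stdVec k) := by
  have hcont1 : Continuous fun y => ∑ l, fderiv ℝ (piola Ψ Φ η k l) y (stdVec l) :=
    continuous_finsetSum _ fun l _ => continuous_fderiv_apply_const (h.contDiff_piola hη k l) _
  have hcont2 : Continuous fun y => absJac Ψ y * fderiv ℝ η (Ψ y) (stdVec k) :=
    h.continuous_absJac.mul ((continuous_fderiv_apply_const hη _).comp h.contDiff.continuous)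
  refine ae_eq_of_integral_contDiff_smul_eq hcont1.locallyIntegrable hcont2.locallyIntegrable ?_
  intro v hv hvc
  have hvΦ : ContDiff ℝ ∞ (fun x => v (Φ x)) := hv.comp h.contDiff_symm
  have hpt : ∀ y, absJac Ψ y * (fderiv ℝ (fun x => v (Φ x)) (Ψ y) (stdVec k) * η (Ψ y)) =
      ∑ l, fderiv ℝ v y (stdVec l) * piola Ψ Φ η k l y := by
    intro y
    have h1 : fderiv ℝ (fun x => v (Φ x)) (Ψ y) =
        (fderiv ℝ v y).comp (fderiv ℝ Φ (Ψ y)) := by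
      have := fderiv_comp (Ψ y) (g := v) (f := Φ) (hv.differentiable (by simp) _)
        (h.symm.differentiable _)
      rw [h.left_inv] at this
      exact this
    rw [h1, ContinuousLinearMap.comp_apply, clm_apply_eq_sum, Finset.sum_mul, Finset.mul_sum]
    refine Finset.sum_congr rfl fun l _ => ?_
    rw [piola]
    ring
  simp only [smul_eq_mul, Finset.mul_sum]
  rw [integral_finsetSum _ fun l _ =>
    (integrable_mul_of_contDiff hv (h.contDiff_piola hη k l) (h.hasCompactSupport_piola hc k l) l).1]
  simp only [fun l => integral_mul_fderiv_of_contDiff hv (h.contDiff_piola hη k l)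
    (h.hasCompactSupport_piola hc k l) l]
  rw [Finset.sum_neg_distrib, ← integral_finsetSum _ fun l _ =>
    (integrable_mul_of_contDiff hv (h.contDiff_piola hη k l)
      (h.hasCompactSupport_piola hc k l) l).2.1]
  simp only [← hpt]
  rw [← h.integral_eq (fun x => fderiv ℝ (fun x => v (Φ x)) x (stdVec k) * η x),
    ← integral_mul_fderiv_of_contDiff hvΦ hη hc k, h.integral_eq]
  refine integral_congr_ae (Eventually.of_forall fun y => ?_)
  simp only [h.left_inv]
  ring

/-- The chain rule `∂ₖ(u ∘ Φ) = ∑ₗ (∂ₗu ∘ Φ) ∂ₖΦₗ` for weak gradients. -/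
lemma hasWeakGrad_comp (h : IsCompactDiffeo Ω Ψ Φ) (hΩ : IsOpen Ω) {u : Pt d → ℝ}
    {g : Fin d → Pt d → ℝ} (hu : HasWeakGrad Ω u g) :
    HasWeakGrad Ω (fun x => u (Φ x))
      (fun k x => ∑ l, fderiv ℝ Φ x (stdVec k) l * g l (Φ x)) := by
  refine ⟨h.symm.locallyIntegrableOn_comp hΩ hu.1, fun k => ⟨?_, fun η hη hc hs => ?_⟩⟩
  · have h1 : ∀ l, LocallyIntegrableOn (fun x => fderiv ℝ Φ x (stdVec k) l * g l (Φ x)) Ω volume := by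
      intro l
      have h2 : ContDiff ℝ ∞ (fun x => fderiv ℝ Φ x (stdVec k)) :=
        (h.contDiff_symm.fderiv_right (m := ∞) (by simp)).clm_apply contDiff_const
      exact (h.symm.locallyIntegrableOn_comp hΩ (hu.2 l).1).continuousOn_mul
        (contDiff_euclidean.1 h2 l).continuous.continuousOn hΩ.isLocallyClosed
    rw [locallyIntegrableOn_iff hΩ.isLocallyClosed]
    intro K hKΩ hK
    exact integrable_finsetSum _ fun l _ => (h1 l).integrableOn_compact_subset hKΩ hK
  · have hζ1 := fun l => h.contDiff_piola hη k l
    have hζ2 := fun l => h.hasCompactSupport_piola hc k l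
    have hζ3 := fun l => h.tsupport_piola_subset hs k l
    rw [h.setIntegral_eq hΩ.measurableSet (fun x => u (Φ x) * _),
      h.setIntegral_eq hΩ.measurableSet (fun x => _ * η x)]
    simp only [h.left_inv]
    have hae : ∀ᵐ y ∂(volume.restrict Ω), absJac Ψ y * (u y * fderiv ℝ η (Ψ y) (stdVec k)) =
        ∑ l, u y * fderiv ℝ (piola Ψ Φ η k l) y (stdVec l) := by
      filter_upwards [ae_restrict_of_ae (h.ae_div_piola_eq hη hc k)] with y hy
      rw [← Finset.mul_sum, hy]
      ring
    have hpt : ∀ y, absJac Ψ y * ((∑ l, fderiv ℝ Φ (Ψ y) (stdVec k) l * g l y) * η (Ψ y)) =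
        ∑ l, g l y * piola Ψ Φ η k l y := by
      intro y
      rw [Finset.sum_mul, Finset.mul_sum]
      refine Finset.sum_congr rfl fun l _ => ?_
      rw [piola]
      ring
    rw [integral_congr_ae hae, integral_finsetSum _ fun l _ =>
      (HasWeakGrad.integrable_mul_fderiv hu.1 l (hζ1 l) (hζ2 l) (hζ3 l)).integrableOn]
    simp only [hpt, fun l => hu.integral_mul_fderiv l (hζ1 l) (hζ2 l) (hζ3 l)]
    rw [integral_finsetSum _ fun l _ => (integrable_mul_of_tsupport_subset (hu.2 l).1
      (hζ1 l).continuous (hζ2 l) (hζ3 l)).integrableOn, Finset.sum_neg_distrib]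

end IsCompactDiffeo

open scoped Convolution

/-! ### Mollification -/

/-- The mollification `ρ ⋆ f` of `f` by a normalised bump function. -/
noncomputable def mollify (ρ : ContDiffBump (0 : Pt d)) (f : Pt d → ℝ) (x : Pt d) : ℝ :=
  ∫ t, ρ.normed volume t * f (x - t)

lemma mollify_eq_convolution (ρ : ContDiffBump (0 : Pt d)) (f : Pt d → ℝ) :
    mollify ρ f = ρ.normed volume ⋆[ContinuousLinearMap.lsmul ℝ ℝ, volume] f := by
  ext x
  simp [mollify, convolution_lsmul]

lemma integrable_mollify_integrand (ρ : ContDiffBump (0 : Pt d)) {f : Pt d → ℝ}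
    (hf : LocallyIntegrable f volume) (x : Pt d) :
    Integrable (fun t => ρ.normed volume t * f (x - t)) volume :=
  ρ.hasCompactSupport_normed.convolutionExists_left (ContinuousLinearMap.lsmul ℝ ℝ)
    ρ.continuous_normed hf x

lemma contDiff_mollify (ρ : ContDiffBump (0 : Pt d)) {f : Pt d → ℝ}
    (hf : LocallyIntegrable f volume) : ContDiff ℝ ∞ (mollify ρ f) := by
  rw [mollify_eq_convolution]
  exact ρ.hasCompactSupport_normed.contDiff_convolution_left _ ρ.contDiff_normed hf

lemma integrable_mollify (ρ : ContDiffBump (0 : Pt d)) {f : Pt d → ℝ}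
    (hf : Integrable f volume) : Integrable (mollify ρ f) volume := by
  rw [mollify_eq_convolution]
  exact ρ.integrable_normed.integrable_convolution _ hf

lemma integral_mollify (ρ : ContDiffBump (0 : Pt d)) {f : Pt d → ℝ}
    (hf : Integrable f volume) : ∫ x, mollify ρ f x = ∫ x, f x := by
  rw [mollify_eq_convolution, integral_convolution _ ρ.integrable_normed hf,
    ρ.integral_normed]
  simp

/-- Mollification commutes with weak differentiation. -/
lemma fderiv_mollify (ρ : ContDiffBump (0 : Pt d)) {u : Pt d → ℝ} {g : Fin d → Pt d → ℝ}
    (hu : HasWeakGrad univ u g) (k : Fin d) (x : Pt d) :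
    fderiv ℝ (mollify ρ u) x (stdVec k) = mollify ρ (g k) x := by
  have hul : LocallyIntegrable u volume := locallyIntegrableOn_univ.1 hu.1
  have hρ : ContDiff ℝ ∞ (ρ.normed (volume : Measure (Pt d))) := ρ.contDiff_normed
  have h1 := ρ.hasCompactSupport_normed.hasFDerivAt_convolution_left (μ := volume)
    (ContinuousLinearMap.lsmul ℝ ℝ) (hρ.of_le (by simp)) hul x
  have hint := (ρ.hasCompactSupport_normed.fderiv (𝕜 := ℝ)).convolutionExists_left (μ := volume)
    ((ContinuousLinearMap.lsmul ℝ ℝ).precompL (Pt d)) (hρ.continuous_fderiv (by simp)) hul x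
  set η : Pt d → ℝ := fun y => ρ.normed volume (x - y) with hη
  have hη1 : ContDiff ℝ ∞ η := hρ.comp (contDiff_const.sub contDiff_id)
  have hη2 : HasCompactSupport η :=
    ρ.hasCompactSupport_normed.comp_homeomorph (Homeomorph.subLeft x)
  have hη3 : ∀ y, fderiv ℝ η y (stdVec k) = -fderiv ℝ (ρ.normed volume) (x - y) (stdVec k) := by
    intro y
    have h2 : HasFDerivAt (fun y : Pt d => x - y) (-ContinuousLinearMap.id ℝ (Pt d)) y :=
      (hasFDerivAt_id y).const_sub x
    have h3 : HasFDerivAt η _ y :=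
      ((hρ.differentiable (by simp) (x - y)).hasFDerivAt).comp y h2
    rw [h3.fderiv]
    simp
  have h4 := hu.integral_mul_fderiv k hη1 hη2 (subset_univ _)
  rw [Measure.restrict_univ] at h4
  rw [mollify_eq_convolution, h1.fderiv, convolution_def, ContinuousLinearMap.integral_apply hint]
  simp only [ContinuousLinearMap.precompL_apply, ContinuousLinearMap.lsmul_apply, smul_eq_mul]
  rw [mollify, ← integral_sub_left_eq_self _ volume x,
    ← integral_sub_left_eq_self (fun t => ρ.normed volume t * g k (x - t)) volume x]
  simp only [sub_sub_cancel]
  have h5 : ∀ y, fderiv ℝ (ρ.normed volume) (x - y) (stdVec k) * u y =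
      -(u y * fderiv ℝ η y (stdVec k)) := fun y => by rw [hη3]; ring
  simp only [h5, integral_neg, h4, neg_neg]
  exact integral_congr_ae (Eventually.of_forall fun y => mul_comm _ _)

/-- Jensen's inequality for mollification. -/
lemma IsElasticDensity.map_mollify_le {φ : ℝ → ℝ} {p : ℝ} (hφ : IsElasticDensity φ p)
    (ρ : ContDiffBump (0 : Pt d)) {f : Pt d → ℝ} (hf : LocallyIntegrable f volume)
    (hi : LocallyIntegrable (fun x => φ |f x|) volume) (x : Pt d) :
    φ |mollify ρ f x| ≤ mollify ρ (fun x => φ |f x|) x := by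
  have hρ0 : ∀ t, 0 ≤ ρ.normed (volume : Measure (Pt d)) t := ρ.nonneg_normed
  have hi1 := integrable_mollify_integrand ρ hf x
  have hi2 := integrable_mollify_integrand ρ hi x
  have hi3 : Integrable (fun t => ρ.normed volume t * |f (x - t)|) volume := by
    refine hi1.abs.congr (Eventually.of_forall fun t => ?_)
    simp only [abs_mul, abs_of_nonneg (hρ0 t)]
  set a : ℝ := ∫ t, ρ.normed volume t * |f (x - t)| with ha
  have ha0 : 0 ≤ a := integral_nonneg fun t => mul_nonneg (hρ0 t) (abs_nonneg _)
  have h1 : |mollify ρ f x| ≤ a := by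
    refine (abs_integral_le_integral_abs).trans (le_of_eq ?_)
    refine integral_congr_ae (Eventually.of_forall fun t => ?_)
    simp only [abs_mul, abs_of_nonneg (hρ0 t)]
  refine (hφ.mono (abs_nonneg _) h1).trans ?_
  have hi4 : Integrable (fun t => ρ.normed volume t * (φ a - dphi φ a * a) +
      dphi φ a * (ρ.normed volume t * |f (x - t)|)) volume :=
    (ρ.integrable_normed.mul_const _).add (hi3.const_mul _)
  have h2 : ∫ t, (ρ.normed volume t * (φ a - dphi φ a * a) +
      dphi φ a * (ρ.normed volume t * |f (x - t)|)) = φ a := by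
    rw [integral_add (ρ.integrable_normed.mul_const _) (hi3.const_mul _), integral_mul_const,
      integral_const_mul, ρ.integral_normed, ← ha]
    ring
  rw [← h2]
  refine integral_mono hi4 hi2 fun t => ?_
  have h3 := mul_le_mul_of_nonneg_left (hφ.tangent_le ha0 (abs_nonneg (f (x - t)))) (hρ0 t)
  simp only
  linarith

/-- Mollifications converge in the modular of `φ`. The functions `φ |ρₙ ⋆ f - f|` converge to zero
almost everywhere and are dominated by `C (ρₙ ⋆ φ |f| + φ |f|)`, whose integrals do not depend
on `n`; so Fatou's lemma applies to the difference. -/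
lemma IsElasticDensity.tendsto_lintegral_mollify {φ : ℝ → ℝ} {p : ℝ} (hφ : IsElasticDensity φ p)
    {ρ : ℕ → ContDiffBump (0 : Pt d)} (hρ : Tendsto (fun n => (ρ n).rOut) atTop (𝓝 0)) {c : ℝ}
    (hρ' : ∀ n, (ρ n).rOut ≤ c * (ρ n).rIn) {f : Pt d → ℝ} (hf : Integrable f volume)
    (hi : Integrable (fun x => φ |f x|) volume) :
    Tendsto (fun n => ∫⁻ x, ENNReal.ofReal (φ |mollify (ρ n) f x - f x|)) atTop (𝓝 0) := by
  obtain ⟨C, hC, hadd⟩ := hφ.exists_map_add_le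
  set I : ℝ := ∫ x, φ |f x| with hI
  have hI0 : 0 ≤ I := integral_nonneg fun x => hφ.nonneg (abs_nonneg _)
  have hm : ∀ n, Integrable (mollify (ρ n) (fun x => φ |f x|)) volume :=
    fun n => integrable_mollify _ hi
  set D : ℕ → Pt d → ℝ := fun n x => C * (mollify (ρ n) (fun x => φ |f x|) x + φ |f x|) with hD
  have hDi : ∀ n, Integrable (D n) volume := fun n => ((hm n).add hi).const_mul C
  have hDint : ∀ n, ∫ x, D n x = 2 * C * I := by
    intro n
    simp only [hD]
    rw [integral_const_mul, integral_add (hm n) hi, integral_mollify _ hi, ← hI]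
    ring
  have hle : ∀ n x, φ |mollify (ρ n) f x - f x| ≤ D n x := by
    intro n x
    calc φ |mollify (ρ n) f x - f x| ≤ φ (|mollify (ρ n) f x| + |f x|) :=
          hφ.mono (abs_nonneg _) (abs_sub _ _)
      _ ≤ C * (φ |mollify (ρ n) f x| + φ |f x|) := hadd _ _ (abs_nonneg _) (abs_nonneg _)
      _ ≤ D n x := by
          simp only [hD]
          gcongr
          exact hφ.map_mollify_le _ hf.locallyIntegrable hi.locallyIntegrable x
  have hφ0 : ∀ n x, 0 ≤ φ |mollify (ρ n) f x - f x| := fun n x => hφ.nonneg (abs_nonneg _)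
  have hmeas : ∀ n, AEStronglyMeasurable (fun x => φ |mollify (ρ n) f x - f x|) volume :=
    fun n => hφ.aestronglyMeasurable_comp
      ((integrable_mollify _ hf).sub hf).aestronglyMeasurable.norm fun x => abs_nonneg _
  have hint : ∀ n, Integrable (fun x => φ |mollify (ρ n) f x - f x|) volume := fun n =>
    (hDi n).mono' (hmeas n) (Eventually.of_forall fun x => by
      rw [Real.norm_of_nonneg (hφ0 n x)]; exact hle n x)
  set a : ℕ → ℝ := fun n => ∫ x, φ |mollify (ρ n) f x - f x| with ha
  have ha0 : ∀ n, 0 ≤ a n := fun n => integral_nonneg (hφ0 n)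
  have haI : ∀ n, a n ≤ 2 * C * I := fun n => by
    rw [← hDint n]
    exact integral_mono (hint n) (hDi n) (hle n)
  have hae1 := ContDiffBump.ae_convolution_tendsto_right_of_locallyIntegrable (μ := volume) hρ
    (Eventually.of_forall hρ') hf.locallyIntegrable
  have hae2 := ContDiffBump.ae_convolution_tendsto_right_of_locallyIntegrable (μ := volume) hρ
    (Eventually.of_forall hρ') hi.locallyIntegrable
  simp only [← mollify_eq_convolution] at hae1 hae2
  have hlim : ∀ᵐ x, Tendsto (fun n => ENNReal.ofReal (D n x - φ |mollify (ρ n) f x - f x|)) atTop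
      (𝓝 (ENNReal.ofReal (2 * C * φ |f x|))) := by
    filter_upwards [hae1, hae2] with x h1 h2
    have h3 : Tendsto (fun n => φ |mollify (ρ n) f x - f x|) atTop (𝓝 0) := by
      have h4 : Tendsto (fun n => |mollify (ρ n) f x - f x|) atTop (𝓝[Ici 0] 0) := by
        refine tendsto_nhdsWithin_iff.2 ⟨?_, Eventually.of_forall fun n => mem_Ici.2 (abs_nonneg _)⟩
        have := (h1.sub_const (f x)).abs
        simpa using this
      have h5 := (hφ.continuousOn 0 (mem_Ici.2 le_rfl)).tendsto.comp h4
      rwa [hφ.map_zero] at h5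
    refine (ENNReal.continuous_ofReal.tendsto _).comp ?_
    have h6 := ((h2.add_const (φ |f x|)).const_mul C).sub h3
    convert h6 using 2
    ring
  have hfatou : ENNReal.ofReal (2 * C * I) ≤
      liminf (fun n => ENNReal.ofReal (2 * C * I - a n)) atTop := by
    have h1 : ENNReal.ofReal (2 * C * I) = ∫⁻ x, ENNReal.ofReal (2 * C * φ |f x|) := by
      rw [← ofReal_integral_eq_lintegral_ofReal (hi.const_mul _)
        (Eventually.of_forall fun x => by have := hφ.nonneg (abs_nonneg (f x)); positivity),
        integral_const_mul]
    have h2 : ∀ n, ENNReal.ofReal (2 * C * I - a n) =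
        ∫⁻ x, ENNReal.ofReal (D n x - φ |mollify (ρ n) f x - f x|) := by
      intro n
      have h3 : ∫ x, (D n x - φ |mollify (ρ n) f x - f x|) = 2 * C * I - a n := by
        rw [integral_sub (hDi n) (hint n), hDint]
      rw [← h3]
      exact ofReal_integral_eq_lintegral_ofReal ((hDi n).sub (hint n))
        (Eventually.of_forall fun x => sub_nonneg.2 (hle n x))
    simp only [h1, h2]
    refine le_trans (le_of_eq (lintegral_congr_ae ?_)) (lintegral_liminf_le' fun n =>
      ((hDi n).sub (hint n)).aestronglyMeasurable.aemeasurable.ennreal_ofReal)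
    filter_upwards [hlim] with x hx using hx.liminf_eq.symm
  have hatend : Tendsto a atTop (𝓝 0) := by
    rw [Metric.tendsto_atTop']
    intro ε hε
    rcases (mul_nonneg (mul_nonneg zero_le_two hC) hI0).eq_or_lt with h0 | hpos
    · refine ⟨0, fun n _ => ?_⟩
      have : a n = 0 := le_antisymm ((haI n).trans h0.symm.le) (ha0 n)
      simpa [this] using hε
    · have h1 : ENNReal.ofReal (2 * C * I - ε) < ENNReal.ofReal (2 * C * I) :=
        (ENNReal.ofReal_lt_ofReal_iff hpos).2 (by linarith)
      obtain ⟨N, hN⟩ := eventually_atTop.1 (eventually_lt_of_lt_liminf (h1.trans_le hfatou))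
      refine ⟨N, fun n hn => ?_⟩
      have h2 : 2 * C * I - ε < 2 * C * I - a n := by
        by_contra hcon
        exact absurd (hN n hn.le) (not_lt.2 (ENNReal.ofReal_le_ofReal (not_lt.1 hcon)))
      rw [Real.dist_eq, sub_zero, abs_of_nonneg (ha0 n)]
      linarith
  have h1 := (ENNReal.continuous_ofReal.tendsto _).comp hatend
  rw [ENNReal.ofReal_zero] at h1
  refine h1.congr fun n => ?_
  exact ofReal_integral_eq_lintegral_ofReal (hint n) (Eventually.of_forall (hφ0 n))

/-! ### Euclidean norms of families of real numbers -/

/-- The Euclidean norm of a finite family; `frob` and `gradNorm` are instances of it. -/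
noncomputable def l2 {ι : Type*} [Fintype ι] (a : ι → ℝ) : ℝ := √(∑ i, a i ^ 2)

section l2

variable {ι : Type*} [Fintype ι]

lemma l2_nonneg (a : ι → ℝ) : 0 ≤ l2 a := Real.sqrt_nonneg _

lemma abs_le_l2 (a : ι → ℝ) (i : ι) : |a i| ≤ l2 a :=
  Real.abs_le_sqrt (Finset.single_le_sum (f := fun i => a i ^ 2) (fun _ _ => sq_nonneg _)
    (Finset.mem_univ i))

lemma l2_le_sum_abs (a : ι → ℝ) : l2 a ≤ ∑ i, |a i| := by
  refine (Real.sqrt_le_left (Finset.sum_nonneg fun i _ => abs_nonneg _)).2 ?_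
  calc ∑ i, a i ^ 2 = ∑ i, |a i| ^ 2 := by simp
    _ ≤ (∑ i, |a i|) ^ 2 := Finset.sum_sq_le_sq_sum_of_nonneg fun i _ => abs_nonneg _

lemma frob_eq_l2 (P : Mat) : frob P = l2 (fun q : Fin 3 × Fin 3 => P q.1 q.2) := by
  rw [frob, l2, Fintype.sum_prod_type]

lemma gradNorm_eq_l2 (G : Fin d → Mat) :
    gradNorm G = l2 (fun q : Fin d × Fin 3 × Fin 3 => G q.1 q.2.1 q.2.2) := by
  simp only [gradNorm, l2, Fintype.sum_prod_type]

lemma frob_nonneg (P : Mat) : 0 ≤ frob P := Real.sqrt_nonneg _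

lemma gradNorm_nonneg (G : Fin d → Mat) : 0 ≤ gradNorm G := Real.sqrt_nonneg _

lemma frob_zero : frob 0 = 0 := by simp [frob]

lemma gradNorm_zero : gradNorm (0 : Fin d → Mat) = 0 := by simp [gradNorm]

lemma aestronglyMeasurable_l2 {α : Type*} [MeasurableSpace α] {μ : Measure α} {a : α → ι → ℝ}
    (ha : ∀ i, AEStronglyMeasurable (fun x => a x i) μ) :
    AEStronglyMeasurable (fun x => l2 (a x)) μ :=
  Real.continuous_sqrt.comp_aestronglyMeasurable
    (Finset.aestronglyMeasurable_fun_sum _ fun i _ => (ha i).pow 2)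

lemma aestronglyMeasurable_frob {α : Type*} [MeasurableSpace α] {μ : Measure α} {a : α → Mat}
    (ha : ∀ i j, AEStronglyMeasurable (fun x => a x i j) μ) :
    AEStronglyMeasurable (fun x => frob (a x)) μ := by
  simp only [frob_eq_l2]
  exact aestronglyMeasurable_l2 fun q => ha _ _

lemma aestronglyMeasurable_gradNorm {α : Type*} [MeasurableSpace α] {μ : Measure α}
    {a : α → Fin d → Mat} (ha : ∀ k i j, AEStronglyMeasurable (fun x => a x k i j) μ) :
    AEStronglyMeasurable (fun x => gradNorm (a x)) μ := by
  simp only [gradNorm_eq_l2]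
  exact aestronglyMeasurable_l2 fun q => ha _ _ _

namespace IsElasticDensity

variable {φ : ℝ → ℝ} {p : ℝ}

lemma map_abs_le_map_l2 (hφ : IsElasticDensity φ p) (a : ι → ℝ) (i : ι) : φ |a i| ≤ φ (l2 a) :=
  hφ.mono (abs_nonneg _) (abs_le_l2 a i)

lemma exists_map_l2_le (hφ : IsElasticDensity φ p) (ι : Type*) [Fintype ι] :
    ∃ C : ℝ, 0 ≤ C ∧ ∀ a : ι → ℝ, φ (l2 a) ≤ C * ∑ i, φ |a i| := by
  obtain ⟨C, hC, h⟩ := hφ.exists_map_sum_le ι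
  exact ⟨C, hC, fun a => (hφ.mono (l2_nonneg a) (l2_le_sum_abs a)).trans
    (h _ fun i => abs_nonneg _)⟩

lemma exists_map_l2_add_le (hφ : IsElasticDensity φ p) (ι : Type*) [Fintype ι] :
    ∃ C : ℝ, 0 ≤ C ∧ ∀ a b : ι → ℝ, φ (l2 (fun i => a i + b i)) ≤ C * (φ (l2 a) + φ (l2 b)) := by
  obtain ⟨C, hC, h⟩ := hφ.exists_map_l2_le ι
  obtain ⟨C', hC', h'⟩ := hφ.exists_map_add_le
  refine ⟨C * (Fintype.card ι * C'), by positivity, fun a b => (h _).trans ?_⟩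
  rw [mul_assoc]
  refine mul_le_mul_of_nonneg_left ?_ hC
  calc ∑ i, φ |a i + b i| ≤ ∑ _i : ι, C' * (φ (l2 a) + φ (l2 b)) := by
        refine Finset.sum_le_sum fun i _ => ?_
        calc φ |a i + b i| ≤ φ (|a i| + |b i|) := hφ.mono (abs_nonneg _) (abs_add_le _ _)
          _ ≤ C' * (φ |a i| + φ |b i|) := h' _ _ (abs_nonneg _) (abs_nonneg _)
          _ ≤ C' * (φ (l2 a) + φ (l2 b)) := by
              gcongr
              · exact hφ.map_abs_le_map_l2 a i
              · exact hφ.map_abs_le_map_l2 b i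
    _ = _ := by simp; ring

lemma exists_map_frob_add_le (hφ : IsElasticDensity φ p) :
    ∃ C : ℝ, 0 ≤ C ∧ ∀ P P' : Mat, φ (frob (P + P')) ≤ C * (φ (frob P) + φ (frob P')) := by
  obtain ⟨C, hC, h⟩ := hφ.exists_map_l2_add_le (Fin 3 × Fin 3)
  refine ⟨C, hC, fun P P' => ?_⟩
  simp only [frob_eq_l2]
  exact h _ _

lemma exists_map_gradNorm_add_le (hφ : IsElasticDensity φ p) (d : ℕ) :
    ∃ C : ℝ, 0 ≤ C ∧ ∀ G G' : Fin d → Mat,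
      φ (gradNorm (G + G')) ≤ C * (φ (gradNorm G) + φ (gradNorm G')) := by
  obtain ⟨C, hC, h⟩ := hφ.exists_map_l2_add_le (Fin d × Fin 3 × Fin 3)
  refine ⟨C, hC, fun P P' => ?_⟩
  simp only [gradNorm_eq_l2]
  exact h _ _

end IsElasticDensity

end l2

lemma IsWeakGrad.aestronglyMeasurable {Q : Pt d → Mat} {G : Pt d → Fin d → Mat}
    (h : IsWeakGrad Ω Q G) (i j : Fin 3) :
    AEStronglyMeasurable (fun x => Q x i j) (volume.restrict Ω) :=
  (h i j).1.aestronglyMeasurable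

lemma IsWeakGrad.aestronglyMeasurable_grad {Q : Pt d → Mat} {G : Pt d → Fin d → Mat}
    (h : IsWeakGrad Ω Q G) (k : Fin d) (i j : Fin 3) :
    AEStronglyMeasurable (fun x => G x k i j) (volume.restrict Ω) :=
  ((h i j).2 k).1.aestronglyMeasurable

lemma IsTestMap.continuous_classicalGrad {w : Pt d → Mat} (hw : IsTestMap Ω w) (k : Fin d)
    (i j : Fin 3) : Continuous (fun x => classicalGrad w x k i j) :=
  continuous_fderiv_apply_const (hw i j).1 _

/-! ### Compactly supported maps belong to `W^{1,φ}_0` -/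

lemma integrable_of_eq_zero_off_compact {u : Pt d → ℝ} {K : Set (Pt d)}
    (hu : LocallyIntegrableOn u Ω volume) (hK : IsCompact K) (hKΩ : K ⊆ Ω)
    (h0 : ∀ x, x ∉ K → u x = 0) : Integrable u volume := by
  refine (integrableOn_iff_integrable_of_support_subset fun x hx => ?_).1
    (hu.integrableOn_compact_subset hKΩ hK)
  by_contra hxK
  exact hx (h0 x hxK)

/-- A function with compact support in `Ω` has the same weak gradient in the whole space. -/
lemma HasWeakGrad.univ_of_eq_zero_off_compact (hΩ : IsOpen Ω) {u : Pt d → ℝ}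
    {g : Fin d → Pt d → ℝ} (hu : HasWeakGrad Ω u g) {K : Set (Pt d)} (hK : IsCompact K)
    (hKΩ : K ⊆ Ω) (h0 : ∀ x, x ∉ K → u x = 0) (hg0 : ∀ k x, x ∉ K → g k x = 0) :
    HasWeakGrad univ u g := by
  refine ⟨(integrable_of_eq_zero_off_compact hu.1 hK hKΩ h0).locallyIntegrable.locallyIntegrableOn _,
    fun k => ⟨(integrable_of_eq_zero_off_compact (hu.2 k).1 hK hKΩ
      (hg0 k)).locallyIntegrable.locallyIntegrableOn _, fun η h1 h2 _ => ?_⟩⟩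
  obtain ⟨L, hL, hKL, hLΩ⟩ := exists_compact_between hK hΩ hKΩ
  obtain ⟨ζ, hζ1, hζ0, -⟩ := exists_contMDiffMap_one_nhds_of_subset_interior (n := ⊤)
    (modelWithCornersSelf ℝ (Pt d)) hK.isClosed hKL
  have hζ : ContDiff ℝ ∞ (ζ : Pt d → ℝ) := ζ.contMDiff.contDiff
  have hζs : tsupport (ζ : Pt d → ℝ) ⊆ L := by
    refine closure_minimal (fun x hx => ?_) hL.isClosed
    by_contra hxL
    exact hx (hζ0 x hxL)
  have h3 := hu.integral_mul_fderiv k (η := fun x => ζ x * η x) (hζ.mul h1) h2.mul_left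
    ((tsupport_mul_subset_left).trans (hζs.trans hLΩ))
  have hK1 : ∀ x ∈ K, (ζ : Pt d → ℝ) =ᶠ[𝓝 x] fun _ => 1 := fun x hx =>
    hζ1.filter_mono (nhds_le_nhdsSet hx)
  have e1 : ∀ x, u x * fderiv ℝ (fun x => ζ x * η x) x (stdVec k) =
      u x * fderiv ℝ η x (stdVec k) := by
    intro x
    by_cases hx : x ∈ K
    · have : (fun x => ζ x * η x) =ᶠ[𝓝 x] η := by
        filter_upwards [hK1 x hx] with y hy
        rw [hy, one_mul]
      rw [this.fderiv_eq]
    · simp [h0 x hx]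
  have e2 : ∀ x, g k x * (ζ x * η x) = g k x * η x := by
    intro x
    by_cases hx : x ∈ K
    · rw [(hK1 x hx).self_of_nhds, one_mul]
    · simp [hg0 k x hx]
  simp only [e1, e2] at h3
  rw [setIntegral_eq_integral_of_forall_compl_eq_zero (s := Ω) fun x hx => by
      simp [h0 x fun h => hx (hKΩ h)],
    setIntegral_eq_integral_of_forall_compl_eq_zero (s := Ω) fun x hx => by
      simp [hg0 k x fun h => hx (hKΩ h)]] at h3
  rwa [Measure.restrict_univ]

lemma mollify_eq_zero (ρ : ContDiffBump (0 : Pt d)) {u : Pt d → ℝ} {K : Set (Pt d)} {δ : ℝ}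
    (hρ : ρ.rOut ≤ δ) (h0 : ∀ x, x ∉ K → u x = 0) {x : Pt d}
    (hx : x ∉ Metric.cthickening δ K) : mollify ρ u x = 0 := by
  refine integral_eq_zero_of_ae (Eventually.of_forall fun t => ?_)
  by_cases ht : t ∈ Metric.ball (0 : Pt d) ρ.rOut
  · have : x - t ∉ K := by
      intro hK
      refine hx (Metric.mem_cthickening_of_dist_le x (x - t) δ K hK ?_)
      rw [dist_eq_norm, sub_sub_cancel]
      rw [mem_ball_zero_iff] at ht
      exact ht.le.trans hρ
    simp [h0 _ this]
  · have : ρ.normed (volume : Measure (Pt d)) t = 0 := by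
      rw [← ρ.support_normed_eq (μ := volume)] at ht
      exact Function.notMem_support.1 ht
    simp [this]

lemma tendsto_lintegral_of_le_sum {α ι : Type*} [MeasurableSpace α] [Fintype ι] {μ : Measure α}
    {F : ℕ → α → ℝ} {f : ι → ℕ → α → ℝ} {C : ℝ}
    (hle : ∀ n, ∀ᵐ x ∂μ, F n x ≤ C * ∑ i, f i n x) (hf0 : ∀ i n x, 0 ≤ f i n x)
    (hfm : ∀ i n, AEStronglyMeasurable (f i n) μ)
    (hf : ∀ i, Tendsto (fun n => ∫⁻ x, ENNReal.ofReal (f i n x) ∂μ) atTop (𝓝 0)) :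
    Tendsto (fun n => ∫⁻ x, ENNReal.ofReal (F n x) ∂μ) atTop (𝓝 0) := by
  have h1 : Tendsto (fun n => ENNReal.ofReal C * ∑ i, ∫⁻ x, ENNReal.ofReal (f i n x) ∂μ) atTop
      (𝓝 0) := by
    have h2 := ENNReal.Tendsto.const_mul (a := ENNReal.ofReal C)
      (tendsto_finsetSum Finset.univ fun i _ => hf i) (Or.inr ENNReal.ofReal_ne_top)
    simpa using h2
  refine tendsto_of_tendsto_of_tendsto_of_le_of_le tendsto_const_nhds h1 (fun n => zero_le)
    fun n => ?_
  calc ∫⁻ x, ENNReal.ofReal (F n x) ∂μ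
      ≤ ∫⁻ x, ENNReal.ofReal C * ∑ i, ENNReal.ofReal (f i n x) ∂μ := by
        refine lintegral_mono_ae ((hle n).mono fun x hx => ?_)
        rw [← ENNReal.ofReal_sum_of_nonneg fun i _ => hf0 i n x,
          ← ENNReal.ofReal_mul' (Finset.sum_nonneg fun i _ => hf0 i n x)]
        exact ENNReal.ofReal_le_ofReal hx
    _ = ENNReal.ofReal C * ∑ i, ∫⁻ x, ENNReal.ofReal (f i n x) ∂μ := by
        rw [lintegral_const_mul' _ _ ENNReal.ofReal_ne_top, lintegral_finsetSum' _ fun i _ =>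
          (hfm i n).aemeasurable.ennreal_ofReal]

/-- Componentwise mollification approximates compactly supported maps by test maps. -/
lemma IsElasticDensity.exists_testMap_tendsto {φ : ℝ → ℝ} {p : ℝ} (hφ : IsElasticDensity φ p)
    (hΩ : IsOpen Ω) {U : Pt d → Mat} {H : Pt d → Fin d → Mat} (hU : IsWeakGrad Ω U H)
    {K : Set (Pt d)} (hK : IsCompact K) (hKΩ : K ⊆ Ω) (hU0 : ∀ x, x ∉ K → U x = 0)
    (hH0 : ∀ x, x ∉ K → H x = 0) (hUi : IntegrableOn (fun x => φ (frob (U x))) Ω volume)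
    (hHi : IntegrableOn (fun x => φ (gradNorm (H x))) Ω volume) :
    ∃ w : ℕ → Pt d → Mat, (∀ n, IsTestMap Ω (w n)) ∧
      Tendsto (fun n => ∫⁻ x in Ω, ENNReal.ofReal (φ (frob (w n x - U x)))) atTop (𝓝 0) ∧
      Tendsto (fun n => ∫⁻ x in Ω,
        ENNReal.ofReal (φ (gradNorm (classicalGrad (w n) x - H x)))) atTop (𝓝 0) := by
  obtain ⟨δ, hδ, hδΩ⟩ := hK.exists_cthickening_subset_open hΩ hKΩ
  let ρ : ℕ → ContDiffBump (0 : Pt d) := fun n =>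
    ⟨δ / (2 * (n + 1)), δ / (n + 1), by positivity,
      div_lt_div_of_pos_left hδ (by positivity) (by linarith [n.cast_nonneg (α := ℝ)])⟩
  have hρδ : ∀ n, (ρ n).rOut ≤ δ := fun n =>
    div_le_self hδ.le (by linarith [n.cast_nonneg (α := ℝ)])
  have hρ0 : Tendsto (fun n => (ρ n).rOut) atTop (𝓝 0) :=
    tendsto_const_nhds.div_atTop (tendsto_atTop_add_const_right _ _ tendsto_natCast_atTop_atTop)
  have hρc : ∀ n, (ρ n).rOut ≤ 2 * (ρ n).rIn := by
    intro n
    change δ / (n + 1) ≤ 2 * (δ / (2 * (n + 1)))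
    apply le_of_eq
    field_simp
  have hW : ∀ i j, HasWeakGrad univ (fun x => U x i j) (fun k x => H x k i j) := fun i j =>
    HasWeakGrad.univ_of_eq_zero_off_compact hΩ (hU i j) hK hKΩ
      (fun x hx => by simp [hU0 x hx]) (fun k x hx => by simp [hH0 x hx])
  have hUint : ∀ i j, Integrable (fun x => U x i j) volume := fun i j =>
    integrable_of_eq_zero_off_compact (hU i j).1 hK hKΩ fun x hx => by simp [hU0 x hx]
  have hHint : ∀ k i j, Integrable (fun x => H x k i j) volume := fun k i j =>
    integrable_of_eq_zero_off_compact ((hU i j).2 k).1 hK hKΩ fun x hx => by simp [hH0 x hx]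
  have hUφ : ∀ i j, Integrable (fun x => φ |U x i j|) volume := by
    intro i j
    have h1 : Integrable (fun x => φ (frob (U x))) volume :=
      (integrableOn_iff_integrable_of_support_subset fun x hx => by
        by_contra hxΩ
        exact hx (by simp [hU0 x fun h => hxΩ (hKΩ h), frob_zero, hφ.map_zero])).1 hUi
    refine h1.mono' (hφ.aestronglyMeasurable_comp (hUint i j).aestronglyMeasurable.norm
      fun x => abs_nonneg _) (Eventually.of_forall fun x => ?_)
    rw [Real.norm_of_nonneg (hφ.nonneg (abs_nonneg _)), frob_eq_l2]
    exact hφ.map_abs_le_map_l2 (fun q : Fin 3 × Fin 3 => U x q.1 q.2) (i, j)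
  have hHφ : ∀ k i j, Integrable (fun x => φ |H x k i j|) volume := by
    intro k i j
    have h1 : Integrable (fun x => φ (gradNorm (H x))) volume :=
      (integrableOn_iff_integrable_of_support_subset fun x hx => by
        by_contra hxΩ
        exact hx (by simp [hH0 x fun h => hxΩ (hKΩ h), gradNorm_zero, hφ.map_zero])).1 hHi
    refine h1.mono' (hφ.aestronglyMeasurable_comp (hHint k i j).aestronglyMeasurable.norm
      fun x => abs_nonneg _) (Eventually.of_forall fun x => ?_)
    rw [Real.norm_of_nonneg (hφ.nonneg (abs_nonneg _)), gradNorm_eq_l2]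
    exact hφ.map_abs_le_map_l2 (fun q : Fin d × Fin 3 × Fin 3 => H x q.1 q.2.1 q.2.2) (k, i, j)
  have hlim : ∀ f : Pt d → ℝ, Integrable f volume → Integrable (fun x => φ |f x|) volume →
      Tendsto (fun n => ∫⁻ x in Ω, ENNReal.ofReal (φ |mollify (ρ n) f x - f x|)) atTop (𝓝 0) := by
    intro f hf hf'
    exact tendsto_of_tendsto_of_tendsto_of_le_of_le tendsto_const_nhds
      (hφ.tendsto_lintegral_mollify hρ0 hρc hf hf') (fun n => zero_le)
      fun n => setLIntegral_le_lintegral _ _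
  have hmeas : ∀ (f : Pt d → ℝ) (n : ℕ), Integrable f volume →
      AEStronglyMeasurable (fun x => φ |mollify (ρ n) f x - f x|) (volume.restrict Ω) :=
    fun f n hf => (hφ.aestronglyMeasurable_comp
      ((integrable_mollify _ hf).sub hf).aestronglyMeasurable.norm fun x => abs_nonneg _).restrict
  refine ⟨fun n x => Matrix.of fun i j => mollify (ρ n) (fun y => U y i j) x, ?_, ?_, ?_⟩
  · intro n i j
    have hs : tsupport (mollify (ρ n) (fun y => U y i j)) ⊆ Metric.cthickening δ K := by
      refine closure_minimal (fun x hx => ?_) Metric.isClosed_cthickening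
      by_contra hxK
      exact hx (mollify_eq_zero (ρ n) (hρδ n) (fun y hy => by simp [hU0 y hy]) hxK)
    exact ⟨contDiff_mollify _ (hUint i j).locallyIntegrable,
      hK.cthickening.of_isClosed_subset (isClosed_tsupport _) hs, hs.trans hδΩ⟩
  · obtain ⟨C, hC, h⟩ := hφ.exists_map_l2_le (Fin 3 × Fin 3)
    refine tendsto_lintegral_of_le_sum (C := C)
      (f := fun (q : Fin 3 × Fin 3) n x =>
        φ |mollify (ρ n) (fun y => U y q.1 q.2) x - U x q.1 q.2|)
      (fun n => Eventually.of_forall fun x => ?_) (fun q n x => hφ.nonneg (abs_nonneg _))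
      (fun q n => hmeas _ n (hUint _ _)) (fun q => hlim _ (hUint _ _) (hUφ _ _))
    rw [frob_eq_l2]
    exact h _
  · obtain ⟨C, hC, h⟩ := hφ.exists_map_l2_le (Fin d × Fin 3 × Fin 3)
    refine tendsto_lintegral_of_le_sum (C := C)
      (f := fun (q : Fin d × Fin 3 × Fin 3) n x =>
        φ |mollify (ρ n) (fun y => H y q.1 q.2.1 q.2.2) x - H x q.1 q.2.1 q.2.2|)
      (fun n => Eventually.of_forall fun x => ?_) (fun q n x => hφ.nonneg (abs_nonneg _))
      (fun q n => hmeas _ n (hHint _ _ _)) (fun q => hlim _ (hHint _ _ _) (hHφ _ _ _))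
    rw [gradNorm_eq_l2]
    refine (h _).trans (le_of_eq ?_)
    refine congrArg (C * ·) (Finset.sum_congr rfl fun q _ => ?_)
    have := fderiv_mollify (ρ n) (hW q.2.1 q.2.2) q.1 x
    rw [← this]
    rfl

/-- Adding a compactly supported map does not change the boundary values. -/
lemma MemW10phi.add_of_eq_zero_off_compact {φ : ℝ → ℝ} {p : ℝ} {V : Pt d → Mat}
    (hV : MemW10phi Ω φ V) (hφ : IsElasticDensity φ p)
    (hΩ : IsOpen Ω) {U : Pt d → Mat} {H : Pt d → Fin d → Mat} (hU : IsWeakGrad Ω U H)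
    {K : Set (Pt d)} (hK : IsCompact K) (hKΩ : K ⊆ Ω) (hU0 : ∀ x, x ∉ K → U x = 0)
    (hH0 : ∀ x, x ∉ K → H x = 0) (hUi : IntegrableOn (fun x => φ (frob (U x))) Ω volume)
    (hHi : IntegrableOn (fun x => φ (gradNorm (H x))) Ω volume) :
    MemW10phi Ω φ (fun x => U x + V x) := by
  obtain ⟨C, hC, hfrob⟩ := hφ.exists_map_frob_add_le
  obtain ⟨C', hC', hgrad⟩ := hφ.exists_map_gradNorm_add_le d
  have hVG := weakGrad_spec hV.mem.exists_weakGrad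
  have hsum : IsWeakGrad Ω (fun x => U x + V x) (fun x => H x + weakGrad Ω V x) :=
    fun i j => HasWeakGrad.add (hU i j) (hVG i j)
  have hae := weakGrad_ae_eq hΩ hsum
  refine ⟨⟨⟨_, hsum⟩, ?_, ?_⟩, ?_⟩
  · refine ((hUi.add hV.mem.integrable_self).const_mul C).mono'
      (hφ.aestronglyMeasurable_comp (aestronglyMeasurable_frob fun i j =>
        hsum.aestronglyMeasurable i j) fun x => frob_nonneg _) (Eventually.of_forall fun x => ?_)
    rw [Real.norm_of_nonneg (hφ.nonneg (frob_nonneg _))]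
    exact hfrob _ _
  · have h1 : IntegrableOn (fun x => φ (gradNorm (H x + weakGrad Ω V x))) Ω volume := by
      refine ((hHi.add hV.mem.integrable_grad).const_mul C').mono'
        (hφ.aestronglyMeasurable_comp (aestronglyMeasurable_gradNorm fun k i j =>
          hsum.aestronglyMeasurable_grad k i j) fun x => gradNorm_nonneg _)
        (Eventually.of_forall fun x => ?_)
      rw [Real.norm_of_nonneg (hφ.nonneg (gradNorm_nonneg _))]
      exact hgrad _ _
    refine Integrable.congr h1 ?_
    filter_upwards [hae] with x hx
    rw [hx]
  · obtain ⟨w₁, ht₁, hl₁, hg₁⟩ := hφ.exists_testMap_tendsto hΩ hU hK hKΩ hU0 hH0 hUi hHi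
    obtain ⟨w₂, ht₂, hl₂, hg₂⟩ := hV.approx
    refine ⟨fun n x => w₁ n x + w₂ n x, fun n i j => ⟨(ht₁ n i j).1.add (ht₂ n i j).1,
      (ht₁ n i j).2.1.add (ht₂ n i j).2.1, ?_⟩, ?_, ?_⟩
    · exact (tsupport_add _ _).trans (union_subset (ht₁ n i j).2.2 (ht₂ n i j).2.2)
    · refine tendsto_lintegral_of_le_sum (C := C)
        (f := ![fun n x => φ (frob (w₁ n x - U x)), fun n x => φ (frob (w₂ n x - V x))])
        (fun n => Eventually.of_forall fun x => ?_) ?_ ?_ ?_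
      · simp only [Fin.sum_univ_two, Matrix.cons_val_zero, Matrix.cons_val_one]
        rw [add_sub_add_comm]
        exact hfrob _ _
      · intro i n x
        fin_cases i <;> exact hφ.nonneg (frob_nonneg _)
      · intro i n
        fin_cases i
        · exact hφ.aestronglyMeasurable_comp (aestronglyMeasurable_frob fun i j =>
            (ht₁ n i j).1.continuous.aestronglyMeasurable.sub (hU.aestronglyMeasurable i j))
            fun x => frob_nonneg _
        · exact hφ.aestronglyMeasurable_comp (aestronglyMeasurable_frob fun i j =>
            (ht₂ n i j).1.continuous.aestronglyMeasurable.sub (hVG.aestronglyMeasurable i j))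
            fun x => frob_nonneg _
      · intro i
        fin_cases i
        · exact hl₁
        · exact hl₂
    · refine tendsto_lintegral_of_le_sum (C := C')
        (f := ![fun n x => φ (gradNorm (classicalGrad (w₁ n) x - H x)),
          fun n x => φ (gradNorm (classicalGrad (w₂ n) x - weakGrad Ω V x))])
        (fun n => ?_) ?_ ?_ ?_
      · filter_upwards [hae] with x hx
        simp only [Fin.sum_univ_two, Matrix.cons_val_zero, Matrix.cons_val_one]
        have e : classicalGrad (fun x => w₁ n x + w₂ n x) x =
            classicalGrad (w₁ n) x + classicalGrad (w₂ n) x := by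
          ext k i j
          have := fderiv_fun_add ((ht₁ n i j).1.differentiable (by simp) x)
            ((ht₂ n i j).1.differentiable (by simp) x)
          simp only [classicalGrad, Matrix.of_apply, Pi.add_apply, Matrix.add_apply, this,
            add_apply]
        rw [hx, e, add_sub_add_comm]
        exact hgrad _ _
      · intro i n x
        fin_cases i <;> exact hφ.nonneg (gradNorm_nonneg _)
      · intro i n
        fin_cases i
        · exact hφ.aestronglyMeasurable_comp (aestronglyMeasurable_gradNorm fun k i j =>
            ((ht₁ n).continuous_classicalGrad k i j).aestronglyMeasurable.sub
              (hU.aestronglyMeasurable_grad k i j)) fun x => gradNorm_nonneg _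
        · exact hφ.aestronglyMeasurable_comp (aestronglyMeasurable_gradNorm fun k i j =>
            ((ht₂ n).continuous_classicalGrad k i j).aestronglyMeasurable.sub
              (hVG.aestronglyMeasurable_grad k i j)) fun x => gradNorm_nonneg _
      · intro i
        fin_cases i
        · exact hg₁
        · exact hg₂

/-! ### Radial contractions -/

open scoped RealInnerProductSpace

/-- Small smooth compactly supported perturbations of the identity are diffeomorphisms. -/
lemma exists_isCompactDiffeo_sub_smul {W : Pt d → Pt d} (hW : ContDiff ℝ ∞ W)
    (hc : HasCompactSupport W) (hs : tsupport W ⊆ Ω) :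
    ∃ s₀ : ℝ, 0 < s₀ ∧ ∀ s, 0 < s → s < s₀ → ∃ Φ, IsCompactDiffeo Ω (fun y => y - s • W y) Φ := by
  obtain ⟨c, hc'⟩ := hW.lipschitzWith_of_hasCompactSupport hc (by simp)
  refine ⟨1 / (c + 1), by positivity, fun s hs0 hs1 => ?_⟩
  have hsc : s * c < 1 := by
    rw [lt_div_iff₀ (by positivity)] at hs1
    linarith
  set Ψ : Pt d → Pt d := fun y => y - s • W y with hΨ
  have hΨs : ContDiff ℝ ∞ Ψ := contDiff_id.sub (hW.const_smul s)
  have happrox : ApproximatesLinearOn Ψ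
      ((ContinuousLinearEquiv.refl ℝ (Pt d) : Pt d ≃L[ℝ] Pt d) : Pt d →L[ℝ] Pt d) univ
      (s.toNNReal * c) := by
    intro x _ y _
    have h1 : Ψ x - Ψ y - (x - y) = -(s • (W x - W y)) := by
      simp only [hΨ, smul_sub]
      abel
    have h2 := hc'.dist_le_mul x y
    rw [dist_eq_norm, dist_eq_norm] at h2
    simp only [ContinuousLinearEquiv.coe_coe, ContinuousLinearEquiv.refl_apply, NNReal.coe_mul,
      Real.coe_toNNReal _ hs0.le]
    rw [h1, norm_neg, norm_smul, Real.norm_of_nonneg hs0.le, mul_assoc]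
    exact mul_le_mul_of_nonneg_left h2 hs0.le
  have hsmall : Subsingleton (Pt d) ∨ s.toNNReal * c <
      ‖((ContinuousLinearEquiv.refl ℝ (Pt d)).symm : Pt d →L[ℝ] Pt d)‖₊⁻¹ := by
    rcases subsingleton_or_nontrivial (Pt d) with h | h
    · exact Or.inl h
    · right
      have h1 : ‖((ContinuousLinearEquiv.refl ℝ (Pt d)).symm : Pt d →L[ℝ] Pt d)‖₊ = 1 :=
        NNReal.coe_injective ContinuousLinearMap.norm_id
      rw [h1, inv_one, ← NNReal.coe_lt_coe, NNReal.coe_mul, Real.coe_toNNReal _ hs0.le]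
      exact hsc
  let e : Pt d ≃ₜ Pt d := happrox.toHomeomorph Ψ hsmall
  have he : ∀ y, e y = Ψ y := fun y => rfl
  have hd : ∀ y, HasFDerivAt Ψ (ContinuousLinearMap.id ℝ (Pt d) - s • fderiv ℝ W y) y := fun y =>
    (hasFDerivAt_id y).sub ((hW.differentiable (by simp) y).hasFDerivAt.const_smul s)
  have hinj : ∀ y, Function.Injective (ContinuousLinearMap.id ℝ (Pt d) - s • fderiv ℝ W y) := by
    intro y
    rw [injective_iff_map_eq_zero]
    intro v hv
    have h1 : v = s • fderiv ℝ W y v := by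
      simpa [sub_eq_zero] using hv
    have h2 : ‖v‖ ≤ s * (c * ‖v‖) := by
      conv_lhs => rw [h1, norm_smul, Real.norm_of_nonneg hs0.le]
      refine mul_le_mul_of_nonneg_left ((fderiv ℝ W y).le_of_opNorm_le ?_ v) hs0.le
      exact norm_fderiv_le_of_lipschitz ℝ hc'
    by_contra hv0
    have h3 : 0 < ‖v‖ := norm_pos_iff.2 hv0
    nlinarith
  let f' : Pt d → Pt d ≃L[ℝ] Pt d := fun y =>
    (LinearEquiv.ofInjectiveEndo
      ((ContinuousLinearMap.id ℝ (Pt d) - s • fderiv ℝ W y : Pt d →L[ℝ] Pt d) : Pt d →ₗ[ℝ] Pt d)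
      (hinj y)).toContinuousLinearEquiv
  have hf' : ∀ y, HasFDerivAt e (f' y : Pt d →L[ℝ] Pt d) y := by
    intro y
    have : (f' y : Pt d →L[ℝ] Pt d) = ContinuousLinearMap.id ℝ (Pt d) - s • fderiv ℝ W y := by
      ext1 v
      rfl
    rw [this]
    exact hd y
  refine ⟨e.symm, hΨs, e.contDiff_symm hf' hΨs, fun x => e.symm_apply_apply x,
    fun x => e.apply_symm_apply x, tsupport W, hc, hs, fun x hx => ?_⟩
  simp [hΨ, image_eq_zero_of_notMem_tsupport hx]

lemma det_smul_id_add_rankOne (a m : ℝ) (ha : a ≠ 0) (z : Pt d) (T : Pt d →L[ℝ] Pt d)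
    (hT : ∀ v, T v = a • v + (m * ⟪z, v⟫) • z) :
    T.det = a ^ d * (1 + m / a * ‖z‖ ^ 2) := by
  have h1 : (T : Pt d →ₗ[ℝ] Pt d) = a • LinearMap.transvection
      ((m / a) • (innerSL ℝ z : Pt d →ₗ[ℝ] ℝ)) z := by
    ext1 v
    simp only [ContinuousLinearMap.coe_coe, hT, LinearMap.smul_apply, LinearMap.transvection.apply,
      smul_add, smul_smul]
    congr 2
    simp
    field_simp
  rw [ContinuousLinearMap.det, h1, LinearMap.det_smul, LinearMap.transvection.det]
  simp

lemma mul_norm_le_of_rankOne (a m : ℝ) (hm : 0 ≤ m) (z v : Pt d) :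
    a * ‖v‖ ≤ ‖a • v + (m * ⟪z, v⟫) • z‖ := by
  rcases eq_or_ne v 0 with rfl | hv
  · simp
  have h1 : 0 < ‖v‖ := norm_pos_iff.2 hv
  have h2 : ⟪a • v + (m * ⟪z, v⟫) • z, v⟫ = a * ‖v‖ ^ 2 + m * ⟪z, v⟫ ^ 2 := by
    rw [inner_add_left, inner_smul_left, inner_smul_left, real_inner_self_eq_norm_sq]
    simp
    ring
  have h3 := real_inner_le_norm (a • v + (m * ⟪z, v⟫) • z) v
  rw [h2] at h3
  have h4 : 0 ≤ m * ⟪z, v⟫ ^ 2 := by positivity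
  refine le_of_mul_le_mul_right ?_ h1
  nlinarith

/-- The radial vector field `χ(|y - x₀|²) (y - x₀)`. -/
noncomputable def radialField (χ : ℝ → ℝ) (x₀ y : Pt d) : Pt d := χ (‖y - x₀‖ ^ 2) • (y - x₀)

section radial

variable {χ : ℝ → ℝ} {x₀ : Pt d} {r : ℝ}

lemma contDiff_radialField (hχ : ContDiff ℝ ∞ χ) : ContDiff ℝ ∞ (radialField χ x₀) :=
  (hχ.comp ((contDiff_id.sub contDiff_const).norm_sq ℝ)).smul (contDiff_id.sub contDiff_const)

lemma tsupport_radialField_subset (hr : 0 ≤ r) (h0 : ∀ t, r ^ 2 ≤ t → χ t = 0) :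
    tsupport (radialField χ x₀) ⊆ Metric.closedBall x₀ r := by
  refine closure_minimal (fun y hy => ?_) Metric.isClosed_closedBall
  by_contra hcon
  rw [Metric.mem_closedBall, not_le, dist_eq_norm] at hcon
  exact hy (by simp [radialField, h0 _ (pow_le_pow_left₀ hr hcon.le 2)])

lemma hasCompactSupport_radialField (hr : 0 ≤ r) (h0 : ∀ t, r ^ 2 ≤ t → χ t = 0) :
    HasCompactSupport (radialField χ x₀) :=
  (isCompact_closedBall x₀ r).of_isClosed_subset (isClosed_tsupport _)
    (tsupport_radialField_subset hr h0)

lemma hasFDerivAt_radial (hχ : ContDiff ℝ ∞ χ) (s : ℝ) (y : Pt d) :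
    HasFDerivAt (fun y => y - s • radialField χ x₀ y)
      ((1 - s * χ (‖y - x₀‖ ^ 2)) • ContinuousLinearMap.id ℝ (Pt d) +
        ((-(2 * s * deriv χ (‖y - x₀‖ ^ 2))) • innerSL ℝ (y - x₀)).smulRight (y - x₀)) y := by
  have h1 : HasFDerivAt (fun y : Pt d => y - x₀) (ContinuousLinearMap.id ℝ (Pt d)) y :=
    (hasFDerivAt_id y).sub_const x₀
  have h2 := h1.norm_sq
  have h3 := (hχ.differentiable (by simp) (‖y - x₀‖ ^ 2)).hasDerivAt.comp_hasFDerivAt y h2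
  have h4 := (hasFDerivAt_id y).sub ((h3.smul h1).const_smul s)
  refine h4.congr_fderiv ?_
  ext1 v
  simp only [Function.comp, sub_apply, add_apply, smul_apply, ContinuousLinearMap.smulRight_apply,
    ContinuousLinearMap.id_apply, ContinuousLinearMap.comp_apply, innerSL_apply_apply, smul_eq_mul,
    nsmul_eq_mul]
  module

lemma fderiv_radial_apply (hχ : ContDiff ℝ ∞ χ) (s : ℝ) (y v : Pt d) :
    fderiv ℝ (fun y => y - s • radialField χ x₀ y) y v =
      (1 - s * χ (‖y - x₀‖ ^ 2)) • v +
        (-(2 * s * deriv χ (‖y - x₀‖ ^ 2)) * ⟪y - x₀, v⟫) • (y - x₀) := by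
  rw [(hasFDerivAt_radial hχ s y).fderiv]
  simp [inner_sub_left]

end radial

/-! ### Composition of admissible maps with diffeomorphisms -/

/-- The action of a linear map `T` on gradients: `(∂ₖ(Q ∘ T)) = ∑ₗ Tₗₖ ∂ₗQ`. -/
noncomputable def pullGrad (T : Pt d →L[ℝ] Pt d) (G : Fin d → Mat) (k : Fin d) : Mat :=
  ∑ l, T (stdVec k) l • G l

lemma pullGrad_apply (T : Pt d →L[ℝ] Pt d) (G : Fin d → Mat) (k : Fin d) (i j : Fin 3) :
    pullGrad T G k i j = ∑ l, T (stdVec k) l * G l i j := by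
  simp [pullGrad, Matrix.sum_apply]

lemma pullGrad_id (G : Fin d → Mat) : pullGrad (ContinuousLinearMap.id ℝ (Pt d)) G = G := by
  ext k i j
  simp [pullGrad_apply, stdVec]

lemma gradNorm_sq (G : Fin d → Mat) :
    gradNorm G ^ 2 = ∑ i, ∑ j, ‖(WithLp.toLp 2 fun k => G k i j : Pt d)‖ ^ 2 := by
  rw [gradNorm, Real.sq_sqrt (by positivity), Finset.sum_comm]
  refine Finset.sum_congr rfl fun i _ => ?_
  rw [Finset.sum_comm]
  simp [EuclideanSpace.norm_sq_eq]

lemma gradNorm_pullGrad_le (T : Pt d →L[ℝ] Pt d) (G : Fin d → Mat) :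
    gradNorm (pullGrad T G) ≤ ‖T‖ * gradNorm G := by
  refine le_of_sq_le_sq ?_ (mul_nonneg (norm_nonneg _) (gradNorm_nonneg _))
  rw [mul_pow, gradNorm_sq, gradNorm_sq, Finset.mul_sum]
  refine Finset.sum_le_sum fun i _ => ?_
  rw [Finset.mul_sum]
  refine Finset.sum_le_sum fun j _ => ?_
  rw [← mul_pow]
  refine pow_le_pow_left₀ (norm_nonneg _) ?_ 2
  have h1 : (WithLp.toLp 2 fun k => pullGrad T G k i j : Pt d) =
      T.adjoint (WithLp.toLp 2 fun k => G k i j) := by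
    ext k
    have h2 : (T.adjoint (WithLp.toLp 2 fun k => G k i j)) k =
        ⟪stdVec k, T.adjoint (WithLp.toLp 2 fun k => G k i j)⟫ := by
      simp [stdVec, EuclideanSpace.inner_single_left]
    rw [h2, ContinuousLinearMap.adjoint_inner_right]
    simp [pullGrad_apply, PiLp.inner_apply, mul_comm]
  rw [h1, ← LinearIsometryEquiv.norm_map ContinuousLinearMap.adjoint T]
  exact ContinuousLinearMap.le_opNorm _ _

lemma frob_neg (P : Mat) : frob (-P) = frob P := by simp [frob]

lemma gradNorm_neg (G : Fin d → Mat) : gradNorm (-G) = gradNorm G := by simp [gradNorm]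

namespace IsCompactDiffeo

variable {Ψ Φ : Pt d → Pt d}

lemma isWeakGrad_comp (h : IsCompactDiffeo Ω Ψ Φ) (hΩ : IsOpen Ω) {Q : Pt d → Mat}
    {G : Pt d → Fin d → Mat} (hQ : IsWeakGrad Ω Q G) :
    IsWeakGrad Ω (fun x => Q (Φ x)) (fun x => pullGrad (fderiv ℝ Φ x) (G (Φ x))) := by
  intro i j
  have := h.hasWeakGrad_comp hΩ (hQ i j)
  simp only [← pullGrad_apply] at this
  exact this

lemma integrableOn_comp_symm (h : IsCompactDiffeo Ω Ψ Φ) (hΩ : IsOpen Ω) {f : Pt d → ℝ}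
    (hf : IntegrableOn f Ω volume) : IntegrableOn (fun x => f (Φ x)) Ω volume :=
  h.symm.integrableOn_comp hΩ.measurableSet (by rwa [h.symm.image_eq])

lemma integrableOn_absJac_mul (h : IsCompactDiffeo Ω Ψ Φ) (hΩ : IsOpen Ω) {f : Pt d → ℝ}
    (hf : IntegrableOn f Ω volume) :
    IntegrableOn (fun y => absJac Ψ y * f (Ψ y)) Ω volume := by
  rw [← h.image_eq] at hf
  exact (integrableOn_image_iff_integrableOn_abs_det_fderiv_smul volume hΩ.measurableSet
    (fun x _ => (h.differentiable x).hasFDerivAt.hasFDerivWithinAt) h.injective.injOn f).1 hf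

lemma integrableOn_pullGrad (h : IsCompactDiffeo Ω Ψ Φ) (hΩ : IsOpen Ω) {φ : ℝ → ℝ} {p : ℝ}
    (hφ : IsElasticDensity φ p) {Q : Pt d → Mat} {G : Pt d → Fin d → Mat}
    (hQ : IsWeakGrad Ω Q G) (hG : IntegrableOn (fun x => φ (gradNorm (G x))) Ω volume) :
    IntegrableOn (fun x => φ (gradNorm (pullGrad (fderiv ℝ Φ x) (G (Φ x))))) Ω volume := by
  obtain ⟨M, hM⟩ := h.symm.exists_norm_fderiv_le
  refine hφ.integrable_comp_of_le_sum (ι := Unit) (f := fun _ x => gradNorm (G (Φ x)))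
    (aestronglyMeasurable_gradNorm fun k i j =>
      (h.isWeakGrad_comp hΩ hQ).aestronglyMeasurable_grad k i j) (fun x => gradNorm_nonneg _)
    (fun _ x => gradNorm_nonneg _) M (fun x => ?_)
    (fun _ => h.integrableOn_comp_symm hΩ hG)
  simp only [Finset.univ_unique, Finset.sum_const, Finset.card_singleton, one_smul]
  exact (gradNorm_pullGrad_le _ _).trans
    (mul_le_mul_of_nonneg_right (hM x) (gradNorm_nonneg _))

end IsCompactDiffeo

/-- Diffeomorphisms with compact support preserve the admissible class. -/
lemma IsAdmissible.comp {φ : ℝ → ℝ} {p A B C : ℝ} {Qb Q : Pt d → Mat} {Ψ Φ : Pt d → Pt d}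
    (hQ : IsAdmissible Ω φ A B C Qb Q) (hφ : IsElasticDensity φ p) (hΩ : IsOpen Ω)
    (h : IsCompactDiffeo Ω Ψ Φ) : IsAdmissible Ω φ A B C Qb (fun x => Q (Φ x)) := by
  have hG := weakGrad_spec hQ.mem.exists_weakGrad
  set G := weakGrad Ω Q with hGdef
  have hP := h.isWeakGrad_comp hΩ hG
  have hPφ : IntegrableOn (fun x => φ (frob (Q (Φ x)))) Ω volume :=
    h.integrableOn_comp_symm hΩ hQ.mem.integrable_self
  have hPg := h.integrableOn_pullGrad hΩ hφ hG hQ.mem.integrable_grad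
  obtain ⟨C₁, hC₁, hfrob⟩ := hφ.exists_map_frob_add_le
  obtain ⟨C₂, hC₂, hgrad⟩ := hφ.exists_map_gradNorm_add_le d
  refine ⟨⟨⟨_, hP⟩, hPφ, ?_⟩, h.symm.quasiMeasurePreserving.ae hQ.values,
    h.integrableOn_comp_symm hΩ hQ.integrable_bulk, ?_⟩
  · refine hPg.congr ?_
    filter_upwards [weakGrad_ae_eq hΩ hP] with x hx
    rw [hx]
  · obtain ⟨K, hK, hKΩ, hid⟩ := h.symm.eq_id
    have hU : IsWeakGrad Ω (fun x => Q (Φ x) - Q x)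
        (fun x => pullGrad (fderiv ℝ Φ x) (G (Φ x)) - G x) :=
      fun i j => HasWeakGrad.sub (hP i j) (hG i j)
    have hU0 : ∀ x, x ∉ K → Q (Φ x) - Q x = 0 := fun x hx => by rw [hid x hx, sub_self]
    have hH0 : ∀ x, x ∉ K → pullGrad (fderiv ℝ Φ x) (G (Φ x)) - G x = 0 := by
      intro x hx
      have h1 : Φ =ᶠ[𝓝 x] id := by
        filter_upwards [hK.isClosed.isOpen_compl.mem_nhds hx] with y hy using hid y hy
      rw [h1.fderiv_eq, fderiv_id, pullGrad_id, hid x hx, sub_self]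
    have h2 := hQ.boundary.add_of_eq_zero_off_compact hφ hΩ hU hK hKΩ hU0 hH0 ?_ ?_
    · simpa only [sub_add_sub_cancel] using h2
    · refine ((hPφ.add hQ.mem.integrable_self).const_mul C₁).mono'
        (hφ.aestronglyMeasurable_comp (aestronglyMeasurable_frob fun i j =>
          hU.aestronglyMeasurable i j) fun x => frob_nonneg _) (Eventually.of_forall fun x => ?_)
      rw [Real.norm_of_nonneg (hφ.nonneg (frob_nonneg _)), sub_eq_add_neg]
      have h3 := hfrob (Q (Φ x)) (-Q x)
      rwa [frob_neg] at h3
    · refine ((hPg.add hQ.mem.integrable_grad).const_mul C₂).mono'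
        (hφ.aestronglyMeasurable_comp (aestronglyMeasurable_gradNorm fun k i j =>
          hU.aestronglyMeasurable_grad k i j) fun x => gradNorm_nonneg _)
        (Eventually.of_forall fun x => ?_)
      rw [Real.norm_of_nonneg (hφ.nonneg (gradNorm_nonneg _)), sub_eq_add_neg]
      have h3 := hgrad (pullGrad (fderiv ℝ Φ x) (G (Φ x))) (-G x)
      rwa [gradNorm_neg] at h3

lemma IsCompactDiffeo.norm_fderiv_symm_le {Ψ Φ : Pt d → Pt d} (h : IsCompactDiffeo Ω Ψ Φ)
    {y : Pt d} {a : ℝ} (ha : 0 < a) (hle : ∀ v, a * ‖v‖ ≤ ‖fderiv ℝ Ψ y v‖) :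
    ‖fderiv ℝ Φ (Ψ y)‖ ≤ 1 / a := by
  refine ContinuousLinearMap.opNorm_le_bound _ (by positivity) fun w => ?_
  have h1 := hle (fderiv ℝ Φ (Ψ y) w)
  have h2 := congrArg (fun T : Pt d →L[ℝ] Pt d => T w) (h.fderiv_comp_fderiv' y)
  simp only [ContinuousLinearMap.comp_apply, ContinuousLinearMap.id_apply] at h2
  rw [h2] at h1
  rw [div_mul_eq_mul_div, one_mul, le_div_iff₀ ha]
  linarith

/-- The energy of `Q ∘ Ψ⁻¹`, written as an integral in the variable `y = Ψ⁻¹ x`, for a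
diffeomorphism `Ψ` with `|DΨ v| ≥ a |v|`. -/
lemma IsEnergyMinimizer.Imod_le {φ : ℝ → ℝ} {p A B C L : ℝ} {Qb Q : Pt d → Mat}
    {Ψ Φ : Pt d → Pt d} (hQ : IsEnergyMinimizer Ω φ A B C L Qb Q) (hφ : IsElasticDensity φ p)
    (hΩ : IsOpen Ω) (h : IsCompactDiffeo Ω Ψ Φ) {a : Pt d → ℝ} (ha : ∀ y, 0 < a y)
    (hle : ∀ y v, a y * ‖v‖ ≤ ‖fderiv ℝ Ψ y v‖)
    (hi : IntegrableOn (fun y => absJac Ψ y * (φ (gradNorm (weakGrad Ω Q y) / a y) +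
      1 / L * bulk A B C (Q y))) Ω volume) :
    Imod Ω φ A B C L Q ≤ ∫ y in Ω, absJac Ψ y * (φ (gradNorm (weakGrad Ω Q y) / a y) +
      1 / L * bulk A B C (Q y)) := by
  have hG := weakGrad_spec hQ.1.mem.exists_weakGrad
  have hP := h.isWeakGrad_comp hΩ hG
  set G := weakGrad Ω Q with hGdef
  set e : Pt d → ℝ := fun x => φ (gradNorm (pullGrad (fderiv ℝ Φ x) (G (Φ x)))) +
    1 / L * bulk A B C (Q (Φ x)) with he
  have hei : IntegrableOn e Ω volume :=
    (h.integrableOn_pullGrad hΩ hφ hG hQ.1.mem.integrable_grad).add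
      ((h.integrableOn_comp_symm hΩ hQ.1.integrable_bulk).const_mul _)
  have h1 : Imod Ω φ A B C L (fun x => Q (Φ x)) = ∫ x in Ω, e x := by
    refine integral_congr_ae ?_
    filter_upwards [weakGrad_ae_eq hΩ hP] with x hx
    simp only [energyDensity, he, hx]
  refine (hQ.2 _ (hQ.1.comp hφ hΩ h)).trans ?_
  rw [h1, h.setIntegral_eq hΩ.measurableSet]
  refine integral_mono (h.integrableOn_absJac_mul hΩ hei) hi fun y => ?_
  refine mul_le_mul_of_nonneg_left ?_ (absJac_nonneg _ _)
  simp only [he, h.left_inv]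
  gcongr
  refine hφ.mono (gradNorm_nonneg _) ((gradNorm_pullGrad_le _ _).trans ?_)
  rw [div_eq_mul_one_div, mul_comm]
  exact mul_le_mul_of_nonneg_left (h.norm_fderiv_symm_le (ha y) (hle y)) (gradNorm_nonneg _)

/-! ### The bulk potential is bounded below -/

lemma bddBelow_bulk₀ {A B C : ℝ} (hC : 0 < C) : BddBelow (bulk₀ A B C '' S0) := by
  refine ⟨-(2 * (|A| / 2 + 162 * B ^ 2 / C) ^ 2 / C), ?_⟩
  rintro _ ⟨P, ⟨hsymm, -⟩, rfl⟩
  have hs : ∀ i j, P j i = P i j := fun i j => congrFun (congrFun hsymm i) j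
  set q : ℝ := (P * P).trace with hq
  have hqsum : q = ∑ i, ∑ j, P i j ^ 2 := by
    rw [hq, Matrix.trace]
    refine Finset.sum_congr rfl fun i _ => ?_
    rw [Matrix.diag_apply, Matrix.mul_apply]
    exact Finset.sum_congr rfl fun j _ => by rw [hs i j, sq]
  have hq0 : 0 ≤ q := by rw [hqsum]; positivity
  have hle : ∀ i j, |P i j| ≤ √q := by
    intro i j
    refine Real.abs_le_sqrt ?_
    rw [hqsum]
    exact (Finset.single_le_sum (f := fun j => P i j ^ 2) (fun _ _ => sq_nonneg _)
      (Finset.mem_univ j)).trans (Finset.single_le_sum (f := fun i => ∑ j, P i j ^ 2)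
        (fun _ _ => Finset.sum_nonneg fun _ _ => sq_nonneg _) (Finset.mem_univ i))
  have h3 : |(P * P * P).trace| ≤ 27 * (q * √q) := by
    have hterm : ∀ i k j, |P i j * P j k * P k i| ≤ q * √q := by
      intro i k j
      rw [abs_mul, abs_mul]
      calc |P i j| * |P j k| * |P k i| ≤ √q * √q * √q := by
            gcongr
            exacts [hle i j, hle j k, hle k i]
        _ = q * √q := by rw [Real.mul_self_sqrt hq0]
    have htr : (P * P * P).trace = ∑ i, ∑ k, ∑ j, P i j * P j k * P k i := by
      simp [Matrix.trace, Matrix.mul_apply, Finset.sum_mul]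
    rw [htr]
    calc |∑ i, ∑ k, ∑ j, P i j * P j k * P k i| ≤ ∑ i, ∑ k, ∑ j, |P i j * P j k * P k i| := by
          refine (Finset.abs_sum_le_sum_abs _ _).trans (Finset.sum_le_sum fun i _ => ?_)
          refine (Finset.abs_sum_le_sum_abs _ _).trans (Finset.sum_le_sum fun k _ => ?_)
          exact Finset.abs_sum_le_sum_abs _ _
      _ ≤ ∑ _i : Fin 3, ∑ _k : Fin 3, ∑ _j : Fin 3, q * √q :=
          Finset.sum_le_sum fun i _ => Finset.sum_le_sum fun k _ =>
            Finset.sum_le_sum fun j _ => hterm i k j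
      _ = 27 * (q * √q) := by simp; ring
  -- Young's inequality absorbs the cubic term: `9 |B| q √q ≤ C q² / 8 + (162 B² / C) q`.
  have h4 : B / 3 * (P * P * P).trace ≤ C / 4 * q ^ 2 / 2 + 162 * B ^ 2 / C * q := by
    have h5 : B / 3 * (P * P * P).trace ≤ 9 * |B| * (q * √q) := by
      calc B / 3 * (P * P * P).trace ≤ |B / 3 * (P * P * P).trace| := le_abs_self _
        _ = |B| / 3 * |(P * P * P).trace| := by
            rw [abs_mul, abs_div, abs_of_pos (zero_lt_three (α := ℝ))]
        _ ≤ |B| / 3 * (27 * (q * √q)) := by gcongr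
        _ = _ := by ring
    refine h5.trans ?_
    have h6 : 0 ≤ q * (C * √q - 36 * |B|) ^ 2 := by positivity
    have h7 : √q ^ 2 = q := Real.sq_sqrt hq0
    have h8 : |B| ^ 2 = B ^ 2 := sq_abs B
    have h9 : q * (C * √q - 36 * |B|) ^ 2 =
        C ^ 2 * q ^ 2 - 72 * C * |B| * (q * √q) + 1296 * B ^ 2 * q := by
      calc _ = C ^ 2 * q * √q ^ 2 - 72 * C * |B| * (q * √q) + 1296 * |B| ^ 2 * q := by ring
        _ = _ := by rw [h7, h8]; ring
    rw [h9] at h6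
    have h10 : C / 4 * q ^ 2 / 2 + 162 * B ^ 2 / C * q - 9 * |B| * (q * √q) =
        (C ^ 2 * q ^ 2 - 72 * C * |B| * (q * √q) + 1296 * B ^ 2 * q) / (8 * C) := by
      field_simp
      ring
    have h11 : 0 ≤ (C ^ 2 * q ^ 2 - 72 * C * |B| * (q * √q) + 1296 * B ^ 2 * q) / (8 * C) := by
      positivity
    linarith
  set E : ℝ := |A| / 2 + 162 * B ^ 2 / C with hE
  have h12 : A / 2 * q ≤ |A| / 2 * q := by gcongr; exact le_abs_self A
  have h13 : C / 4 * q ^ 2 / 2 - E * q + 2 * E ^ 2 / C = (C * q - 4 * E) ^ 2 / (8 * C) := by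
    field_simp
    ring
  have h14 : 0 ≤ (C * q - 4 * E) ^ 2 / (8 * C) := by positivity
  have h15 : E * q = |A| / 2 * q + 162 * B ^ 2 / C * q := by rw [hE]; ring
  have h16 : bulk₀ A B C P = -(A / 2) * q - B / 3 * (P * P * P).trace + C / 4 * q ^ 2 := rfl
  rw [h16]
  linarith

lemma bulk_nonneg {A B C : ℝ} (hC : 0 < C) {P : Mat} (hP : P ∈ S0) : 0 ≤ bulk A B C P :=
  sub_nonneg.2 (csInf_le (bddBelow_bulk₀ hC) ⟨P, hP, rfl⟩)

/-! ### The inner variation -/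

/-- The Jacobian determinant of the radial contraction `y ↦ (1 - s χ(|y|²)) y` in dimension `n + 1`,
as a function of `c = χ(|y|²)` and `k = χ'(|y|²) |y|²`. -/
def radialJac (n : ℕ) (s c k : ℝ) : ℝ := (1 - s * c) ^ n * (1 - s * c - 2 * s * k)

/-- The derivative of `radialJac` in `s`. -/
def radialJacDeriv (n : ℕ) (s c k : ℝ) : ℝ :=
  n * (1 - s * c) ^ (n - 1) * (-c) * (1 - s * c - 2 * s * k) + (1 - s * c) ^ n * (-c - 2 * k)

lemma hasDerivAt_one_sub_mul (s c : ℝ) : HasDerivAt (fun s : ℝ => 1 - s * c) (-c) s := by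
  simpa using ((hasDerivAt_id s).mul_const c).const_sub 1

lemma hasDerivAt_radialJac (n : ℕ) (s c k : ℝ) :
    HasDerivAt (fun s => radialJac n s c k) (radialJacDeriv n s c k) s := by
  have h1 := (hasDerivAt_one_sub_mul s c).pow n
  have h2 : HasDerivAt (fun s : ℝ => 1 - s * c - 2 * s * k) (-c - 2 * k) s := by
    have h3 : HasDerivAt (fun s : ℝ => 2 * s * k) (2 * k) s := by
      simpa using ((hasDerivAt_id s).const_mul 2).mul_const k
    exact (hasDerivAt_one_sub_mul s c).sub h3
  exact h1.mul h2

lemma exists_radialJac_bound (n : ℕ) (X Y : ℝ) : ∃ C, 0 ≤ C ∧ ∀ s c k, |s| ≤ 1 → |c| ≤ X → |k| ≤ Y →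
    |radialJac n s c k| ≤ C ∧ |radialJacDeriv n s c k| ≤ C := by
  have hcomp : IsCompact (Icc (-1 : ℝ) 1 ×ˢ Icc (-X) X ×ˢ Icc (-Y) Y) :=
    isCompact_Icc.prod (isCompact_Icc.prod isCompact_Icc)
  obtain ⟨C₁, h1⟩ := hcomp.exists_bound_of_continuousOn
    (f := fun q : ℝ × ℝ × ℝ => radialJac n q.1 q.2.1 q.2.2)
    (by unfold radialJac; fun_prop)
  obtain ⟨C₂, h2⟩ := hcomp.exists_bound_of_continuousOn
    (f := fun q : ℝ × ℝ × ℝ => radialJacDeriv n q.1 q.2.1 q.2.2)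
    (by unfold radialJacDeriv; fun_prop)
  refine ⟨max (max C₁ C₂) 0, le_max_right _ _, fun s c k hs hc hk => ?_⟩
  have hm : (s, c, k) ∈ Icc (-1 : ℝ) 1 ×ˢ Icc (-X) X ×ˢ Icc (-Y) Y :=
    ⟨abs_le.1 hs, abs_le.1 hc, abs_le.1 hk⟩
  exact ⟨(h1 _ hm).trans ((le_max_left _ _).trans (le_max_left _ _)),
    (h2 _ hm).trans ((le_max_right _ _).trans (le_max_left _ _))⟩

section derivative

variable {φ : ℝ → ℝ} {p : ℝ} {α : Type*} [MeasurableSpace α] {μ : Measure α} {g f c k : α → ℝ}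
  {X Y : ℝ}

lemma IsElasticDensity.map_div_le (hφ : IsElasticDensity φ p) {g a : ℝ} (hg : 0 ≤ g)
    (ha : 1 / 2 ≤ a) : φ (g / a) ≤ φ (2 * g) := by
  have ha0 : 0 < a := by linarith
  refine hφ.mono (div_nonneg hg ha0.le) ?_
  rw [div_le_iff₀ ha0]
  nlinarith

/-- Differentiation under the integral sign of the energy of the contracted map. -/
lemma IsElasticDensity.hasDerivAt_integral (hφ : IsElasticDensity φ p) (n : ℕ)
    (hg : AEStronglyMeasurable g μ) (hg0 : ∀ y, 0 ≤ g y) (hgi : Integrable (fun y => φ (g y)) μ)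
    (hf : Integrable f μ) (hc : AEStronglyMeasurable c μ) (hk : AEStronglyMeasurable k μ)
    (hX : ∀ y, |c y| ≤ X) (hY : ∀ y, |k y| ≤ Y) :
    ∃ ε, 0 < ε ∧ (∀ s, |s| < ε → ∀ y, 1 / 2 ≤ 1 - s * c y) ∧
      (∀ s, |s| < ε → Integrable (fun y =>
        radialJac n s (c y) (k y) * (φ (g y / (1 - s * c y)) + f y)) μ) ∧
      HasDerivAt (fun s => ∫ y, radialJac n s (c y) (k y) * (φ (g y / (1 - s * c y)) + f y) ∂μ)
        (∫ y, (-((n + 1) * c y + 2 * k y) * (φ (g y) + f y) + dphi φ (g y) * g y * c y) ∂μ) 0 := by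
  obtain ⟨C, hC, hJ⟩ := exists_radialJac_bound n X Y
  obtain ⟨K, hK⟩ := hφ.exists_mul_dphi_le
  obtain ⟨N, hN⟩ := hφ.exists_map_mul_le
  have hX1 : 0 < max X 1 := lt_max_of_lt_right one_pos
  set ε : ℝ := 1 / (2 * max X 1) with hε
  have hε0 : 0 < ε := by positivity
  have hε1 : ε ≤ 1 := by
    rw [hε, div_le_one (by positivity)]
    linarith [le_max_right X 1]
  have ha : ∀ s, |s| < ε → ∀ y, 1 / 2 ≤ 1 - s * c y := by
    intro s hs y
    have h1 : |s * c y| ≤ ε * max X 1 := by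
      rw [abs_mul]
      exact mul_le_mul hs.le ((hX y).trans (le_max_left _ _)) (abs_nonneg _) hε0.le
    have h2 : ε * max X 1 = 1 / 2 := by
      rw [hε]
      field_simp
    linarith [le_abs_self (s * c y)]
  have hD : ∀ y, φ (2 * g y) ≤ 2 ^ N * φ (g y) := fun y => hN _ _ one_le_two (hg0 y)
  have hpow0 : (0 : ℝ) ≤ 2 ^ N := by positivity
  have hmeasJ : ∀ s, AEStronglyMeasurable (fun y => radialJac n s (c y) (k y)) μ := by
    intro s
    have h1 : Continuous (fun q : ℝ × ℝ => radialJac n s q.1 q.2) := by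
      unfold radialJac
      fun_prop
    exact h1.comp_aestronglyMeasurable (hc.prodMk hk)
  have hmeas : ∀ s, |s| < ε → AEStronglyMeasurable (fun y =>
      radialJac n s (c y) (k y) * (φ (g y / (1 - s * c y)) + f y)) μ := by
    intro s hs
    have h1 : AEStronglyMeasurable (fun y => g y / (1 - s * c y)) μ :=
      (hg.aemeasurable.div (((hc.aemeasurable.const_mul s).const_sub 1))).aestronglyMeasurable
    exact (hmeasJ s).mul ((hφ.aestronglyMeasurable_comp h1 fun y =>
      div_nonneg (hg0 y) (by linarith [ha s hs y])).add hf.aestronglyMeasurable)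
  have hE : ∀ s, |s| < ε → ∀ y, |φ (g y / (1 - s * c y)) + f y| ≤ 2 ^ N * φ (g y) + |f y| := by
    intro s hs y
    refine (abs_add_le _ _).trans (add_le_add_left ?_ _)
    rw [abs_of_nonneg (hφ.nonneg (div_nonneg (hg0 y) (by linarith [ha s hs y])))]
    exact (hφ.map_div_le (hg0 y) (ha s hs y)).trans (hD y)
  have hbi : Integrable (fun y => 2 ^ N * φ (g y) + |f y|) μ := (hgi.const_mul _).add hf.abs
  have hint : ∀ s, |s| < ε → Integrable (fun y =>
      radialJac n s (c y) (k y) * (φ (g y / (1 - s * c y)) + f y)) μ := by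
    intro s hs
    refine (hbi.const_mul C).mono' (hmeas s hs) (Eventually.of_forall fun y => ?_)
    rw [Real.norm_eq_abs, abs_mul]
    exact mul_le_mul (hJ s _ _ (hs.le.trans hε1) (hX y) (hY y)).1 (hE s hs y) (abs_nonneg _) hC
  refine ⟨ε, hε0, ha, hint, ?_⟩
  set F' : ℝ → α → ℝ := fun s y =>
    radialJacDeriv n s (c y) (k y) * (φ (g y / (1 - s * c y)) + f y) +
      radialJac n s (c y) (k y) * (dphi φ (g y / (1 - s * c y)) *
        (g y * c y / (1 - s * c y) ^ 2)) with hF'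
  have hF'0 : ∀ y, F' 0 y =
      -((n + 1) * c y + 2 * k y) * (φ (g y) + f y) + dphi φ (g y) * g y * c y := by
    intro y
    simp [hF', radialJacDeriv, radialJac]
    ring
  have hmeas' : AEStronglyMeasurable (F' 0) μ := by
    simp only [funext hF'0]
    exact ((((hc.const_mul _).add (hk.const_mul 2)).neg).mul
      (hgi.aestronglyMeasurable.add hf.aestronglyMeasurable)).add
      (((hφ.aestronglyMeasurable_dphi_comp hg hg0).mul hg).mul hc)
  have hmain := hasDerivAt_integral_of_dominated_loc_of_deriv_le (μ := μ) (𝕜 := ℝ)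
    (F := fun s y => radialJac n s (c y) (k y) * (φ (g y / (1 - s * c y)) + f y)) (F' := F')
    (x₀ := 0) (s := Metric.ball 0 ε)
    (bound := fun y => C * (2 ^ N * φ (g y) + |f y|) + C * (2 * X * (K * (2 ^ N * φ (g y)))))
    (Metric.ball_mem_nhds 0 hε0) ?_ (hint 0 (by simpa using hε0)) hmeas' ?_ ?_ ?_
  · have h2 := hmain.2
    simp only [hF'0] at h2
    exact h2
  · filter_upwards [Metric.ball_mem_nhds (0 : ℝ) hε0] with s hs
    exact hmeas s (by simpa using hs)
  · refine Eventually.of_forall fun y s hs => ?_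
    have hs : |s| < ε := by simpa using hs
    have ha' := ha s hs y
    have ha0 : 0 < 1 - s * c y := by linarith
    obtain ⟨hJ1, hJ2⟩ := hJ s _ _ (hs.le.trans hε1) (hX y) (hY y)
    refine (norm_add_le _ _).trans (add_le_add ?_ ?_)
    · rw [Real.norm_eq_abs, abs_mul]
      exact mul_le_mul hJ2 (hE s hs y) (abs_nonneg _) hC
    · rw [Real.norm_eq_abs, abs_mul]
      refine mul_le_mul hJ1 ?_ (abs_nonneg _) hC
      have hga : 0 ≤ g y / (1 - s * c y) := div_nonneg (hg0 y) ha0.le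
      have e1 : dphi φ (g y / (1 - s * c y)) * (g y * c y / (1 - s * c y) ^ 2) =
          c y / (1 - s * c y) * (g y / (1 - s * c y) * dphi φ (g y / (1 - s * c y))) := by
        field_simp
      rw [e1, abs_mul, abs_of_nonneg (mul_nonneg hga (hφ.dphi_nonneg hga))]
      refine mul_le_mul ?_ ?_ (mul_nonneg hga (hφ.dphi_nonneg hga))
        (mul_nonneg zero_le_two ((abs_nonneg _).trans (hX y)))
      · rw [abs_div, abs_of_pos ha0, div_le_iff₀ ha0]
        have := (abs_nonneg _).trans (hX y)
        nlinarith [hX y]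
      · refine (hK _ hga).trans ?_
        gcongr
        exact (hφ.map_div_le (hg0 y) ha').trans (hD y)
  · exact (hbi.const_mul C).add ((((hgi.const_mul _).const_mul _).const_mul _).const_mul _)
  · refine Eventually.of_forall fun y s hs => ?_
    have hs : |s| < ε := by simpa using hs
    have ha0 : 0 < 1 - s * c y := by linarith [ha s hs y]
    refine (hasDerivAt_radialJac n s (c y) (k y)).mul (HasDerivAt.add_const (f y) ?_)
    rcases (hg0 y).eq_or_lt with h0 | hpos
    · simp only [← h0, zero_div, zero_mul, mul_zero]
      exact hasDerivAt_const _ _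
    · have h1 : HasDerivAt (fun s => g y / (1 - s * c y)) (g y * c y / (1 - s * c y) ^ 2) s := by
        have h2 := (hasDerivAt_const s (g y)).div (hasDerivAt_one_sub_mul s (c y)) ha0.ne'
        exact h2.congr_deriv (by ring)
      exact (hφ.hasDerivAt (div_pos hpos ha0)).comp s h1

end derivative

lemma nonneg_of_hasDerivAt_of_le {F : ℝ → ℝ} {D s₀ : ℝ} (hF : HasDerivAt F D 0) (hs : 0 < s₀)
    (h : ∀ s, 0 < s → s < s₀ → F 0 ≤ F s) : 0 ≤ D := by
  have h1 := (hasDerivWithinAt_iff_tendsto_slope' (s := Ioi (0 : ℝ)) (by simp)).1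
    (hF.hasDerivWithinAt (s := Ioi 0))
  refine ge_of_tendsto h1 ?_
  filter_upwards [Ioo_mem_nhdsGT hs] with s hs'
  rw [slope_def_field, sub_zero]
  exact div_nonneg (sub_nonneg.2 (h s hs'.1 hs'.2)) hs'.1.le

/-- The inner variation inequality: the derivative at `s = 0` of the energy of the competitors
`Q ∘ Ψₛ⁻¹`, where `Ψₛ y = x₀ + (1 - s χ(|y - x₀|²)) (y - x₀)`, is nonnegative. Since `χ` is
nonincreasing, the smallest singular value of `DΨₛ` is `1 - s χ`, attained in the tangential
directions; bounding the gradient of the competitor with it drops the contribution of the radial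
derivative of `Q`, which has a favourable sign. -/
lemma IsEnergyMinimizer.inner_variation {φ : ℝ → ℝ} {p A B C L : ℝ} {Qb Q : Pt d → Mat}
    (hQ : IsEnergyMinimizer Ω φ A B C L Qb Q) (hφ : IsElasticDensity φ p) (hd : d ≠ 0)
    (hΩ : IsOpen Ω) {χ : ℝ → ℝ} (hχ : ContDiff ℝ ∞ χ)
    (hχ' : ∀ t, deriv χ t ≤ 0) {x₀ : Pt d} {r : ℝ} (hr : 0 ≤ r) (hχr : ∀ t, r ^ 2 ≤ t → χ t = 0)
    (hball : Metric.closedBall x₀ r ⊆ Ω) :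
    ∫ y in Ω, energyDensity Ω φ A B C L Q y *
        (d * χ (‖y - x₀‖ ^ 2) + 2 * (deriv χ (‖y - x₀‖ ^ 2) * ‖y - x₀‖ ^ 2)) ≤
      ∫ y in Ω, dphi φ (gradNorm (weakGrad Ω Q y)) * gradNorm (weakGrad Ω Q y) *
        χ (‖y - x₀‖ ^ 2) := by
  have hG := weakGrad_spec hQ.1.mem.exists_weakGrad
  have hgi := hQ.1.mem.integrable_grad
  set g : Pt d → ℝ := fun y => gradNorm (weakGrad Ω Q y) with hg
  have hg0 : ∀ y, 0 ≤ g y := fun y => gradNorm_nonneg _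
  have hgm : AEStronglyMeasurable g (volume.restrict Ω) :=
    aestronglyMeasurable_gradNorm fun k i j => hG.aestronglyMeasurable_grad k i j
  set f : Pt d → ℝ := fun y => 1 / L * bulk A B C (Q y) with hf
  have hfi : IntegrableOn f Ω volume := hQ.1.integrable_bulk.const_mul _
  set c : Pt d → ℝ := fun y => χ (‖y - x₀‖ ^ 2) with hc
  set k : Pt d → ℝ := fun y => deriv χ (‖y - x₀‖ ^ 2) * ‖y - x₀‖ ^ 2 with hk
  have hχd : Continuous (deriv χ) := hχ.continuous_deriv (by simp)
  have hcc : Continuous c := hχ.continuous.comp (by fun_prop)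
  have hkc : Continuous k := (hχd.comp (by fun_prop)).mul (by fun_prop)
  have hcs : HasCompactSupport c := by
    refine HasCompactSupport.intro (isCompact_closedBall x₀ r) fun y hy => ?_
    rw [Metric.mem_closedBall, not_le, dist_eq_norm] at hy
    exact hχr _ (pow_le_pow_left₀ hr hy.le 2)
  have hks : HasCompactSupport k := by
    refine HasCompactSupport.intro (isCompact_closedBall x₀ r) fun y hy => ?_
    rw [Metric.mem_closedBall, not_le, dist_eq_norm] at hy
    have h1 : χ =ᶠ[𝓝 (‖y - x₀‖ ^ 2)] fun _ => 0 := by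
      filter_upwards [Ioi_mem_nhds (pow_lt_pow_left₀ hy hr two_ne_zero)] with t ht
      exact hχr t (le_of_lt ht)
    simp only [hk]
    rw [h1.deriv_eq]
    simp
  obtain ⟨X, hX⟩ := hcs.exists_bound_of_continuous hcc
  obtain ⟨Y, hY⟩ := hks.exists_bound_of_continuous hkc
  obtain ⟨n, rfl⟩ : ∃ n, d = n + 1 := ⟨d - 1, (Nat.succ_pred_eq_of_ne_zero hd).symm⟩
  obtain ⟨ε, hε, ha, hint, hderiv⟩ := hφ.hasDerivAt_integral n hgm hg0 hgi hfi
    hcc.aestronglyMeasurable hkc.aestronglyMeasurable hX hY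
  obtain ⟨s₀, hs₀, hdiff⟩ := exists_isCompactDiffeo_sub_smul
    (contDiff_radialField (x₀ := x₀) hχ) (hasCompactSupport_radialField hr hχr)
    ((tsupport_radialField_subset hr hχr).trans hball)
  have hnonneg := nonneg_of_hasDerivAt_of_le hderiv (lt_min hε hs₀) ?_
  · have hei : IntegrableOn (fun y => energyDensity Ω φ A B C L Q y *
        (((n + 1 : ℕ) : ℝ) * c y + 2 * k y)) Ω volume := by
      refine Integrable.mul_bdd (c := (n + 1) * X + 2 * Y) (hgi.add hfi)
        (by fun_prop) (Eventually.of_forall fun y => ?_)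
      refine (norm_add_le _ _).trans ?_
      rw [norm_mul, norm_mul, Real.norm_of_nonneg (Nat.cast_nonneg _),
        Real.norm_of_nonneg zero_le_two]
      push_cast
      gcongr
      · exact hX y
      · exact hY y
    have hdi : IntegrableOn (fun y => dphi φ (g y) * g y * c y) Ω volume :=
      (hφ.integrable_dphi_mul hgm hg0 hgi).mul_bdd (c := X) hcc.aestronglyMeasurable
        (Eventually.of_forall hX)
    have e : ∫ y in Ω, (-((n + 1) * c y + 2 * k y) * (φ (g y) + f y) + dphi φ (g y) * g y * c y) =
        (∫ y in Ω, dphi φ (g y) * g y * c y) -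
          ∫ y in Ω, energyDensity Ω φ A B C L Q y * (((n + 1 : ℕ) : ℝ) * c y + 2 * k y) := by
      rw [← integral_sub hdi hei]
      refine integral_congr_ae (Eventually.of_forall fun y => ?_)
      simp only [energyDensity]
      push_cast
      ring
    rw [e] at hnonneg
    exact sub_nonneg.1 hnonneg
  · intro s hs hs'
    have hsε : |s| < ε := by
      rw [abs_of_pos hs]
      exact hs'.trans_le (min_le_left _ _)
    obtain ⟨Φ, hΦ⟩ := hdiff s hs (hs'.trans_le (min_le_right _ _))
    have hpos : ∀ y, 0 < 1 - s * c y := fun y => by linarith [ha s hsε y]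
    have hm : ∀ y, 0 ≤ -(2 * s * deriv χ (‖y - x₀‖ ^ 2)) := fun y => by
      have := hχ' (‖y - x₀‖ ^ 2)
      nlinarith
    have hjac : ∀ y, absJac (fun y => y - s • radialField χ x₀ y) y = radialJac n s (c y) (k y) := by
      intro y
      rw [absJac, det_smul_id_add_rankOne _ _ (hpos y).ne' _ _ fun v => fderiv_radial_apply hχ s y v]
      have h1 : (1 - s * c y) ^ (n + 1) * (1 + -(2 * s * deriv χ (‖y - x₀‖ ^ 2)) /
          (1 - s * c y) * ‖y - x₀‖ ^ 2) = radialJac n s (c y) (k y) := by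
        have := (hpos y).ne'
        rw [radialJac, pow_succ]
        simp only [hk]
        field_simp
        ring
      rw [h1, abs_of_nonneg]
      rw [← h1]
      exact mul_nonneg (pow_nonneg (hpos y).le _) (add_nonneg zero_le_one
        (mul_nonneg (div_nonneg (hm y) (hpos y).le) (sq_nonneg _)))
    have h2 := hQ.Imod_le hφ hΩ hΦ hpos (fun y v => by
      rw [fderiv_radial_apply hχ]
      exact mul_norm_le_of_rankOne _ _ (hm y) _ _) (by
        simp only [hjac]
        exact hint s hsε)
    simp only [hjac] at h2
    refine le_trans (le_of_eq ?_) h2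
    refine integral_congr_ae (Eventually.of_forall fun y => ?_)
    simp [radialJac, energyDensity, hf, hg]

/-! ### The radial weight and its smooth approximations -/

/-- A smooth approximation of the indicator function of `(r², R²)`. -/
noncomputable def window (r R : ℝ) (n : ℕ) (t : ℝ) : ℝ :=
  Real.smoothTransition ((n + 1) * (t - r ^ 2) - 1) *
    Real.smoothTransition ((n + 1) * (R ^ 2 - t) - 1)

/-- A smooth approximation of `t ↦ t ^ (q / 2 - 1) / 2` on `(r², R²)`, where `q = p - d`. -/
noncomputable def cutPower (q r R : ℝ) (n : ℕ) (t : ℝ) : ℝ :=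
  1 / 2 * t ^ (q / 2 - 1) * window r R n t

/-- A smooth nonincreasing approximation of the weight `weight q r R`, as a function of `|y|²`. -/
noncomputable def smoothWeight (q r R : ℝ) (n : ℕ) (t : ℝ) : ℝ :=
  ∫ τ in t..R ^ 2, cutPower q r R n τ

/-- The radial weight `a ↦ ∫_r^R ρ ^ (q - 1) 1_{a < ρ} dρ`. -/
noncomputable def weight (q r R a : ℝ) : ℝ :=
  if a < R then (max r a ^ q - R ^ q) / (-q) else 0

section weight

variable {q r R : ℝ} {n : ℕ} {t : ℝ}

lemma window_nonneg : 0 ≤ window r R n t :=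
  mul_nonneg (Real.smoothTransition.nonneg _) (Real.smoothTransition.nonneg _)

lemma window_le_one : window r R n t ≤ 1 :=
  mul_le_one₀ (Real.smoothTransition.le_one _) (Real.smoothTransition.nonneg _)
    (Real.smoothTransition.le_one _)

lemma contDiff_window : ContDiff ℝ ∞ (window r R n) := by
  unfold window
  exact (Real.smoothTransition.contDiff.comp (by fun_prop)).mul
    (Real.smoothTransition.contDiff.comp (by fun_prop))

lemma window_eq_zero_of_le (ht : t ≤ r ^ 2) : window r R n t = 0 := by
  have h : ((n : ℝ) + 1) * (t - r ^ 2) ≤ 0 :=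
    mul_nonpos_of_nonneg_of_nonpos (by positivity) (by linarith)
  rw [window, Real.smoothTransition.zero_of_nonpos (by linarith), zero_mul]

lemma window_eq_zero_of_ge (ht : R ^ 2 - 1 / (n + 1) ≤ t) : window r R n t = 0 := by
  have hn : (0 : ℝ) < n + 1 := by positivity
  have h : ((n : ℝ) + 1) * (R ^ 2 - t) ≤ 1 := by
    have := mul_le_mul_of_nonneg_left (a := (n : ℝ) + 1) (b := R ^ 2 - t) (c := 1 / (n + 1))
      (by linarith) hn.le
    rwa [mul_one_div_cancel hn.ne'] at this
  rw [window, Real.smoothTransition.zero_of_nonpos (x := _ * (R ^ 2 - t) - 1) (by linarith),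
    mul_zero]

lemma tendsto_window (h1 : r ^ 2 < t) (h2 : t < R ^ 2) :
    Tendsto (fun n => window r R n t) atTop (𝓝 1) := by
  have h : ∀ δ : ℝ, 0 < δ → ∀ᶠ n : ℕ in atTop, 1 ≤ ((n : ℝ) + 1) * δ - 1 := by
    intro δ hδ
    have := ((tendsto_natCast_atTop_atTop (R := ℝ)).atTop_add
      (tendsto_const_nhds (x := (1 : ℝ)))).atTop_mul_const hδ
    filter_upwards [this.eventually_ge_atTop 2] with n hn
    linarith
  refine tendsto_const_nhds.congr' ?_
  filter_upwards [h _ (sub_pos.2 h1), h _ (sub_pos.2 h2)] with n h3 h4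
  rw [window, Real.smoothTransition.one_of_one_le h3, Real.smoothTransition.one_of_one_le h4,
    one_mul]

lemma contDiff_cutPower (hr : 0 < r) : ContDiff ℝ ∞ (cutPower q r R n) := by
  rw [contDiff_iff_contDiffAt]
  intro t
  rcases le_or_gt t 0 with ht | ht
  · have h : cutPower q r R n =ᶠ[𝓝 t] fun _ => 0 := by
      filter_upwards [Iio_mem_nhds (ht.trans_lt (pow_pos hr 2))] with s hs
      rw [cutPower, window_eq_zero_of_le (le_of_lt hs), mul_zero]
    exact contDiffAt_const.congr_of_eventuallyEq h
  · exact (contDiffAt_const.mul (Real.contDiffAt_rpow_const_of_ne ht.ne')).mul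
      contDiff_window.contDiffAt

lemma cutPower_nonneg : 0 ≤ cutPower q r R n t := by
  rcases le_or_gt t (r ^ 2) with ht | ht
  · rw [cutPower, window_eq_zero_of_le ht, mul_zero]
  · have : 0 < t := (sq_nonneg r).trans_lt ht
    exact mul_nonneg (by positivity) window_nonneg

lemma cutPower_le (hr : 0 < r) (hq : q ≤ 0) :
    cutPower q r R n t ≤ 1 / 2 * (r ^ 2) ^ (q / 2 - 1) := by
  rcases le_or_gt t (r ^ 2) with ht | ht
  · rw [cutPower, window_eq_zero_of_le ht, mul_zero]
    positivity
  · have h0 : 0 < t := (sq_nonneg r).trans_lt ht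
    have h1 : t ^ (q / 2 - 1) ≤ (r ^ 2) ^ (q / 2 - 1) :=
      Real.rpow_le_rpow_of_nonpos (by positivity) ht.le (by linarith)
    calc cutPower q r R n t ≤ 1 / 2 * t ^ (q / 2 - 1) * 1 :=
          mul_le_mul_of_nonneg_left window_le_one (by positivity)
      _ ≤ _ := by linarith

lemma cutPower_eq_zero_of_ge (ht : R ^ 2 - 1 / (n + 1) ≤ t) : cutPower q r R n t = 0 := by
  rw [cutPower, window_eq_zero_of_ge ht, mul_zero]

open Classical in
lemma tendsto_cutPower (q : ℝ) : Tendsto (fun n => cutPower q r R n t) atTop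
    (𝓝 (if r ^ 2 < t ∧ t < R ^ 2 then 1 / 2 * t ^ (q / 2 - 1) else 0)) := by
  split_ifs with h
  · simpa [cutPower] using (tendsto_window h.1 h.2).const_mul (1 / 2 * t ^ (q / 2 - 1))
  · refine tendsto_const_nhds.congr fun n => ?_
    rcases le_or_gt t (r ^ 2) with ht | ht
    · rw [cutPower, window_eq_zero_of_le ht, mul_zero]
    · have h2 : R ^ 2 ≤ t := not_lt.1 fun h3 => h ⟨ht, h3⟩
      have h3 : (0 : ℝ) ≤ 1 / (n + 1) := by positivity
      exact (cutPower_eq_zero_of_ge (by linarith)).symm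

lemma hasDerivAt_smoothWeight (hr : 0 < r) :
    HasDerivAt (smoothWeight q r R n) (-cutPower q r R n t) t := by
  have hc : Continuous (cutPower q r R n) := (contDiff_cutPower hr).continuous
  exact intervalIntegral.integral_hasDerivAt_left (hc.intervalIntegrable _ _)
    (hc.stronglyMeasurableAtFilter _ _) hc.continuousAt

lemma contDiff_smoothWeight (hr : 0 < r) : ContDiff ℝ ∞ (smoothWeight q r R n) := by
  rw [contDiff_infty_iff_deriv]
  refine ⟨fun t => (hasDerivAt_smoothWeight hr).differentiableAt, ?_⟩
  have : deriv (smoothWeight q r R n) = fun t => -cutPower q r R n t :=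
    funext fun t => (hasDerivAt_smoothWeight hr).deriv
  rw [this]
  exact (contDiff_cutPower hr).neg

lemma smoothWeight_eq_zero (ht : R ^ 2 - 1 / (n + 1) ≤ t) : smoothWeight q r R n t = 0 := by
  refine intervalIntegral.integral_zero_ae (Eventually.of_forall fun τ hτ => ?_)
  have h3 : (0 : ℝ) ≤ 1 / (n + 1) := by positivity
  refine cutPower_eq_zero_of_ge (le_trans ?_ hτ.1.le)
  exact le_min ht (by linarith)

lemma abs_smoothWeight_le (hr : 0 < r) (hq : q ≤ 0) (ht : 0 ≤ t) :
    |smoothWeight q r R n t| ≤ 1 / 2 * (r ^ 2) ^ (q / 2 - 1) * R ^ 2 := by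
  rcases le_or_gt (R ^ 2) t with h | h
  · have h3 : (0 : ℝ) ≤ 1 / (n + 1) := by positivity
    rw [smoothWeight_eq_zero (by linarith), abs_zero]
    positivity
  · have h1 := intervalIntegral.norm_integral_le_of_norm_le_const (a := t) (b := R ^ 2)
      (f := cutPower q r R n) (C := 1 / 2 * (r ^ 2) ^ (q / 2 - 1)) fun τ _ => by
        rw [Real.norm_of_nonneg cutPower_nonneg]
        exact cutPower_le hr hq
    refine h1.trans ?_
    rw [abs_of_pos (by linarith)]
    gcongr
    linarith

lemma sq_rpow_half {a : ℝ} (ha : 0 ≤ a) (q : ℝ) : (a ^ 2) ^ (q / 2) = a ^ q := by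
  rw [← Real.rpow_natCast, ← Real.rpow_mul ha]
  congr 1
  push_cast
  ring

open Classical in
lemma integral_limit_cutPower (hr : 0 < r) (hrR : r ≤ R) (hq : q < 0) {a : ℝ} (ha : 0 ≤ a) :
    ∫ τ in a ^ 2..R ^ 2, (if r ^ 2 < τ ∧ τ < R ^ 2 then 1 / 2 * τ ^ (q / 2 - 1) else 0) =
      weight q r R a := by
  have hR : 0 < R := hr.trans_le hrR
  set θ : ℝ → ℝ := fun τ => if r ^ 2 < τ ∧ τ < R ^ 2 then 1 / 2 * τ ^ (q / 2 - 1) else 0 with hθ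
  have hmid : ∀ b, r ≤ b → b ≤ R → IntervalIntegrable θ volume (b ^ 2) (R ^ 2) ∧
      ∫ τ in b ^ 2..R ^ 2, θ τ = (b ^ q - R ^ q) / (-q) := by
    intro b hb hbR
    have hb0 : 0 < b := hr.trans_le hb
    have hbR2 : b ^ 2 ≤ R ^ 2 := pow_le_pow_left₀ hb0.le hbR 2
    have h0 : (0 : ℝ) ∉ uIcc (b ^ 2) (R ^ 2) := by
      rw [uIcc_of_le hbR2]
      intro h
      have := pow_pos hb0 2
      linarith [h.1]
    have hae : ∀ᵐ τ : ℝ, τ ∈ uIoc (b ^ 2) (R ^ 2) → 1 / 2 * τ ^ (q / 2 - 1) = θ τ := by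
      filter_upwards [Measure.ae_ne volume (R ^ 2)] with τ hτ hmem
      rw [uIoc_of_le hbR2] at hmem
      have h1 : r ^ 2 ≤ b ^ 2 := pow_le_pow_left₀ hr.le hb 2
      rw [hθ]
      simp only
      rw [if_pos ⟨by linarith [hmem.1], lt_of_le_of_ne hmem.2 hτ⟩]
    have hint : IntervalIntegrable (fun τ : ℝ => 1 / 2 * τ ^ (q / 2 - 1)) volume (b ^ 2) (R ^ 2) :=
      (intervalIntegral.intervalIntegrable_rpow (Or.inr h0)).const_mul _
    refine ⟨hint.congr_ae ((ae_restrict_iff' measurableSet_uIoc).2 hae), ?_⟩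
    rw [← intervalIntegral.integral_congr_ae hae, intervalIntegral.integral_const_mul,
      integral_rpow (Or.inr ⟨by linarith, h0⟩), sub_add_cancel, sq_rpow_half hR.le,
      sq_rpow_half hb0.le]
    field_simp
    ring
  rcases le_or_gt R a with h | h
  · rw [weight, if_neg (not_lt.2 h)]
    refine intervalIntegral.integral_zero_ae (Eventually.of_forall fun τ hτ => ?_)
    rw [uIoc_of_ge (pow_le_pow_left₀ hR.le h 2)] at hτ
    exact if_neg fun h' => absurd h'.2 (not_lt.2 hτ.1.le)
  · rw [weight, if_pos h]
    rcases le_or_gt r a with h1 | h1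
    · rw [max_eq_right h1]
      exact (hmid a h1 h.le).2
    · rw [max_eq_left h1.le]
      have h2 : a ^ 2 ≤ r ^ 2 := pow_le_pow_left₀ ha h1.le 2
      have hz : ∀ τ ∈ uIoc (a ^ 2) (r ^ 2), 0 = θ τ := by
        intro τ hτ
        rw [uIoc_of_le h2] at hτ
        exact (if_neg fun h' => absurd h'.1 (not_lt.2 hτ.2)).symm
      have hi0 : IntervalIntegrable θ volume (a ^ 2) (r ^ 2) :=
        (intervalIntegrable_const (c := (0 : ℝ))).congr hz
      rw [← intervalIntegral.integral_add_adjacent_intervals hi0 (hmid r le_rfl hrR).1,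
        (hmid r le_rfl hrR).2,
        intervalIntegral.integral_zero_ae (Eventually.of_forall fun τ hτ => (hz τ hτ).symm),
        zero_add]

lemma tendsto_smoothWeight (hr : 0 < r) (hrR : r ≤ R) (hq : q < 0) {a : ℝ} (ha : 0 ≤ a) :
    Tendsto (fun n => smoothWeight q r R n (a ^ 2)) atTop (𝓝 (weight q r R a)) := by
  classical
  rw [← integral_limit_cutPower hr hrR hq ha]
  refine intervalIntegral.tendsto_integral_filter_of_dominated_convergence
    (fun _ => 1 / 2 * (r ^ 2) ^ (q / 2 - 1))
    (Eventually.of_forall fun n => (contDiff_cutPower hr).continuous.aestronglyMeasurable)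
    (Eventually.of_forall fun n => Eventually.of_forall fun τ _ => ?_)
    intervalIntegrable_const (Eventually.of_forall fun τ _ => tendsto_cutPower q)
  rw [Real.norm_of_nonneg cutPower_nonneg]
  exact cutPower_le hr hq.le

lemma weight_nonneg (hr : 0 < r) (hrR : r ≤ R) (hq : q < 0) {a : ℝ} : 0 ≤ weight q r R a := by
  unfold weight
  split_ifs with h
  · refine div_nonneg (sub_nonneg.2 ?_) (by linarith)
    exact Real.rpow_le_rpow_of_nonpos (lt_max_of_lt_left hr) (max_le hrR h.le) hq.le
  · exact le_rfl

lemma integral_rpow_indicator (hr : 0 < r) (hrR : r ≤ R) (hq : q < 0) (a : ℝ) :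
    ∫ ρ in Ioc r R, (Ioi a).indicator (fun ρ => ρ ^ (q - 1)) ρ = weight q r R a := by
  rw [setIntegral_indicator measurableSet_Ioi, Ioc_inter_Ioi, weight]
  split_ifs with h
  · have hm : r ⊔ a ≤ R := max_le hrR h.le
    have hm0 : 0 < r ⊔ a := lt_max_of_lt_left hr
    rw [← intervalIntegral.integral_of_le hm, integral_rpow (Or.inr ⟨by linarith, ?_⟩),
      sub_add_cancel]
    · field_simp
      ring
    · rw [uIcc_of_le hm]
      exact fun h0 => absurd h0.1 (not_le.2 hm0)
  · rw [Ioc_eq_empty (not_lt.2 ((not_lt.1 h).trans (le_max_right _ _))), setIntegral_empty]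

end weight

/-! ### The monotonicity formula -/

lemma abs_weight_le {q r R : ℝ} (hr : 0 < r) (hrR : r ≤ R) (hq : q < 0) {a : ℝ} (ha : 0 ≤ a) :
    |weight q r R a| ≤ 1 / 2 * (r ^ 2) ^ (q / 2 - 1) * R ^ 2 :=
  le_of_tendsto (tendsto_smoothWeight hr hrR hq ha).abs
    (Eventually.of_forall fun n => abs_smoothWeight_le (n := n) hr hq.le (sq_nonneg a))

lemma measurable_weight (q r R : ℝ) : Measurable (weight q r R) := by
  unfold weight
  exact Measurable.ite measurableSet_Iio (by fun_prop) measurable_const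

/-- The inner variation inequality for the nonsmooth weight `weight (p - d) r R`, obtained as
a limit of smooth weights. -/
lemma IsEnergyMinimizer.inner_variation_weight {φ : ℝ → ℝ} {p A B C L : ℝ} {Qb Q : Pt d → Mat}
    (hQ : IsEnergyMinimizer Ω φ A B C L Qb Q) (hφ : IsElasticDensity φ p) (hd : d ≠ 0)
    (hΩ : IsOpen Ω) {q : ℝ} (hq : q < 0) {x₀ : Pt d} {r R : ℝ} (hr : 0 < r) (hrR : r ≤ R)
    (hball : Metric.ball x₀ R ⊆ Ω) :
    ∫ y in Ω, energyDensity Ω φ A B C L Q y *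
        (d * weight q r R ‖y - x₀‖ - if r < ‖y - x₀‖ ∧ ‖y - x₀‖ < R then ‖y - x₀‖ ^ q else 0) ≤
      ∫ y in Ω, dphi φ (gradNorm (weakGrad Ω Q y)) * gradNorm (weakGrad Ω Q y) *
        weight q r R ‖y - x₀‖ := by
  classical
  have hR : 0 < R := hr.trans_le hrR
  have hG := weakGrad_spec hQ.1.mem.exists_weakGrad
  have hgi := hQ.1.mem.integrable_grad
  have hgm : AEStronglyMeasurable (fun y => gradNorm (weakGrad Ω Q y)) (volume.restrict Ω) :=
    aestronglyMeasurable_gradNorm fun k i j => hG.aestronglyMeasurable_grad k i j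
  have hei : IntegrableOn (energyDensity Ω φ A B C L Q) Ω volume :=
    hgi.add (hQ.1.integrable_bulk.const_mul _)
  have hdi : IntegrableOn (fun y => dphi φ (gradNorm (weakGrad Ω Q y)) *
      gradNorm (weakGrad Ω Q y)) Ω volume :=
    hφ.integrable_dphi_mul hgm (fun y => gradNorm_nonneg _) hgi
  set Θ : ℝ := 1 / 2 * (r ^ 2) ^ (q / 2 - 1) with hΘ
  have hΘ0 : 0 ≤ Θ := by positivity
  have hχc : ∀ n, Continuous (fun y : Pt d => smoothWeight q r R n (‖y - x₀‖ ^ 2)) := fun n =>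
    (contDiff_smoothWeight hr).continuous.comp (by fun_prop)
  have hsc : ∀ n, Continuous (fun y : Pt d => cutPower q r R n (‖y - x₀‖ ^ 2)) := fun n =>
    (contDiff_cutPower hr).continuous.comp (by fun_prop)
  have hineq : ∀ n, ∫ y in Ω, energyDensity Ω φ A B C L Q y *
        (d * smoothWeight q r R n (‖y - x₀‖ ^ 2) +
          2 * (-cutPower q r R n (‖y - x₀‖ ^ 2) * ‖y - x₀‖ ^ 2)) ≤
      ∫ y in Ω, dphi φ (gradNorm (weakGrad Ω Q y)) * gradNorm (weakGrad Ω Q y) *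
        smoothWeight q r R n (‖y - x₀‖ ^ 2) := by
    intro n
    have hn : (0 : ℝ) < 1 / (n + 1) := by positivity
    have hrn : √(R ^ 2 - 1 / (n + 1)) < R := by
      rw [Real.sqrt_lt' hR]
      linarith
    have h1 := hQ.inner_variation hφ hd hΩ (contDiff_smoothWeight (q := q) (R := R) (n := n) hr)
      (fun t => by
        rw [(hasDerivAt_smoothWeight hr).deriv]
        exact neg_nonpos.2 cutPower_nonneg)
      (x₀ := x₀) (Real.sqrt_nonneg (R ^ 2 - 1 / (n + 1)))
      (fun t ht => smoothWeight_eq_zero (by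
        rw [Real.sq_sqrt'] at ht
        exact (le_max_left _ _).trans ht))
      ((Metric.closedBall_subset_ball hrn).trans hball)
    simpa only [(hasDerivAt_smoothWeight hr).deriv] using h1
  have hcut : ∀ n (y : Pt d), |cutPower q r R n (‖y - x₀‖ ^ 2) * ‖y - x₀‖ ^ 2| ≤ Θ * R ^ 2 := by
    intro n y
    rcases le_or_gt (R ^ 2) (‖y - x₀‖ ^ 2) with h | h
    · have hn : (0 : ℝ) < 1 / (n + 1) := by positivity
      rw [cutPower_eq_zero_of_ge (by linarith), zero_mul, abs_zero]
      positivity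
    · rw [abs_mul, abs_of_nonneg cutPower_nonneg, abs_of_nonneg (sq_nonneg _)]
      exact mul_le_mul (cutPower_le hr hq.le) h.le (sq_nonneg _) hΘ0
  have hlimcut : ∀ y : Pt d, Tendsto
      (fun n => 2 * (-cutPower q r R n (‖y - x₀‖ ^ 2) * ‖y - x₀‖ ^ 2)) atTop
      (𝓝 (-if r < ‖y - x₀‖ ∧ ‖y - x₀‖ < R then ‖y - x₀‖ ^ q else 0)) := by
    intro y
    have h1 := (((tendsto_cutPower (r := r) (R := R) (t := ‖y - x₀‖ ^ 2) q).neg).mul_const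
      (‖y - x₀‖ ^ 2)).const_mul 2
    convert h1 using 2
    have e : (r ^ 2 < ‖y - x₀‖ ^ 2 ∧ ‖y - x₀‖ ^ 2 < R ^ 2) ↔ (r < ‖y - x₀‖ ∧ ‖y - x₀‖ < R) := by
      rw [sq_lt_sq₀ hr.le (norm_nonneg _), sq_lt_sq₀ (norm_nonneg _) hR.le]
    simp only [e]
    split_ifs with h
    · have h0 : 0 < ‖y - x₀‖ ^ 2 := pow_pos (hr.trans h.1) 2
      rw [← sq_rpow_half (norm_nonneg (y - x₀)) q]
      have h2 : (‖y - x₀‖ ^ 2) ^ (q / 2) = (‖y - x₀‖ ^ 2) ^ (q / 2 - 1) * ‖y - x₀‖ ^ 2 := by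
        rw [← Real.rpow_add_one h0.ne', sub_add_cancel]
      rw [h2]
      ring
    · simp
  have hleft := tendsto_integral_of_dominated_convergence (μ := volume.restrict Ω)
    (F := fun n y => energyDensity Ω φ A B C L Q y *
        (d * smoothWeight q r R n (‖y - x₀‖ ^ 2) +
          2 * (-cutPower q r R n (‖y - x₀‖ ^ 2) * ‖y - x₀‖ ^ 2)))
    (f := fun y => energyDensity Ω φ A B C L Q y *
        (d * weight q r R ‖y - x₀‖ - if r < ‖y - x₀‖ ∧ ‖y - x₀‖ < R then ‖y - x₀‖ ^ q else 0))
    (fun y => ‖energyDensity Ω φ A B C L Q y‖ * (d * (Θ * R ^ 2) + 2 * (Θ * R ^ 2)))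
    (fun n => hei.aestronglyMeasurable.mul (Continuous.aestronglyMeasurable
      (((hχc n).const_mul _).add ((((hsc n).neg).mul (by fun_prop)).const_mul _))))
    (hei.norm.mul_const _)
    (fun n => Eventually.of_forall fun y => ?_) (Eventually.of_forall fun y => ?_)
  · have hright := tendsto_integral_of_dominated_convergence (μ := volume.restrict Ω)
      (F := fun n y => dphi φ (gradNorm (weakGrad Ω Q y)) * gradNorm (weakGrad Ω Q y) *
        smoothWeight q r R n (‖y - x₀‖ ^ 2))
      (f := fun y => dphi φ (gradNorm (weakGrad Ω Q y)) * gradNorm (weakGrad Ω Q y) *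
        weight q r R ‖y - x₀‖)
      (fun y => ‖dphi φ (gradNorm (weakGrad Ω Q y)) * gradNorm (weakGrad Ω Q y)‖ * (Θ * R ^ 2))
      (fun n => hdi.aestronglyMeasurable.mul (hχc n).aestronglyMeasurable)
      (hdi.norm.mul_const _)
      (fun n => Eventually.of_forall fun y => ?_) (Eventually.of_forall fun y => ?_)
    · exact le_of_tendsto_of_tendsto' hleft hright hineq
    · rw [norm_mul _ (smoothWeight _ _ _ _ _)]
      gcongr
      exact abs_smoothWeight_le hr hq.le (sq_nonneg _)
    · exact (tendsto_smoothWeight hr hrR hq (norm_nonneg _)).const_mul _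
  · rw [norm_mul]
    refine mul_le_mul_of_nonneg_left ((norm_add_le _ _).trans ?_) (norm_nonneg _)
    rw [norm_mul, norm_mul, Real.norm_of_nonneg (Nat.cast_nonneg _),
      Real.norm_of_nonneg zero_le_two, neg_mul, norm_neg]
    gcongr
    · exact abs_smoothWeight_le hr hq.le (sq_nonneg _)
    · exact hcut n y
  · rw [sub_eq_add_neg]
    exact (((tendsto_smoothWeight hr hrR hq (norm_nonneg _)).const_mul _).add
      (hlimcut y)).const_mul _

lemma one_div_rpow_eq {r : ℝ} (hr : 0 < r) (p : ℝ) (d : ℕ) :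
    1 / r ^ ((d : ℝ) - p) = r ^ (p - d) := by
  rw [one_div, ← Real.rpow_neg hr.le, neg_sub]

/-- The almost-monotonicity of the rescaled energy, with the error term as an integral over `Ω`. -/
lemma IsEnergyMinimizer.rescaledEnergy_le {φ : ℝ → ℝ} {p A B C L : ℝ} {Qb Q : Pt d → Mat}
    (hQ : IsEnergyMinimizer Ω φ A B C L Qb Q) (hφ : IsElasticDensity φ p) (hd : 2 ≤ d)
    (hΩ : IsOpen Ω) (hC : 0 < C) (hL : 0 < L) {x₀ : Pt d} {r R : ℝ} (hr : 0 < r) (hrR : r ≤ R)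
    (hball : Metric.ball x₀ R ⊆ Ω) :
    rescaledEnergy Ω φ p A B C L Q x₀ r ≤ rescaledEnergy Ω φ p A B C L Q x₀ R +
      ∫ y in Ω, xi φ p (gradNorm (weakGrad Ω Q y)) * weight (p - d) r R ‖y - x₀‖ := by
  have hR : 0 < R := hr.trans_le hrR
  have hd' : (2 : ℝ) ≤ d := by exact_mod_cast hd
  have hp := hφ.p_lt_two
  have hp1 := hφ.one_lt_p
  set q : ℝ := p - d with hqdef
  have hq : q < 0 := by linarith
  have hG := weakGrad_spec hQ.1.mem.exists_weakGrad
  have hgi := hQ.1.mem.integrable_grad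
  have hgm : AEStronglyMeasurable (fun y => gradNorm (weakGrad Ω Q y)) (volume.restrict Ω) :=
    aestronglyMeasurable_gradNorm fun k i j => hG.aestronglyMeasurable_grad k i j
  set e : Pt d → ℝ := energyDensity Ω φ A B C L Q with he
  have hei : IntegrableOn e Ω volume := hgi.add (hQ.1.integrable_bulk.const_mul _)
  have hbulk : ∀ᵐ y ∂(volume.restrict Ω), 0 ≤ 1 / L * bulk A B C (Q y) := by
    filter_upwards [hQ.1.values] with y hy
    exact mul_nonneg (by positivity) (bulk_nonneg hC hy)
  set W : Pt d → ℝ := fun y => weight q r R ‖y - x₀‖ with hW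
  have hWm : AEStronglyMeasurable W (volume.restrict Ω) :=
    ((measurable_weight q r R).comp (by fun_prop)).aestronglyMeasurable
  have hWb : ∀ y, ‖W y‖ ≤ 1 / 2 * (r ^ 2) ^ (q / 2 - 1) * R ^ 2 := fun y =>
    abs_weight_le hr hrR hq (norm_nonneg _)
  have hW0 : ∀ y, 0 ≤ W y := fun y => weight_nonneg hr hrR hq
  set ξ : Pt d → ℝ := fun y => xi φ p (gradNorm (weakGrad Ω Q y)) with hξ
  have hξi : IntegrableOn ξ Ω volume := hφ.integrable_xi hgm (fun y => gradNorm_nonneg _) hgi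
  have hξW : IntegrableOn (fun y => ξ y * W y) Ω volume :=
    hξi.mul_bdd hWm (Eventually.of_forall hWb)
  have heW : IntegrableOn (fun y => e y * W y) Ω volume :=
    hei.mul_bdd hWm (Eventually.of_forall hWb)
  have hdW : IntegrableOn (fun y => dphi φ (gradNorm (weakGrad Ω Q y)) *
      gradNorm (weakGrad Ω Q y) * W y) Ω volume :=
    (hφ.integrable_dphi_mul hgm (fun y => gradNorm_nonneg _) hgi).mul_bdd hWm
      (Eventually.of_forall hWb)
  have hmain := hQ.inner_variation_weight hφ (by omega) hΩ hq hr hrR hball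
  have h1 : ∫ y in Ω, dphi φ (gradNorm (weakGrad Ω Q y)) * gradNorm (weakGrad Ω Q y) * W y ≤
      (∫ y in Ω, ξ y * W y) + ∫ y in Ω, p * (e y * W y) := by
    rw [← integral_add hξW (heW.const_mul p)]
    refine integral_mono_ae hdW (hξW.add (heW.const_mul p)) ?_
    filter_upwards [hbulk] with y hy
    have h2 : 0 ≤ p * (1 / L * bulk A B C (Q y) * W y) :=
      mul_nonneg (by linarith) (mul_nonneg hy (hW0 y))
    simp only [hξ, xi, he, energyDensity]
    linarith
  have hannm : Measurable fun y : Pt d =>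
      if r < ‖y - x₀‖ ∧ ‖y - x₀‖ < R then ‖y - x₀‖ ^ q else 0 := by
    refine Measurable.ite ?_ (by fun_prop) measurable_const
    have hnorm : Measurable fun y : Pt d => ‖y - x₀‖ := by fun_prop
    exact (measurableSet_lt measurable_const hnorm).inter (measurableSet_lt hnorm measurable_const)
  have hannb : ∀ y : Pt d, ‖if r < ‖y - x₀‖ ∧ ‖y - x₀‖ < R then ‖y - x₀‖ ^ q else 0‖ ≤ r ^ q := by
    intro y
    split_ifs with h
    · rw [Real.norm_of_nonneg (by positivity)]
      exact Real.rpow_le_rpow_of_nonpos hr h.1.le hq.le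
    · simp only [norm_zero]
      positivity
  have hann : IntegrableOn (fun y => e y *
      if r < ‖y - x₀‖ ∧ ‖y - x₀‖ < R then ‖y - x₀‖ ^ q else 0) Ω volume :=
    hei.mul_bdd hannm.aestronglyMeasurable (Eventually.of_forall hannb)
  have hfull : IntegrableOn (fun y => e y * (d * W y -
      if r < ‖y - x₀‖ ∧ ‖y - x₀‖ < R then ‖y - x₀‖ ^ q else 0)) Ω volume := by
    refine ((heW.const_mul d).sub hann).congr (Eventually.of_forall fun y => ?_)
    simp only [Pi.sub_apply]
    ring
  have hr' : IntegrableOn (fun y => (Metric.ball x₀ r).indicator e y) Ω volume :=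
    hei.indicator Metric.isOpen_ball.measurableSet
  have hR' : IntegrableOn (fun y => (Metric.ball x₀ R).indicator e y) Ω volume :=
    hei.indicator Metric.isOpen_ball.measurableSet
  have hset : ∀ s, s ≤ R → ∫ y in Ω, (Metric.ball x₀ s).indicator e y =
      ∫ y in Metric.ball x₀ s, e y := by
    intro s hs
    rw [setIntegral_indicator Metric.isOpen_ball.measurableSet,
      inter_eq_right.2 ((Metric.ball_subset_ball hs).trans hball)]
  have h3 : r ^ q * (∫ y in Metric.ball x₀ r, e y) - R ^ q * (∫ y in Metric.ball x₀ R, e y) ≤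
      (∫ y in Ω, e y * (d * W y -
        if r < ‖y - x₀‖ ∧ ‖y - x₀‖ < R then ‖y - x₀‖ ^ q else 0)) - ∫ y in Ω, p * (e y * W y) := by
    rw [← hset r hrR, ← hset R le_rfl, ← integral_const_mul, ← integral_const_mul,
      ← integral_sub (hr'.const_mul _) (hR'.const_mul _),
      ← integral_sub hfull (heW.const_mul p)]
    refine integral_mono_ae ((hr'.const_mul _).sub (hR'.const_mul _))
      (hfull.sub (heW.const_mul p)) ?_
    filter_upwards [hbulk] with y hy
    have he0 : 0 ≤ e y := add_nonneg (hφ.nonneg (gradNorm_nonneg _)) hy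
    have hq0 : q ≠ 0 := hq.ne
    have hdp : (d : ℝ) = p - q := by rw [hqdef]; ring
    simp only [hW, weight, hdp, indicator, Metric.mem_ball, dist_eq_norm]
    rcases lt_trichotomy ‖y - x₀‖ r with h | h | h
    · rw [if_pos h, if_pos (h.trans_le hrR), if_pos (h.trans_le hrR), if_neg (by
        intro h'; linarith [h'.1]), max_eq_left h.le]
      apply le_of_eq
      field_simp
      ring
    -- on the sphere `|y - x₀| = r` the two sides differ by the nonnegative term `r ^ q * e y`
    · simp only [h, lt_irrefl, false_and, if_false, max_self]
      split_ifs with h4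
      · have h5 : 0 ≤ r ^ q * e y := by positivity
        have h6 : e y * ((p - q) * ((r ^ q - R ^ q) / -q) - 0) -
            p * (e y * ((r ^ q - R ^ q) / -q)) = r ^ q * e y - R ^ q * e y := by
          field_simp
          ring
        rw [h6]
        linarith
      · simp
    · rw [if_neg h.not_gt]
      by_cases h4 : ‖y - x₀‖ < R
      · rw [if_pos h4, if_pos h4, if_pos ⟨h, h4⟩, max_eq_right h.le]
        apply le_of_eq
        field_simp
        ring
      · rw [if_neg h4, if_neg h4, if_neg fun h' => h4 h'.2]
        simp
  rw [rescaledEnergy, rescaledEnergy, one_div_rpow_eq hr, one_div_rpow_eq hR]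
  have h7 := hmain.trans h1
  linarith

/-- Fubini's theorem for the error term. -/
lemma integral_errorDensity {φ : ℝ → ℝ} {p : ℝ} {Q : Pt d → Mat} (hpd : p < d)
    (hξ : IntegrableOn (fun y => xi φ p (gradNorm (weakGrad Ω Q y))) Ω volume)
    {x₀ : Pt d} {r R : ℝ} (hr : 0 < r) (hrR : r ≤ R) (hball : Metric.ball x₀ R ⊆ Ω) :
    IntervalIntegrable (errorDensity Ω φ p Q x₀) volume r R ∧
      ∫ ρ in r..R, errorDensity Ω φ p Q x₀ ρ =
        ∫ y in Ω, xi φ p (gradNorm (weakGrad Ω Q y)) * weight (p - d) r R ‖y - x₀‖ := by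
  set q : ℝ := p - d with hqdef
  have hq : q < 0 := by linarith
  set ξ : Pt d → ℝ := fun y => xi φ p (gradNorm (weakGrad Ω Q y)) with hξdef
  set k : ℝ → Pt d → ℝ := fun ρ y => (Ioi ‖y - x₀‖).indicator (fun ρ => ρ ^ (q - 1)) ρ with hk
  have hkm : Measurable (Function.uncurry k) := by
    have h1 : Function.uncurry k = {z : ℝ × Pt d | ‖z.2 - x₀‖ < z.1}.indicator
        fun z => z.1 ^ (q - 1) := by
      ext z
      simp [Function.uncurry, hk, indicator]
    rw [h1]
    have hnorm : Measurable fun z : ℝ × Pt d => ‖z.2 - x₀‖ := by fun_prop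
    exact Measurable.indicator (by fun_prop) (measurableSet_lt hnorm measurable_fst)
  have hprod : Integrable (fun z : ℝ × Pt d => Function.uncurry k z * ξ z.2)
      ((volume.restrict (Ioc r R)).prod (volume.restrict Ω)) := by
    refine Integrable.bdd_mul (c := r ^ (q - 1)) (hξ.comp_snd _) hkm.aestronglyMeasurable ?_
    have h1 : ∀ᵐ z ∂((volume.restrict (Ioc r R)).prod (volume.restrict Ω)), z.1 ∈ Ioc r R :=
      Measure.quasiMeasurePreserving_fst.ae (ae_restrict_mem measurableSet_Ioc)
    filter_upwards [h1] with z hz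
    have hz0 : 0 < z.1 := hr.trans hz.1
    refine (norm_indicator_le_norm_self (fun ρ : ℝ => ρ ^ (q - 1)) z.1).trans ?_
    rw [Real.norm_of_nonneg (by positivity)]
    exact Real.rpow_le_rpow_of_nonpos hr hz.1.le (by linarith)
  have hslice : ∀ ρ, ρ ≤ R → ∫ y in Ω, k ρ y * ξ y = errorDensity Ω φ p Q x₀ ρ := by
    intro ρ hρ
    have h1 : ∀ y, k ρ y * ξ y = (Metric.ball x₀ ρ).indicator (fun y => ρ ^ (q - 1) * ξ y) y := by
      intro y
      simp only [hk, indicator, mem_Ioi, Metric.mem_ball, dist_eq_norm]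
      split_ifs <;> simp
    simp only [h1]
    rw [setIntegral_indicator Metric.isOpen_ball.measurableSet,
      inter_eq_right.2 ((Metric.ball_subset_ball hρ).trans hball), integral_const_mul]
    rfl
  constructor
  · rw [intervalIntegrable_iff_integrableOn_Ioc_of_le hrR]
    refine Integrable.congr hprod.integral_prod_left ?_
    filter_upwards [ae_restrict_mem measurableSet_Ioc] with ρ hρ
    exact hslice ρ hρ.2
  · rw [intervalIntegral.integral_of_le hrR]
    have h2 := integral_integral_swap (f := fun ρ y => k ρ y * ξ y) hprod
    rw [← setIntegral_congr_fun measurableSet_Ioc fun ρ hρ => hslice ρ hρ.2, h2]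
    refine integral_congr_ae (Eventually.of_forall fun y => ?_)
    simp only
    rw [integral_mul_const, hk, integral_rpow_indicator hr hrR hq, mul_comm]

lemma setIntegral_ball_le {f : Pt d → ℝ} {K : ℝ} (hf : ∀ y, f y ≤ K) {x₀ : Pt d}
    {ρ : ℝ} (hρ : 0 < ρ) (hi : IntegrableOn f (Metric.ball x₀ ρ) volume) :
    ∫ y in Metric.ball x₀ ρ, f y ≤ K * (volume.real (Metric.ball (0 : Pt d) 1) * ρ ^ d) := by
  have hfin : volume (Metric.ball x₀ ρ) ≠ ⊤ := measure_ball_lt_top.ne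
  calc ∫ y in Metric.ball x₀ ρ, f y ≤ ∫ _y in Metric.ball x₀ ρ, K :=
        integral_mono hi (integrableOn_const hfin) hf
    _ = K * (volume.real (Metric.ball (0 : Pt d) 1) * ρ ^ d) := by
        rw [setIntegral_const, smul_eq_mul, measureReal_def, measureReal_def,
          Measure.addHaar_ball_of_pos volume x₀ hρ, ENNReal.toReal_mul,
          ENNReal.toReal_ofReal (by positivity), finrank_euclideanSpace_fin]
        ring

end LdG

theorem lemma3 (d : ℕ) (hd : d = 2 ∨ d = 3) (φ : ℝ → ℝ) (p : ℝ)
    (hφ : LdG.IsElasticDensity φ p) :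
    ∃ M : ℝ, 0 < M ∧
      ∀ (Ω : Set (LdG.Pt d)), LdG.IsBoundedSmoothDomain Ω →
      ∀ (A B C L : ℝ), 0 < A → 0 < B → 0 < C → 0 < L →
      ∀ (Qb Q : LdG.Pt d → LdG.Mat), LdG.IsBoundaryDatum Ω φ A B C Qb →
        LdG.IsEnergyMinimizer Ω φ A B C L Qb Q →
      ∀ (x₀ : LdG.Pt d), x₀ ∈ Ω →
      ∀ (r R : ℝ), 0 < r → r ≤ R → Metric.ball x₀ R ⊆ Ω →
        IntegrableOn (fun x => LdG.xi φ p (LdG.gradNorm (LdG.weakGrad Ω Q x)))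
          (Metric.ball x₀ R) volume ∧
        IntervalIntegrable (LdG.errorDensity Ω φ p Q x₀) volume r R ∧
        LdG.rescaledEnergy Ω φ p A B C L Q x₀ r ≤
          LdG.rescaledEnergy Ω φ p A B C L Q x₀ R
            + ∫ ρ in r..R, LdG.errorDensity Ω φ p Q x₀ ρ ∧
        LdG.rescaledEnergy Ω φ p A B C L Q x₀ R
            + ∫ ρ in r..R, LdG.errorDensity Ω φ p Q x₀ ρ ≤
          LdG.rescaledEnergy Ω φ p A B C L Q x₀ R + M * (R ^ p - r ^ p) := by
  obtain ⟨K₀, hK₀⟩ := hφ.subquadratic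
  set K : ℝ := max K₀ 0 with hK
  have hK0 : 0 ≤ K := le_max_right _ _
  have hξK : ∀ t, 0 ≤ t → LdG.xi φ p t ≤ K := fun t ht =>
    (hK₀ ⟨t, ht, rfl⟩).trans (le_max_left _ _)
  have hp0 : 0 < p := zero_lt_one.trans hφ.one_lt_p
  have hd2 : 2 ≤ d := by rcases hd with rfl | rfl <;> norm_num
  have hpd : p < d := hφ.p_lt_two.trans_le (by exact_mod_cast hd2)
  set v : ℝ := volume.real (Metric.ball (0 : LdG.Pt d) 1)
  have hv0 : 0 ≤ v := measureReal_nonneg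
  refine ⟨K * v / p + 1, by positivity, ?_⟩
  intro Ω hΩ A B C L _ _ hC hL Qb Q _ hQ x₀ _ r R hr hrR hball
  have hgm : AEStronglyMeasurable (fun y => LdG.gradNorm (LdG.weakGrad Ω Q y))
      (volume.restrict Ω) := LdG.aestronglyMeasurable_gradNorm fun k i j =>
    (LdG.weakGrad_spec hQ.1.mem.exists_weakGrad).aestronglyMeasurable_grad k i j
  have hξi := hφ.integrable_xi hgm (fun y => LdG.gradNorm_nonneg _) hQ.1.mem.integrable_grad
  obtain ⟨hint, heq⟩ := LdG.integral_errorDensity hpd hξi hr hrR hball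
  refine ⟨IntegrableOn.mono_set hξi hball, hint, ?_, ?_⟩
  · rw [heq]
    exact hQ.rescaledEnergy_le hφ hd2 hΩ.isOpen hC hL hr hrR hball
  · refine add_le_add_right ?_ _
    have hpt : ∀ ρ ∈ Icc r R, LdG.errorDensity Ω φ p Q x₀ ρ ≤ K * v * ρ ^ (p - 1) := by
      intro ρ hρ
      have hρ0 : 0 < ρ := hr.trans_le hρ.1
      have h1 := LdG.setIntegral_ball_le (fun y => hξK _ (LdG.gradNorm_nonneg
        (LdG.weakGrad Ω Q y))) hρ0 (IntegrableOn.mono_set hξi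
          ((Metric.ball_subset_ball hρ.2).trans hball))
      have h2 : ρ ^ (p - 1) = ρ ^ (p - d - 1) * ρ ^ d := by
        rw [← Real.rpow_natCast, ← Real.rpow_add hρ0]
        congr 1
        ring
      calc LdG.errorDensity Ω φ p Q x₀ ρ
          ≤ ρ ^ (p - d - 1) * (K * (v * ρ ^ d)) :=
            mul_le_mul_of_nonneg_left h1 (by positivity)
        _ = K * v * ρ ^ (p - 1) := by rw [h2]; ring
    have hpow : IntervalIntegrable (fun ρ : ℝ => K * v * ρ ^ (p - 1)) volume r R :=
      (intervalIntegral.intervalIntegrable_rpow' (by linarith [hφ.one_lt_p])).const_mul _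
    refine (intervalIntegral.integral_mono_on hrR hint hpow hpt).trans ?_
    rw [intervalIntegral.integral_const_mul,
      integral_rpow (Or.inl (by linarith [hφ.one_lt_p])), sub_add_cancel]
    have h3 : 0 ≤ R ^ p - r ^ p := sub_nonneg.2 (Real.rpow_le_rpow hr.le hrR hp0.le)
    have h4 : K * v * ((R ^ p - r ^ p) / p) = K * v / p * (R ^ p - r ^ p) := by ring
    rw [h4]
    linarith
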